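/- \textbf{Conventions.} $\mathrm{Top}_*$ is the category of based sequential topological spaces (spaces on which sequential continuity implies continuity, e.g. all first-countable spaces), with the products of that category (for first-countable spaces these are the usual products); $X\wedge Y=X\times Y/X\vee Y$. For finite sets $A\ni a$ and $B$ put $A\cup_aB=(A\setminus\{a\})\sqcup B$. An operad $\mathcal Q$ in $\mathrm{Top}_*$ is a functor from finite sets and bijections to $\mathrm{Top}_*$ with $\mathcal Q(\emptyset)=*$, with natural, associative and unital partial compositions $\mathcal Q(A)\wedge\mathcal Q(B)\to\mathcal Q(A\cup_aB)$ and a unit $S^0\to\mathcal Q(1)$. A cooperad is an operad in $\mathrm{Top}_*^{op}$: natural, coassociative and counital decompositions $\mathcal C(A\cup_aB)\to\mathcal C(A)\wedge\mathcal C(B)$ with counit $\mathcal C(1)\to S^0$. The unit operad $\mathcal I$ is $S^0$ in arity $1$ and $*$ in other arities. $\mathcal Q$ is augmented if it is equipped with an operad map $\mathcal Q\to\mathcal I$, and strongly augmented if moreover $\mathcal Q(1)\to S^0$ sends non-base points to the non-base point. $\mathcal Q$ need not be reduced, i.e. $\mathcal Q(1)$ is arbitrary. Trees are finite rooted trees without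 vertices of arity $0$, with leaves labelled bijectively by a finite set $S$ (the tree with one edge and no vertex is allowed). A vertex of arity $1$ is unstable. A branch is an edge of the underlying stable tree (obtained by erasing the unstable vertices), that is a maximal chain of edges meeting at unstable vertices; its weight is the sum of the weights of its edges. A weighted tree has edge weights in $[0,1]$ adding up to $1$ along each path from a leaf to the root. \textbf{Bar construction.} $\mathsf B(\mathcal Q)(S)$ is the quotient of the disjoint union of a base point and of the spaces $\prod_{v}\mathcal Q(\mathrm{in}(v))\times w(\mathsf T)$ over all trees $\mathsf T$ labelled by $S$, where $\mathrm{in}(v)$ is the set of incoming edges of the vertex $v$ and $w(\mathsf T)$ is the space of weightings, by: isomorphism of trees; a tree with a vertex label equal to the base point, or with a root or leaf branch of weight $0$, is the base point; (1) an internal edge of weight $0$ may be contracted, composing the two adjacent labels in $\mathcal Q$; (2) an arity-one vertex labelled by the operadic unit may be removed, adding the adjacent weights; (3) at a root or leaf edge of weight $0$ on a branch of non-zero weight, the augmentation may be applied to the label of the adjacent unstable vertex (giving the base point, or the removal of the vertex). \textbf{Proposition.} Let $\mathcal Q$ be a strongly augmented operad in $\mathrm{Top}_*$. Then $\mathsf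 B(\mathcal Q)$ carries a cooperad structure whose decomposition maps $$\mathsf B(\mathcal Q)(A\cup_aB)\to\mathsf B(\mathcal Q)(A)\wedge\mathsf B(\mathcal Q)(B)$$ are given on representatives $\Psi=(\mathsf T,q_*,w)$ as follows, and whose counit sends exactly the base point of $\mathsf B(\mathcal Q)(1)$ to the base point of $S^0$. (i) If no branch of $\mathsf T$ has $B$ as the set of labels of the leaves above it (i.e. the underlying stable tree is not a graft $\mathsf t_A\circ_a\mathsf t_B$), or if the branch with this property has weight $0$, then $\Psi$ is sent to the base point. (ii) Otherwise let $E$ be that branch. Then $\Psi\mapsto\Psi_A\wedge\Psi_B$, where the underlying stable trees of $\Psi_A$, $\Psi_B$ are $\mathsf t_A$, $\mathsf t_B$, and $E$ with all its edges and its unstable vertices and their labels is duplicated: one copy becomes the branch of the leaf $a$ of $\Psi_A$, the other becomes the root branch of $\Psi_B$. All other vertices keep their labels, and those above $E$ go to $\Psi_B$, the remaining ones to $\Psi_A$. In $\Psi_A$ the weights on the copy of $E$ are multiplied by the unique constant for which the weights on the path from the leaf $a$ to the root add up to $1$, and all other weights are kept; in $\Psi_B$ all weights are multiplied by the unique constant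 for which they add up to $1$ on each path from a leaf to the root. -/

import Mathlib

open Filter Topology

universe u v

noncomputable section

namespace OpBar

/-! ## Based sequential spaces and their smash product -/

/-- The sequential coreflection of a topology: the open sets are the sequentially open sets of `t`.
The products of the category of sequential spaces (the spaces on which sequential continuity
implies continuity) are the coreflections of the ordinary products. -/
@[reducible]
def seqCoreflection {X : Type*} (t : TopologicalSpace X) : TopologicalSpace X where
  IsOpen U := ∀ x ∈ U, ∀ s : ℕ → X, Tendsto s atTop (@nhds X t x) → ∀ᶠ n in atTop, s n ∈ U
  isOpen_univ := fun _ _ _ _ => Eventually.of_forall fun _ => trivial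
  isOpen_inter := fun _ _ hU hV x hx s hs => (hU x hx.1 s hs).and (hV x hx.2 s hs)
  isOpen_sUnion := fun _ hF x hx s hs => by
    obtain ⟨U, hU, hxU⟩ := hx
    exact (hF U hU x hxU s hs).mono fun _ hn => ⟨U, hU, hn⟩

theorem seqCoreflection_le {X : Type*} (t : TopologicalSpace X) : seqCoreflection t ≤ t := by
  intro U hU x hx s hs
  exact hs (@IsOpen.mem_nhds X t x U hU hx)

theorem tendsto_seqCoreflection {X : Type*} (t : TopologicalSpace X) {s : ℕ → X} {x : X}
    (hs : Tendsto s atTop (@nhds X t x)) : Tendsto s atTop (@nhds X (seqCoreflection t) x) := by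
  intro N hN
  obtain ⟨U, hUN, hU, hxU⟩ := (@mem_nhds_iff X (seqCoreflection t) x N).1 hN
  exact (hU x hxU s hs).mono fun _ hn => hUN hn

theorem seqCoreflection_sequentialSpace {X : Type*} (t : TopologicalSpace X) :
    @SequentialSpace X (seqCoreflection t) := by
  let _ := seqCoreflection t
  refine ⟨fun C hC => ?_⟩
  rw [← isOpen_compl_iff]
  intro x hx s hs
  by_contra hcon
  rw [not_eventually] at hcon
  obtain ⟨φ, hφ, hφC⟩ := extraction_of_frequently_atTop hcon
  exact hx (hC (fun n => not_not.1 (hφC n))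
    (tendsto_seqCoreflection t (hs.comp hφ.tendsto_atTop)))

/-- On a sequential space, in particular on a first-countable one, nothing changes. -/
theorem seqCoreflection_eq {X : Type*} (t : TopologicalSpace X) [h : SequentialSpace X] :
    seqCoreflection t = t := by
  refine le_antisymm (seqCoreflection_le t) fun U hU => ?_
  rw [← isClosed_compl_iff]
  refine h.isClosed_of_seq _ fun s x hs hx => fun hxU => ?_
  obtain ⟨n, hn⟩ := (hU x hxU s hx).exists
  exact hs n hn

/-- The product of two spaces in the category of sequential spaces. -/
def SeqProd (X Y : Type*) := X × Y

instance {X Y : Type*} [TopologicalSpace X] [TopologicalSpace Y] :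
    TopologicalSpace (SeqProd X Y) :=
  seqCoreflection (instTopologicalSpaceProd : TopologicalSpace (X × Y))

/-- A chosen base point. -/
class Based (X : Type*) where
  pt : X

/-- Based continuous maps. -/
structure BasedMap (X Y : Type*) [TopologicalSpace X] [Based X] [TopologicalSpace Y] [Based Y] where
  toFun : X → Y
  continuous_toFun : Continuous toFun
  map_pt : toFun Based.pt = Based.pt

instance {X Y : Type*} [TopologicalSpace X] [Based X] [TopologicalSpace Y] [Based Y] :
    CoeFun (BasedMap X Y) (fun _ => X → Y) := ⟨BasedMap.toFun⟩

/-- The identity as a based map. -/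
def BasedMap.id (X : Type*) [TopologicalSpace X] [Based X] : BasedMap X X :=
  ⟨fun x => x, continuous_id, rfl⟩

/-- The two-point based space `S⁰`, with base point `false`. -/
instance : Based Bool := ⟨false⟩

/-- The pairs with at least one coordinate at the base point. -/
def InWedge {X Y : Type*} [Based X] [Based Y] (p : SeqProd X Y) : Prop :=
  p.1 = Based.pt ∨ p.2 = Based.pt

/-- The smash product `X ∧ Y`: the product with the wedge `X ∨ Y` collapsed to a point. -/
def Smash (X Y : Type*) [Based X] [Based Y] :=
  Quot (fun p q : SeqProd X Y => InWedge p ∧ InWedge q)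

namespace Smash

variable {X Y Z X' Y' : Type*} [Based X] [Based Y] [Based Z] [Based X'] [Based Y']

/-- The point `x ∧ y`. -/
def mk (x : X) (y : Y) : Smash X Y := Quot.mk _ ((x, y) : X × Y)

instance : Based (Smash X Y) := ⟨mk Based.pt Based.pt⟩

instance [TopologicalSpace X] [TopologicalSpace Y] : TopologicalSpace (Smash X Y) :=
  inferInstanceAs (TopologicalSpace (Quot _))

theorem mk_eq_pt {x : X} {y : Y} (h : x = Based.pt ∨ y = Based.pt) :
    mk x y = (Based.pt : Smash X Y) :=
  Quot.sound ⟨h, Or.inl rfl⟩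

theorem mk_pt_left (y : Y) : mk (Based.pt : X) y = (Based.pt : Smash X Y) := mk_eq_pt (Or.inl rfl)

theorem mk_pt_right (x : X) : mk x (Based.pt : Y) = (Based.pt : Smash X Y) := mk_eq_pt (Or.inr rfl)

/-- A function of two variables that is constant on the wedge factors through the smash product. -/
def lift {W : Type*} (f : X → Y → W) (w : W) (h₁ : ∀ y, f Based.pt y = w)
    (h₂ : ∀ x, f x Based.pt = w) : Smash X Y → W :=
  Quot.lift (fun p : SeqProd X Y => f p.1 p.2) (by
    have key : ∀ p : SeqProd X Y, InWedge p → f p.1 p.2 = w := by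
      rintro ⟨x, y⟩ h
      rcases h with h | h
      · change x = Based.pt at h
        subst h
        exact h₁ y
      · change y = Based.pt at h
        subst h
        exact h₂ x
    rintro p q ⟨hp, hq⟩
    exact (key p hp).trans (key q hq).symm)

/-- `f ∧ g`. -/
def map [TopologicalSpace X] [TopologicalSpace Y] [TopologicalSpace X'] [TopologicalSpace Y']
    (f : BasedMap X X') (g : BasedMap Y Y') : Smash X Y → Smash X' Y' :=
  lift (fun x y => mk (f x) (g y)) Based.pt
    (fun _ => mk_eq_pt (Or.inl f.map_pt)) (fun _ => mk_eq_pt (Or.inr g.map_pt))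

/-- `(x ∧ y) ∧ z ↦ x ∧ (y ∧ z)`. -/
def assoc : Smash (Smash X Y) Z → Smash X (Smash Y Z) :=
  lift (fun s z => lift (fun x y => mk x (mk y z)) Based.pt
      (fun _ => mk_pt_left _) (fun _ => mk_eq_pt (Or.inr (mk_pt_left _))) s) Based.pt
    (fun _ => mk_pt_left _)
    (fun s => by
      induction s using Quot.ind with
      | mk p => exact mk_eq_pt (Or.inr (mk_pt_right _)))

/-- `(x ∧ y) ∧ z ↦ (x ∧ z) ∧ y`. -/
def swapRight : Smash (Smash X Y) Z → Smash (Smash X Z) Y :=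
  lift (fun s z => lift (fun x y => mk (mk x z) y) Based.pt
      (fun _ => mk_eq_pt (Or.inl (mk_pt_left _))) (fun _ => mk_pt_right _) s) Based.pt
    (fun _ => mk_eq_pt (Or.inl (mk_pt_left _)))
    (fun s => by
      induction s using Quot.ind with
      | mk p => exact mk_eq_pt (Or.inl (mk_pt_right _)))

/-- `S⁰ ∧ X ≅ X`. -/
def leftUnitor : Smash Bool X → X :=
  lift (fun b x => match b with
      | true => x
      | false => Based.pt) Based.pt (fun _ => rfl) (fun b => by cases b <;> rfl)

/-- `X ∧ S⁰ ≅ X`. -/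
def rightUnitor : Smash X Bool → X :=
  lift (fun x b => match b with
      | true => x
      | false => Based.pt) Based.pt (fun b => by cases b <;> rfl) (fun _ => rfl)

end Smash

/-! ## Grafting of finite label sets -/

/-- `A ∪ₐ B = (A \ {a}) ⊔ B`. -/
abbrev Graft (A : Type) (a : A) (B : Type) : Type := {x : A // x ≠ a} ⊕ B

/-- Functoriality of `A ∪ₐ B` in bijections. -/
def graftCongr {A A' B B' : Type} (f : A ≃ A') (a : A) (g : B ≃ B') :
    Graft A a B ≃ Graft A' (f a) B' :=
  Equiv.sumCongr (f.subtypeEquiv fun _ => f.injective.ne_iff.symm) g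

/-- `A ∪ₐ (B ∪_b C) ≃ (A ∪ₐ B) ∪_b C`. -/
def graftAssoc (A : Type) (a : A) (B : Type) (b : B) (C : Type) :
    Graft A a (Graft B b C) ≃ Graft (Graft A a B) (Sum.inr b) C where
  toFun
    | Sum.inl x => Sum.inl ⟨Sum.inl x, Sum.inl_ne_inr⟩
    | Sum.inr (Sum.inl y) => Sum.inl ⟨Sum.inr y.1, fun h => y.2 (Sum.inr_injective h)⟩
    | Sum.inr (Sum.inr z) => Sum.inr z
  invFun
    | Sum.inl ⟨Sum.inl x, _⟩ => Sum.inl x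
    | Sum.inl ⟨Sum.inr y, h⟩ => Sum.inr (Sum.inl ⟨y, fun e => h (congrArg Sum.inr e)⟩)
    | Sum.inr z => Sum.inr (Sum.inr z)
  left_inv := by rintro (x | y | z) <;> rfl
  right_inv := by rintro (⟨x | y, h⟩ | z) <;> rfl

/-- `(A ∪ₐ B) ∪_{a'} C ≃ (A ∪_{a'} C) ∪ₐ B` for `a ≠ a'` in `A`. -/
def graftComm (A : Type) (a a' : A) (h : a ≠ a') (B C : Type) :
    Graft (Graft A a B) (Sum.inl ⟨a', h.symm⟩) C ≃ Graft (Graft A a' C) (Sum.inl ⟨a, h⟩) B where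
  toFun
    | Sum.inl ⟨Sum.inl x, hx⟩ =>
        Sum.inl ⟨Sum.inl ⟨x.1, fun e => hx (congrArg Sum.inl (Subtype.ext e))⟩,
          fun e => x.2 (congrArg Subtype.val (Sum.inl_injective e))⟩
    | Sum.inl ⟨Sum.inr y, _⟩ => Sum.inr y
    | Sum.inr z => Sum.inl ⟨Sum.inr z, Sum.inr_ne_inl⟩
  invFun
    | Sum.inl ⟨Sum.inl x, hx⟩ =>
        Sum.inl ⟨Sum.inl ⟨x.1, fun e => hx (congrArg Sum.inl (Subtype.ext e))⟩,
          fun e => x.2 (congrArg Subtype.val (Sum.inl_injective e))⟩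
    | Sum.inl ⟨Sum.inr z, _⟩ => Sum.inr z
    | Sum.inr y => Sum.inl ⟨Sum.inr y, Sum.inr_ne_inl⟩
  left_inv := by rintro (⟨x | y, h⟩ | z) <;> rfl
  right_inv := by rintro (⟨x | y, h⟩ | z) <;> rfl

/-- `B ≃ {*} ∪_* B`. -/
def graftLeft (B : Type) : B ≃ Graft Unit () B where
  toFun b := Sum.inr b
  invFun
    | Sum.inl x => absurd rfl x.2
    | Sum.inr b => b
  left_inv _ := rfl
  right_inv := by
    rintro (x | b)
    · exact absurd rfl x.2
    · rfl

open Classical in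
/-- `A ≃ A ∪ₐ {*}`. -/
def graftRight (A : Type) (a : A) : A ≃ Graft A a Unit where
  toFun x := if h : x = a then Sum.inr () else Sum.inl ⟨x, h⟩
  invFun
    | Sum.inl x => x.1
    | Sum.inr _ => a
  left_inv x := by
    by_cases h : x = a <;> simp [h]
  right_inv := by
    rintro (⟨x, hx⟩ | u)
    · simp [hx]
    · simp

/-! ## Symmetric sequences, operads and cooperads -/

/-- A pointed symmetric sequence: a functor from finite sets and bijections to based sequential
spaces that sends the empty set to a point. -/
structure SymSeq where
  obj : (S : Type) → [Finite S] → Type u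
  [top : ∀ (S : Type) [Finite S], TopologicalSpace (obj S)]
  [seq : ∀ (S : Type) [Finite S], SequentialSpace (obj S)]
  [based : ∀ (S : Type) [Finite S], Based (obj S)]
  map : ∀ {S S' : Type} [Finite S] [Finite S'], (S ≃ S') → BasedMap (obj S) (obj S')
  map_refl : ∀ (S : Type) [Finite S] (x : obj S), map (Equiv.refl S) x = x
  map_trans : ∀ {S S' S'' : Type} [Finite S] [Finite S'] [Finite S'']
    (f : S ≃ S') (g : S' ≃ S'') (x : obj S), map (f.trans g) x = map g (map f x)
  pointed : ∀ (S : Type) [Finite S] [IsEmpty S] (x : obj S), x = Based.pt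

attribute [instance] SymSeq.top SymSeq.seq SymSeq.based

/-- An operad in based sequential spaces, given by its partial compositions
`Q(A) ∧ Q(B) → Q(A ∪ₐ B)` and its unit `S⁰ → Q(1)`. -/
structure Operad extends SymSeq.{u} where
  unit : obj Unit
  comp : ∀ {A B : Type} [Finite A] [Finite B] (a : A), obj A → obj B → obj (Graft A a B)
  comp_continuous : ∀ {A B : Type} [Finite A] [Finite B] (a : A),
    Continuous (fun p : SeqProd (obj A) (obj B) => comp a p.1 p.2)
  comp_pt_left : ∀ {A B : Type} [Finite A] [Finite B] (a : A) (y : obj B),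
    comp a (Based.pt : obj A) y = Based.pt
  comp_pt_right : ∀ {A B : Type} [Finite A] [Finite B] (a : A) (x : obj A),
    comp a x (Based.pt : obj B) = Based.pt
  comp_map : ∀ {A A' B B' : Type} [Finite A] [Finite A'] [Finite B] [Finite B']
    (f : A ≃ A') (g : B ≃ B') (a : A) (x : obj A) (y : obj B),
    comp (f a) (map f x) (map g y) = map (graftCongr f a g) (comp a x y)
  comp_assoc : ∀ {A B C : Type} [Finite A] [Finite B] [Finite C] (a : A) (b : B)
    (x : obj A) (y : obj B) (z : obj C),
    comp (Sum.inr b : Graft A a B) (comp a x y) z =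
      map (graftAssoc A a B b C) (comp a x (comp b y z))
  comp_comm : ∀ {A B C : Type} [Finite A] [Finite B] [Finite C] (a a' : A) (h : a ≠ a')
    (x : obj A) (y : obj B) (z : obj C),
    comp (Sum.inl ⟨a, h⟩ : Graft A a' C) (comp a' x z) y =
      map (graftComm A a a' h B C) (comp (Sum.inl ⟨a', h.symm⟩ : Graft A a B) (comp a x y) z)
  unit_comp : ∀ {B : Type} [Finite B] (y : obj B), comp () unit y = map (graftLeft B) y
  comp_unit : ∀ {A : Type} [Finite A] (a : A) (x : obj A), comp a x unit = map (graftRight A a) x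

/-- Morphisms of operads. -/
structure OperadHom (P : Operad.{u}) (Q : Operad.{v}) where
  app : ∀ (S : Type) [Finite S], BasedMap (P.obj S) (Q.obj S)
  app_map : ∀ {S S' : Type} [Finite S] [Finite S'] (f : S ≃ S') (x : P.obj S),
    app S' (P.map f x) = Q.map f (app S x)
  app_unit : app Unit P.unit = Q.unit
  app_comp : ∀ {A B : Type} [Finite A] [Finite B] (a : A) (x : P.obj A) (y : P.obj B),
    app (Graft A a B) (P.comp a x y) = Q.comp a (app A x) (app B y)

/-- A cooperad in based sequential spaces with underlying symmetric sequence `C`, that is an operad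
in the opposite category: partial decompositions `C(A ∪ₐ B) → C(A) ∧ C(B)` and a counit
`C(1) → S⁰`. -/
structure CooperadStructure (C : SymSeq.{u}) where
  counit : BasedMap (C.obj Unit) Bool
  decomp : ∀ (A : Type) [Finite A] (a : A) (B : Type) [Finite B],
    BasedMap (C.obj (Graft A a B)) (Smash (C.obj A) (C.obj B))
  decomp_map : ∀ {A A' B B' : Type} [Finite A] [Finite A'] [Finite B] [Finite B']
    (f : A ≃ A') (g : B ≃ B') (a : A) (x : C.obj (Graft A a B)),
    decomp A' (f a) B' (C.map (graftCongr f a g) x) =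
      Smash.map (C.map f) (C.map g) (decomp A a B x)
  coassoc : ∀ {A B D : Type} [Finite A] [Finite B] [Finite D] (a : A) (b : B)
    (x : C.obj (Graft A a (Graft B b D))),
    Smash.assoc (Smash.map (decomp A a B) (BasedMap.id _)
        (decomp (Graft A a B) (Sum.inr b) D (C.map (graftAssoc A a B b D) x))) =
      Smash.map (BasedMap.id _) (decomp B b D) (decomp A a (Graft B b D) x)
  cocomm : ∀ {A B D : Type} [Finite A] [Finite B] [Finite D] (a a' : A) (h : a ≠ a')
    (x : C.obj (Graft (Graft A a B) (Sum.inl ⟨a', h.symm⟩) D)),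
    Smash.swapRight (Smash.map (decomp A a B) (BasedMap.id _)
        (decomp (Graft A a B) (Sum.inl ⟨a', h.symm⟩) D x)) =
      Smash.map (decomp A a' D) (BasedMap.id _)
        (decomp (Graft A a' D) (Sum.inl ⟨a, h⟩) B (C.map (graftComm A a a' h B D) x))
  counit_left : ∀ {B : Type} [Finite B] (x : C.obj B),
    Smash.leftUnitor (Smash.map counit (BasedMap.id _)
      (decomp Unit () B (C.map (graftLeft B) x))) = x
  counit_right : ∀ {A : Type} [Finite A] (a : A) (x : C.obj A),
    Smash.rightUnitor (Smash.map (BasedMap.id _) counit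
      (decomp A a Unit (C.map (graftRight A a) x))) = x

/-! ### The unit operad, augmentations -/

/-- The spaces of the unit operad: `S⁰` on one-element sets and a point otherwise. -/
def UnitObj (S : Type) : Type := {b : Bool // b = true → Nat.card S = 1}

instance (S : Type) : TopologicalSpace (UnitObj S) :=
  inferInstanceAs (TopologicalSpace {b : Bool // b = true → Nat.card S = 1})

instance (S : Type) : DiscreteTopology (UnitObj S) :=
  inferInstanceAs (DiscreteTopology {b : Bool // b = true → Nat.card S = 1})

instance (S : Type) : Based (UnitObj S) := ⟨⟨false, by simp⟩⟩

theorem unitObj_ext {S : Type} {x y : UnitObj S} (h : x.1 = y.1) : x = y := Subtype.ext h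

theorem card_graft_eq_one {A B : Type} (a : A) (hA : Nat.card A = 1) (hB : Nat.card B = 1) :
    Nat.card (Graft A a B) = 1 := by
  obtain ⟨hA, -⟩ := Nat.card_eq_one_iff_unique.1 hA
  have : IsEmpty {x : A // x ≠ a} := ⟨fun x => x.2 (Subsingleton.elim _ _)⟩
  rw [Nat.card_congr (Equiv.emptySum {x : A // x ≠ a} B), hB]

theorem continuous_seqProd_of_discrete {X Y Z : Type*} [TopologicalSpace X] [TopologicalSpace Y]
    [DiscreteTopology X] [DiscreteTopology Y] [TopologicalSpace Z] (f : SeqProd X Y → Z) :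
    Continuous f :=
  continuous_iff_le_induced.2 (le_trans (seqCoreflection_le _)
    (continuous_iff_le_induced.1
      (continuous_of_discreteTopology : Continuous (fun p : X × Y => f p))))

/-- The unit operad `I`. -/
def unitOperad : Operad.{0} where
  obj S _ := UnitObj S
  top S _ := inferInstance
  seq S _ := inferInstance
  based S _ := inferInstance
  map f := ⟨fun x => ⟨x.1, fun h => by rw [← Nat.card_congr f]; exact x.2 h⟩,
    continuous_of_discreteTopology, rfl⟩
  map_refl _ _ _ := rfl
  map_trans _ _ _ := rfl
  pointed S _ _ x := by
    refine unitObj_ext ?_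
    by_contra h
    have h' : x.1 = true := by
      rw [← Bool.not_eq_false]
      exact h
    have := x.2 h'
    simp at this
  unit := ⟨true, fun _ => by simp⟩
  comp a x y := ⟨x.1 && y.1, fun h => by
    rw [Bool.and_eq_true] at h
    exact card_graft_eq_one a (x.2 h.1) (y.2 h.2)⟩
  comp_continuous _ := continuous_seqProd_of_discrete _
  comp_pt_left _ _ := rfl
  comp_pt_right _ x := unitObj_ext (Bool.and_false x.1)
  comp_map _ _ _ _ _ := rfl
  comp_assoc _ _ x y z := unitObj_ext (Bool.and_assoc x.1 y.1 z.1)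
  comp_comm _ _ _ x y z := unitObj_ext (Bool.and_right_comm x.1 z.1 y.1)
  unit_comp y := unitObj_ext (Bool.true_and y.1)
  comp_unit _ x := unitObj_ext (Bool.and_true x.1)

/-- An operad with an operad map to the unit operad. -/
structure AugmentedOperad extends Operad.{u} where
  aug : OperadHom toOperad unitOperad

/-- In arity one the augmentation sends every non-base point to the non-base point. -/
def AugmentedOperad.StronglyAugmented (Q : AugmentedOperad.{u}) : Prop :=
  ∀ x : Q.obj Unit, x ≠ Based.pt → Q.aug.app Unit x ≠ Based.pt

/-! ## Trees -/

/-- A rooted tree with leaves labelled by `S` and no vertex of arity `0`.  Every edge is either the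
outgoing edge of a vertex (the edge just below it) or a leaf, so the set of edges is `V ⊕ L`;
`parent e` is the vertex at the bottom of `e`, and it is `none` exactly for the root edge.  One edge
and no vertex are allowed. -/
structure RTree (S : Type) where
  V : Type
  L : Type
  [finV : Finite V]
  [finL : Finite L]
  parent : V ⊕ L → Option V
  exists_root : ∃ r, parent r = none ∧
    ∀ e, Relation.ReflTransGen (fun x y => ∃ v, parent x = some v ∧ y = Sum.inl v) e r
  arity_pos : ∀ v, ∃ e, parent e = some v
  label : L ≃ S

attribute [instance] RTree.finV RTree.finL

namespace RTree

variable {S : Type} (T : RTree S)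

/-- The edges of a tree. -/
abbrev Edge : Type := T.V ⊕ T.L

/-- `e'` lies on the path from `e` down to the root (`e` itself included). -/
def Path (e e' : T.Edge) : Prop :=
  Relation.ReflTransGen (fun x y => ∃ v, T.parent x = some v ∧ y = Sum.inl v) e e'

/-- The incoming edges of a vertex. -/
def In (v : T.V) : Type := {e : T.Edge // T.parent e = some v}

instance (v : T.V) : Finite (T.In v) := inferInstanceAs (Finite {e : T.Edge // T.parent e = some v})

/-- A vertex is unstable if it has arity one. -/
def Unstable (v : T.V) : Prop := Nat.card (T.In v) = 1

/-- The leaves above an edge. As no vertex has arity `0`, two edges belong to the same branch, that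
is to the same edge of the underlying stable tree, if and only if they have the same leaves above
them. So the branches are the sets of leaves of the form `leavesAbove e`. -/
def leavesAbove (e : T.Edge) : Set T.L := {x | T.Path (Sum.inr x) e}

/-- A weighting: the weights are non-negative and add up to `1` on every path from a leaf to the
root (so they lie in the unit interval). -/
def IsWeighting (w : T.Edge → ℝ) : Prop :=
  (∀ e, 0 ≤ w e) ∧ ∀ x : T.L, ∑ᶠ (e : T.Edge) (_ : T.Path (Sum.inr x) e), w e = 1

/-- The total weight of the branch with set of leaves `X`. -/
def branchWeight (w : T.Edge → ℝ) (X : Set T.L) : ℝ :=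
  ∑ᶠ (e : T.Edge) (_ : T.leavesAbove e = X), w e

open Classical in
/-- Identify the edges coming in to `v` with the edge going out of `v`. -/
def collapse (v : T.V) (e : T.Edge) : T.Edge := if T.parent e = some v then Sum.inl v else e

/-- Change the leaf labels along a bijection. -/
abbrev relabel {S' : Type} (f : S ≃ S') : RTree S' := { T with label := T.label.trans f }

theorem not_isEmpty (T : RTree S) : ¬ IsEmpty S := by
  intro hS
  have : IsEmpty T.L := ⟨fun x => hS.false (T.label x)⟩
  have hsurj : Function.Surjective (fun v : T.V => T.parent (Sum.inl v)) := by
    rintro (_ | v)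
    · obtain ⟨r | x, hr, -⟩ := T.exists_root
      · exact ⟨r, hr⟩
      · exact isEmptyElim x
    · obtain ⟨r | x, hr⟩ := T.arity_pos v
      · exact ⟨r, hr⟩
      · exact isEmptyElim x
  have h := Nat.card_le_card_of_surjective _ hsurj
  rw [Finite.card_option] at h
  omega

end RTree

/-! ## The bar construction -/

/-- The pairs of a labelling of the vertices of `T` by points of `Q` and a weighting of `T`, with
the product topology of sequential spaces. -/
def Cell (Q : SymSeq.{u}) {S : Type} (T : RTree S) : Type u :=
  (∀ v : T.V, Q.obj (T.In v)) × {w : T.Edge → ℝ // T.IsWeighting w}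

instance (Q : SymSeq.{u}) {S : Type} (T : RTree S) : TopologicalSpace (Cell Q T) :=
  seqCoreflection (inferInstanceAs (TopologicalSpace
    ((∀ v : T.V, Q.obj (T.In v)) × {w : T.Edge → ℝ // T.IsWeighting w})))

instance (Q : SymSeq.{u}) {S : Type} (T : RTree S) : SequentialSpace (Cell Q T) :=
  seqCoreflection_sequentialSpace _

/-- The `Q`-labelled weighted trees with leaves labelled by `S`. -/
abbrev WTree (Q : SymSeq.{u}) (S : Type) : Type (max 1 u) := Σ T : RTree S, Cell Q T

namespace WTree

variable {Q : SymSeq.{u}} {S S' : Type}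

/-- The label of a vertex. -/
def lab (p : WTree Q S) (v : p.1.V) : Q.obj (p.1.In v) := p.2.1 v

/-- The weight of an edge. -/
def wt (p : WTree Q S) (e : p.1.Edge) : ℝ := p.2.2.1 e

/-- The label of the vertex `v'` is the label of the vertex `v`, where the incoming edges correspond
under the map of edges `κ`. -/
def LabelsAgree (p' : WTree Q S') (p : WTree Q S) (κ : p'.1.Edge → p.1.Edge)
    (v' : p'.1.V) (v : p.1.V) : Prop :=
  ∃ σ : p'.1.In v' ≃ p.1.In v, (∀ e, (σ e).1 = κ e.1) ∧ Q.map σ (p'.lab v') = p.lab v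

/-- The map of edges given by a map of vertices and by the leaf labels. -/
def edgeMap (p' p : WTree Q S) (φ : p'.1.V → p.1.V) : p'.1.Edge → p.1.Edge :=
  Sum.map φ (fun x => p.1.label.symm (p'.1.label x))

/-- Isomorphism of labelled weighted trees. -/
structure IsIso (p' p : WTree Q S) (φ : p'.1.V ≃ p.1.V) : Prop where
  parent : ∀ e, p.1.parent (edgeMap p' p φ e) = (p'.1.parent e).map φ
  weight : ∀ e, p'.wt e = p.wt (edgeMap p' p φ e)
  labels : ∀ v', LabelsAgree p' p (edgeMap p' p φ) v' (φ v')

open Classical in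
/-- `p'` is obtained from `p` by removing the vertex `v` and attaching the incoming edges of `v`,
with the weight of the outgoing edge of `v` added to their weights, to what was below `v`.  All
vertex labels are kept, except that nothing is said here about the vertex below `v`. -/
structure IsRemoval (p' p : WTree Q S) (v : p.1.V) (φ : p'.1.V → p.1.V) : Prop where
  injective : Function.Injective φ
  range : Set.range φ = {v}ᶜ
  parent : ∀ e, p.1.parent (p.1.collapse v (edgeMap p' p φ e)) = (p'.1.parent e).map φ
  weight : ∀ e, p'.wt e = p.wt (edgeMap p' p φ e) +
    if p.1.parent (edgeMap p' p φ e) = some v then p.wt (Sum.inl v) else 0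
  labels : ∀ u', p.1.parent (Sum.inl v) ≠ some (φ u') →
    LabelsAgree p' p (edgeMap p' p φ) u' (φ u')

/-- Removal of an unstable vertex: the label of the vertex below it is kept as well, where the edge
above the removed vertex takes the place of the edge below it. -/
structure IsUnstableRemoval (p' p : WTree Q S) (v : p.1.V) (φ : p'.1.V → p.1.V) : Prop extends
    IsRemoval p' p v φ where
  unstable : p.1.Unstable v
  label_below : ∀ u', p.1.parent (Sum.inl v) = some (φ u') →
    LabelsAgree p' p (p.1.collapse v ∘ edgeMap p' p φ) u' (φ u')

/-- The outgoing edge of `v`, or the incoming edge of the unstable vertex `v`, is the root edge or a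
leaf, and has weight `0`. -/
def HasZeroEnd (p : WTree Q S) (v : p.1.V) : Prop :=
  (p.1.parent (Sum.inl v) = none ∧ p.wt (Sum.inl v) = 0) ∨
    ∃ x : p.1.L, p.1.parent (Sum.inr x) = some v ∧ p.wt (Sum.inr x) = 0

end WTree

/-- Contraction of the internal edge below the vertex `v`, with operadic composition of the labels
of its two vertices. -/
structure WTree.IsContraction {Q : Operad.{u}} {S : Type} (p' p : WTree Q.toSymSeq S) (v : p.1.V)
    (φ : p'.1.V → p.1.V) : Prop extends WTree.IsRemoval p' p v φ where
  internal : p.1.parent (Sum.inl v) ≠ none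
  label_below : ∀ (u' : p'.1.V) (h : p.1.parent (Sum.inl v) = some (φ u')),
    ∃ σ : p'.1.In u' ≃ Graft (p.1.In (φ u')) ⟨Sum.inl v, h⟩ (p.1.In v),
      (∀ e, Sum.elim (fun x => x.1.1) (fun y => y.1) (σ e) = WTree.edgeMap p' p φ e.1) ∧
      Q.map σ (p'.lab u') = Q.comp ⟨Sum.inl v, h⟩ (p.lab (φ u')) (p.lab v)

/-- The labelled weighted trees together with a base point. -/
abbrev PreBar (Q : SymSeq.{u}) (S : Type) : Type (max 1 u) := Unit ⊕ WTree Q S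

/-- The identifications of the bar construction. -/
inductive BarRel (Q : AugmentedOperad.{u}) (S : Type) :
    PreBar Q.toSymSeq S → PreBar Q.toSymSeq S → Prop
  /-- Isomorphic trees are the same. -/
  | iso (p p' : WTree Q.toSymSeq S) (φ : p'.1.V ≃ p.1.V) (h : WTree.IsIso p' p φ) :
      BarRel Q S (Sum.inr p) (Sum.inr p')
  /-- Labels live in the smash product over the vertices. -/
  | label_pt (p : WTree Q.toSymSeq S) (v : p.1.V) (h : p.lab v = Based.pt) :
      BarRel Q S (Sum.inr p) (Sum.inl ())
  /-- A root branch or leaf branch of weight `0`. -/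
  | zero_branch (p : WTree Q.toSymSeq S) (e : p.1.Edge)
      (he : p.1.parent e = none ∨ ∃ x, e = Sum.inr x)
      (h : p.1.branchWeight p.wt (p.1.leavesAbove e) = 0) :
      BarRel Q S (Sum.inr p) (Sum.inl ())
  /-- An internal edge of weight `0` is identified with operadic composition across it. -/
  | contract (p p' : WTree Q.toSymSeq S) (v : p.1.V) (φ : p'.1.V → p.1.V)
      (h : WTree.IsContraction (Q := Q.toOperad) p' p v φ) (h₀ : p.wt (Sum.inl v) = 0) :
      BarRel Q S (Sum.inr p) (Sum.inr p')
  /-- An unstable vertex labelled by the unit may be removed. -/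
  | unit (p p' : WTree Q.toSymSeq S) (v : p.1.V) (φ : p'.1.V → p.1.V)
      (h : WTree.IsUnstableRemoval p' p v φ) (σ : Unit ≃ p.1.In v)
      (h₁ : p.lab v = Q.map σ Q.unit) :
      BarRel Q S (Sum.inr p) (Sum.inr p')
  /-- At a root or leaf edge of weight `0`, the augmentation is applied to the adjacent unstable
  vertex: if it gives the non-base point, the vertex is removed. (If the whole branch has weight `0`
  then both sides are the base point anyway.) -/
  | augment (p p' : WTree Q.toSymSeq S) (v : p.1.V) (φ : p'.1.V → p.1.V)
      (h : WTree.IsUnstableRemoval p' p v φ) (h₀ : p.HasZeroEnd v)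
      (h₁ : Q.aug.app _ (p.lab v) ≠ Based.pt) :
      BarRel Q S (Sum.inr p) (Sum.inr p')
  /-- If the augmentation gives the base point, so does the tree. -/
  | augment_pt (p : WTree Q.toSymSeq S) (v : p.1.V) (hv : p.1.Unstable v) (h₀ : p.HasZeroEnd v)
      (h₁ : Q.aug.app _ (p.lab v) = Based.pt) :
      BarRel Q S (Sum.inr p) (Sum.inl ())

/-- The space `B(Q)(S)`. -/
def BarObj (Q : AugmentedOperad.{u}) (S : Type) : Type (max 1 u) := Quot (BarRel Q S)

instance (Q : AugmentedOperad.{u}) (S : Type) : TopologicalSpace (BarObj Q S) :=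
  inferInstanceAs (TopologicalSpace (Quot (BarRel Q S)))

instance (Q : AugmentedOperad.{u}) (S : Type) : SequentialSpace (BarObj Q S) :=
  (isQuotientMap_quot_mk : IsQuotientMap (Quot.mk (BarRel Q S))).sequentialSpace

instance (Q : AugmentedOperad.{u}) (S : Type) : Based (BarObj Q S) := ⟨Quot.mk _ (Sum.inl ())⟩

/-- The point of `B(Q)(S)` represented by a labelled weighted tree. -/
def BarObj.mk {Q : AugmentedOperad.{u}} {S : Type} (p : WTree Q.toSymSeq S) : BarObj Q S :=
  Quot.mk _ (Sum.inr p)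

/-- Change of leaf labels on labelled weighted trees. -/
abbrev WTree.relabel {Q : SymSeq.{u}} {S S' : Type} (f : S ≃ S') (p : WTree Q S) : WTree Q S' :=
  ⟨p.1.relabel f, p.2⟩

theorem WTree.edgeMap_relabel {Q : SymSeq.{u}} {S S' : Type} (f : S ≃ S') (p' p : WTree Q S)
    (φ : p'.1.V → p.1.V) :
    WTree.edgeMap (p'.relabel f) (p.relabel f) φ = WTree.edgeMap p' p φ := by
  funext e
  rcases e with v | x
  · rfl
  · change Sum.inr (p.1.label.symm (f.symm (f (p'.1.label x)))) =
      Sum.inr (p.1.label.symm (p'.1.label x))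
    rw [Equiv.symm_apply_apply]

theorem WTree.IsRemoval.relabel {Q : SymSeq.{u}} {S S' : Type} (f : S ≃ S') {p' p : WTree Q S}
    {v : p.1.V} {φ : p'.1.V → p.1.V} (h : WTree.IsRemoval p' p v φ) :
    WTree.IsRemoval (p'.relabel f) (p.relabel f) v φ := by
  constructor
  · exact h.injective
  · exact h.range
  · rw [WTree.edgeMap_relabel]; exact h.parent
  · rw [WTree.edgeMap_relabel]; exact h.weight
  · rw [WTree.edgeMap_relabel]; exact h.labels

theorem WTree.IsUnstableRemoval.relabel {Q : SymSeq.{u}} {S S' : Type} (f : S ≃ S')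
    {p' p : WTree Q S} {v : p.1.V} {φ : p'.1.V → p.1.V} (h : WTree.IsUnstableRemoval p' p v φ) :
    WTree.IsUnstableRemoval (p'.relabel f) (p.relabel f) v φ := by
  refine ⟨h.toIsRemoval.relabel f, h.unstable, ?_⟩
  rw [WTree.edgeMap_relabel]; exact h.label_below

theorem BarRel.relabel {Q : AugmentedOperad.{u}} {S S' : Type} (f : S ≃ S')
    {x y : PreBar Q.toSymSeq S} (h : BarRel Q S x y) :
    BarRel Q S' (Sum.map id (WTree.relabel f) x) (Sum.map id (WTree.relabel f) y) := by
  cases h with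
  | iso p p' φ h =>
    refine BarRel.iso (p.relabel f) (p'.relabel f) φ ?_
    have key := WTree.edgeMap_relabel f p' p φ
    refine ⟨fun e => ?_, fun e => ?_, fun w => ?_⟩
    · exact (congrArg (fun k => p.1.parent (k e)) key).trans (h.parent e)
    · exact (h.weight e).trans (congrArg (fun k => p.wt (k e)) key).symm
    · obtain ⟨σ, hσ, hl⟩ := h.labels w
      exact ⟨σ, fun e => (hσ e).trans (congrFun key e.1).symm, hl⟩
  | label_pt p v h => exact BarRel.label_pt (p.relabel f) v h
  | zero_branch p e he h => exact BarRel.zero_branch (p.relabel f) e he h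
  | contract p p' v φ h h₀ =>
    refine BarRel.contract (p.relabel f) (p'.relabel f) v φ ?_ h₀
    refine ⟨h.toIsRemoval.relabel f, h.internal, ?_⟩
    rw [WTree.edgeMap_relabel]; exact h.label_below
  | unit p p' v φ h σ h₁ =>
    exact BarRel.unit (p.relabel f) (p'.relabel f) v φ (h.relabel f) σ h₁
  | augment p p' v φ h h₀ h₁ =>
    exact BarRel.augment (p.relabel f) (p'.relabel f) v φ (h.relabel f) h₀ h₁
  | augment_pt p v hv h₀ h₁ => exact BarRel.augment_pt (p.relabel f) v hv h₀ h₁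

/-- Functoriality of `B(Q)(S)` in bijections of `S`. -/
def BarObj.map {Q : AugmentedOperad.{u}} {S S' : Type} (f : S ≃ S') :
    BasedMap (BarObj Q S) (BarObj Q S') where
  toFun := Quot.map (Sum.map id (WTree.relabel f)) (fun _ _ h => h.relabel f)
  continuous_toFun := by
    refine continuous_quot_lift _ (continuous_quot_mk.comp ?_)
    refine Continuous.sumMap continuous_id (continuous_sigma fun T => ?_)
    exact continuous_sigmaMk (σ := fun T : RTree S' => Cell Q.toSymSeq T) (i := T.relabel f)
  map_pt := rfl

/-- The bar construction `B(Q)` as a symmetric sequence. -/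
def bar (Q : AugmentedOperad.{u}) : SymSeq.{max 1 u} where
  obj S _ := BarObj Q S
  top S _ := inferInstance
  seq S _ := inferInstance
  based S _ := inferInstance
  map f := BarObj.map f
  map_refl S _ x := by
    induction x using Quot.ind with
    | mk x => rcases x with x | x <;> rfl
  map_trans f g x := by
    induction x using Quot.ind with
    | mk x => rcases x with x | x <;> rfl
  pointed S _ hS x := by
    induction x using Quot.ind with
    | mk x =>
      rcases x with x | x
      · rfl
      · exact absurd hS x.1.not_isEmpty

/-! ## Degrafting -/

namespace WTree

variable {Q : SymSeq.{u}} {A B : Type} {a : A}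

/-- The set of leaves of a tree over `A ∪ₐ B` with label in `B`. The underlying stable tree is the
graft of a tree over `B` onto the leaf `a` of a tree over `A` if and only if one of its branches has
this set of leaves above it. -/
def cutLeaves (p : WTree Q (Graft A a B)) : Set p.1.L := {x | ∃ b, p.1.label x = Sum.inr b}

open Classical in
/-- The map of edges from the lower tree; the leaf `a` goes to the edge `top`. -/
def lowerEdge (pA : WTree Q A) (p : WTree Q (Graft A a B)) (top : p.1.Edge)
    (φ : pA.1.V → p.1.V) : pA.1.Edge → p.1.Edge :=
  Sum.elim (fun v => Sum.inl (φ v))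
    (fun x => if h : pA.1.label x = a then top
      else Sum.inr (p.1.label.symm (Sum.inl ⟨pA.1.label x, h⟩)))

/-- The map of edges from the upper tree. -/
def upperEdge (pB : WTree Q B) (p : WTree Q (Graft A a B)) (φ : pB.1.V → p.1.V) :
    pB.1.Edge → p.1.Edge :=
  Sum.map φ (fun x => p.1.label.symm (Sum.inr (pB.1.label x)))

open Classical in
/-- `pA` and `pB` are obtained from `p` by degrafting at the branch with set of leaves `cutLeaves`,
whose topmost and bottommost edges are `top` and `bot`.

Both trees receive a copy of this branch with all its edges and unstable vertices and their labels:
in `pA` it is the branch of the leaf `a`, in `pB` it is the root branch. The other vertices with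
their labels are distributed over the two trees. In `pA` the weights of the duplicated branch are
scaled by one factor (which is then forced, as the weights on paths add up to `1`) and all other
weights are kept; in `pB` all weights are scaled by one (again forced) factor. -/
structure IsDegrafting (pA : WTree Q A) (pB : WTree Q B) (p : WTree Q (Graft A a B))
    (top bot : p.1.Edge) (φA : pA.1.V → p.1.V) (φB : pB.1.V → p.1.V) : Prop where
  leaves_top : p.1.leavesAbove top = p.cutLeaves
  leaves_bot : p.1.leavesAbove bot = p.cutLeaves
  branch : ∀ e, p.1.leavesAbove e = p.cutLeaves → p.1.Path top e ∧ p.1.Path e bot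
  injective_lower : Function.Injective φA
  injective_upper : Function.Injective φB
  range_lower : Set.range φA = {v | ¬ p.1.leavesAbove (Sum.inl v) ⊆ p.cutLeaves ∨
    (p.1.leavesAbove (Sum.inl v) = p.cutLeaves ∧ Sum.inl v ≠ top)}
  range_upper : Set.range φB = {v | p.1.leavesAbove (Sum.inl v) ⊆ p.cutLeaves}
  parent_lower : ∀ e, (pA.1.parent e).map φA = p.1.parent (lowerEdge pA p top φA e)
  parent_upper : ∀ e, (pB.1.parent e).map φB =
    if upperEdge pB p φB e = bot then none else p.1.parent (upperEdge pB p φB e)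
  labels_lower : ∀ v, LabelsAgree pA p (lowerEdge pA p top φA) v (φA v)
  labels_upper : ∀ v, LabelsAgree pB p (upperEdge pB p φB) v (φB v)
  weight_lower : ∃ c : ℝ, ∀ e, pA.wt e =
    if p.1.leavesAbove (lowerEdge pA p top φA e) = p.cutLeaves
    then c * p.wt (lowerEdge pA p top φA e) else p.wt (lowerEdge pA p top φA e)
  weight_upper : ∃ c : ℝ, ∀ e, pB.wt e = c * p.wt (upperEdge pB p φB e)

end WTree

end OpBar

end

open OpBar

/-! A labelled weighted tree is handled through depths: `depth e` is the total weight from the top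
of the edge `e` down to the root, `base e` the same from its lower end. Removing a vertex and adding
the weight of its outgoing edge to its incoming edges changes no depth of a surviving edge
(`IsRemoval.depth_eq`), so the relations (1)-(3) become statements about depth-preserving maps of
edges. Degrafting fits the same language. Both trees are pieces of `p`, cut out between a bottom
edge and an antichain of upper edges (`IsMinor`, `IsPiece`), with new depth functions: the
duplicated branch is rescaled affinely in the lower tree (`lowerDepth`), and everything is
normalised affinely in the upper one (`upperDepth`). Pieces with the same upper edges, bottom edge
and depths are isomorphic (`IsPiece.mk_eq`), so the decomposition of a tree does not depend on
choices (`IsSplit.decomp_eq`).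

Compatibility with the identifications (`BarRel.preDecomp_eq`): an identification of `p` induces on
each of the two trees an isomorphism or an identification of the same kind, with one exception, the
contraction of an edge of weight `0` at an end of the cut branch. It merges an unstable vertex of
the branch with a vertex beyond that end. In the tree where this end has become a root or leaf edge
there is nothing to compose with, and the unstable vertex just disappears. That is relation (3),
provided the augmentation does not kill its label. Strong augmentation ensures this for every label
other than the base point, and a label at the base point makes both sides trivial.

Continuity (`WTree.continuous_decomp`): sequences suffice, and the critical case is a branch whose
weight tends to `0`, where the scaling factors need not converge. The weightings of the two trees
lie in compact spaces, so a subsequence converges. Let `β` be the limit depth of the lower end of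
the branch. If `β < 1`, the root branch of the upper limit tree has weight `0`. If `β = 1`, the
branch of the leaf `a` of the lower one has weight `0`, since its total weight is `1 - base bot`
before the limit. Either way the limit is the base point.

Laws: pieces of pieces are pieces (`IsPiece.comp`), so iterated decompositions consist of pieces of
one tree, and coassociativity and cocommutativity reduce to equality of depth functions. The counit
asks whether the augmentation is non-trivial on all labels. Over one leaf all vertices are unstable,
so by strong augmentation it vanishes only if some label is the base point. -/

noncomputable section
namespace OpBar

namespace RTree

variable {S S' S'' : Type} {T : RTree S} {T' : RTree S'} {T'' : RTree S''}

/-! ## Paths in trees -/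

theorem Path.refl (e : T.Edge) : T.Path e e := Relation.ReflTransGen.refl

theorem Path.trans {e₁ e₂ e₃ : T.Edge} (h : T.Path e₁ e₂) (h' : T.Path e₂ e₃) : T.Path e₁ e₃ :=
  Relation.ReflTransGen.trans h h'

theorem Path.of_parent {e : T.Edge} {v : T.V} (h : T.parent e = some v) :
    T.Path e (Sum.inl v) :=
  Relation.ReflTransGen.single ⟨v, h, rfl⟩

theorem path_iff_eq_or {e e' : T.Edge} :
    T.Path e e' ↔ e = e' ∨ ∃ v, T.parent e = some v ∧ T.Path (Sum.inl v) e' := by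
  constructor
  · intro h
    rcases Relation.ReflTransGen.cases_head h with h | ⟨c, ⟨v, hv, rfl⟩, h⟩
    · exact Or.inl h
    · exact Or.inr ⟨v, hv, h⟩
  · rintro (rfl | ⟨v, hv, h⟩)
    · exact Path.refl _
    · exact (Path.of_parent hv).trans h

theorem path_tail {e e' : T.Edge} (h : T.Path e e') (hne : e ≠ e') :
    ∃ v c, e' = Sum.inl v ∧ T.parent c = some v ∧ T.Path e c := by
  rcases Relation.ReflTransGen.cases_tail h with h | ⟨c, hc, v, hv, rfl⟩
  · exact absurd h.symm hne
  · exact ⟨v, c, rfl, hv, hc⟩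

theorem path_inr {e : T.Edge} {x : T.L} (h : T.Path e (Sum.inr x)) : e = Sum.inr x := by
  by_contra hne
  obtain ⟨v, c, h, -⟩ := path_tail h hne
  cases h

/-- Induction upwards from the root. It replaces an explicit recursion on the height of an edge and
is the source of all facts about acyclicity and depth. -/
theorem edge_induction (T : RTree S) {P : T.Edge → Prop} (h₀ : ∀ e, T.parent e = none → P e)
    (h₁ : ∀ e v, T.parent e = some v → P (Sum.inl v) → P e) : ∀ e, P e := by
  obtain ⟨r, hr, h⟩ := T.exists_root
  intro e
  refine Relation.ReflTransGen.head_induction_on (h e) (h₀ r hr) ?_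
  rintro a c ⟨v, hv, rfl⟩ - hc
  exact h₁ a v hv hc

/-- Acyclicity is not a field of `RTree`. A cycle through `e` also passes through the edge below
`e`, so it would descend to an edge without parent, and such an edge lies on no cycle. -/
theorem not_path_of_parent {e : T.Edge} {v : T.V} (h : T.parent e = some v) :
    ¬ T.Path (Sum.inl v) e := by
  revert v
  refine T.edge_induction (P := fun e => ∀ {v}, T.parent e = some v → ¬ T.Path (Sum.inl v) e)
    ?_ ?_ e
  · intro e he v hv
    rw [he] at hv
    cases hv
  · intro e v hv ih u hu hp
    obtain rfl : v = u := Option.some.inj (hv.symm.trans hu)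
    rcases path_iff_eq_or.1 hp with h | ⟨t, ht, h⟩
    · rw [← h] at hu
      exact ih hu (Path.refl _)
    · exact ih ht (h.trans (Path.of_parent hv))

theorem Path.antisymm {e e' : T.Edge} (h : T.Path e e') (h' : T.Path e' e) : e = e' := by
  rcases path_iff_eq_or.1 h with h | ⟨v, hv, h⟩
  · exact h
  · exact absurd (h.trans h') (not_path_of_parent hv)

theorem Path.total {e a b : T.Edge} (h : T.Path e a) (h' : T.Path e b) :
    T.Path a b ∨ T.Path b a := by
  refine Relation.ReflTransGen.total_of_right_unique ?_ h h'
  rintro x y z ⟨v, hv, rfl⟩ ⟨w, hw, rfl⟩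
  rw [hv] at hw
  rw [Option.some.inj hw]

theorem path_parent {e e' : T.Edge} {v : T.V} (hv : T.parent e = some v) (h : T.Path e e')
    (hne : e ≠ e') : T.Path (Sum.inl v) e' := by
  rcases path_iff_eq_or.1 h with h | ⟨u, hu, h⟩
  · exact absurd h hne
  · rw [hv] at hu
    rwa [Option.some.inj hu]

theorem eq_of_path_of_parent_eq {c c' : T.Edge} {v : T.V} (h : T.parent c = some v)
    (h' : T.parent c' = some v) (hp : T.Path c c') : c = c' := by
  by_contra hne
  exact not_path_of_parent h' (path_parent h hp hne)

/-- There are finitely many edges and every vertex has an incoming one, so climbing ends at a leaf.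
Hence sets `leavesAbove e` are non-empty, which is what makes them able to detect branches. -/
theorem exists_path_leaf (e : T.Edge) : ∃ x, T.Path (Sum.inr x) e := by
  have htr : IsTrans T.Edge (fun a b => T.Path a b ∧ a ≠ b) :=
    ⟨fun a b c h h' => ⟨h.1.trans h'.1, fun hac => h.2 (h.1.antisymm (hac ▸ h'.1))⟩⟩
  have hir : Std.Irrefl (fun a b : T.Edge => T.Path a b ∧ a ≠ b) := ⟨fun a h => h.2 rfl⟩
  have wf : WellFounded (fun a b : T.Edge => T.Path a b ∧ a ≠ b) :=
    Finite.wellFounded_of_trans_of_irrefl _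
  refine wf.induction (C := fun e => ∃ x, T.Path (Sum.inr x) e) e ?_
  rintro (v | x) ih
  · obtain ⟨c, hc⟩ := T.arity_pos v
    obtain ⟨x, hx⟩ := ih c ⟨Path.of_parent hc, fun h => by
      rw [h] at hc
      exact not_path_of_parent hc (Path.refl _)⟩
    exact ⟨x, hx.trans (Path.of_parent hc)⟩
  · exact ⟨x, Path.refl _⟩

/-- The root edge. -/
def root (T : RTree S) : T.Edge := T.exists_root.choose

theorem parent_root (T : RTree S) : T.parent T.root = none := T.exists_root.choose_spec.1

theorem path_root (e : T.Edge) : T.Path e T.root := T.exists_root.choose_spec.2 e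

theorem eq_root_iff {e : T.Edge} : e = T.root ↔ T.parent e = none := by
  refine ⟨fun h => h ▸ T.parent_root, fun h => ?_⟩
  rcases path_iff_eq_or.1 (path_root e) with h' | ⟨v, hv, -⟩
  · exact h'
  · rw [h] at hv
    cases hv

theorem eq_root_of_path {e : T.Edge} (h : T.Path T.root e) : e = T.root :=
  (path_root e).antisymm h

theorem leavesAbove_mono {e e' : T.Edge} (h : T.Path e e') :
    T.leavesAbove e ⊆ T.leavesAbove e' := fun _ hx => Path.trans hx h

theorem path_or_path_of_mem {e e' : T.Edge} {x : T.L} (h : x ∈ T.leavesAbove e)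
    (h' : x ∈ T.leavesAbove e') : T.Path e e' ∨ T.Path e' e :=
  Path.total h h'

theorem leavesAbove_root : T.leavesAbove T.root = Set.univ :=
  Set.eq_univ_of_forall fun _ => path_root _

theorem leavesAbove_inr (x : T.L) : T.leavesAbove (Sum.inr x) = {x} := by
  ext y
  constructor
  · intro h
    exact Sum.inr_injective (path_inr h)
  · rintro rfl
    exact Path.refl _

/-! ## Depth -/

/-- The total weight of the path from the top of the edge `e` to the root. -/
def depth (T : RTree S) (w : T.Edge → ℝ) (e : T.Edge) : ℝ :=
  ∑ᶠ (e' : T.Edge) (_ : T.Path e e'), w e'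

/-- The total weight of the path from the bottom of the edge `e` to the root. -/
def base (T : RTree S) (w : T.Edge → ℝ) (e : T.Edge) : ℝ := T.depth w e - w e

theorem base_eq (w : T.Edge → ℝ) (e : T.Edge) :
    T.base w e = (T.parent e).elim 0 (fun v => T.depth w (Sum.inl v)) := by
  have h : {e' | T.Path e e'} = insert e {e' | ∃ v, T.parent e = some v ∧ T.Path (Sum.inl v) e'} := by
    ext e'
    simp only [Set.mem_ofPred_eq, Set.mem_insert_iff, eq_comm (a := e')]
    exact path_iff_eq_or
  have h' : e ∉ {e' | ∃ v, T.parent e = some v ∧ T.Path (Sum.inl v) e'} := by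
    rintro ⟨v, hv, hp⟩
    exact not_path_of_parent hv hp
  have key : T.depth w e =
      w e + ∑ᶠ (e' : T.Edge) (_ : e' ∈ {e' | ∃ v, T.parent e = some v ∧ T.Path (Sum.inl v) e'}),
        w e' := by
    rw [← finsum_mem_insert _ h' (Set.toFinite _), ← h]
    rfl
  rw [base, key, add_sub_cancel_left]
  cases hp : T.parent e with
  | none => simp
  | some v =>
    simp only [Option.some.injEq, exists_eq_left', Set.mem_ofPred_eq, Option.elim_some]
    rfl

theorem base_of_parent {w : T.Edge → ℝ} {e : T.Edge} {v : T.V} (h : T.parent e = some v) :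
    T.base w e = T.depth w (Sum.inl v) := by
  rw [base_eq, h]
  rfl

theorem base_of_parent_none {w : T.Edge → ℝ} {e : T.Edge} (h : T.parent e = none) :
    T.base w e = 0 := by
  rw [base_eq, h]
  rfl

theorem depth_eq (w : T.Edge → ℝ) (e : T.Edge) : T.depth w e = w e + T.base w e := by
  rw [base]
  ring

/-- The recursion along `parent` determines the depth. New depth functions are always identified
through it, without evaluating the finite sums. -/
theorem depth_unique {w f : T.Edge → ℝ}
    (h : ∀ e, f e = w e + (T.parent e).elim 0 (fun v => f (Sum.inl v))) (e : T.Edge) :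
    f e = T.depth w e := by
  refine T.edge_induction (P := fun e => f e = T.depth w e) (fun e he => ?_)
    (fun e v hv ih => ?_) e
  · rw [h, depth_eq, base_eq, he]
    rfl
  · rw [h, depth_eq, base_eq, hv, Option.elim_some, Option.elim_some, ih]

theorem isWeighting_iff {w : T.Edge → ℝ} :
    T.IsWeighting w ↔ (∀ e, 0 ≤ w e) ∧ ∀ x, T.depth w (Sum.inr x) = 1 := Iff.rfl

theorem depth_le_base {w : T.Edge → ℝ} (hw : ∀ e, 0 ≤ w e) {e e' : T.Edge} (h : T.Path e e')
    (hne : e ≠ e') : T.depth w e' ≤ T.base w e := by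
  revert h hne
  refine T.edge_induction
    (P := fun e => T.Path e e' → e ≠ e' → T.depth w e' ≤ T.base w e) (fun e he h hne => ?_)
    (fun e v hv ih h hne => ?_) e
  · rcases path_iff_eq_or.1 h with h | ⟨v, hv, -⟩
    · exact absurd h hne
    · rw [he] at hv
      cases hv
  · rw [base_of_parent hv]
    have := path_parent hv h hne
    by_cases hve : Sum.inl v = e'
    · rw [hve]
    · have h1 := ih this hve
      have h2 := depth_eq w (Sum.inl v)
      have h3 := hw (Sum.inl v)
      linarith

theorem base_le_depth {w : T.Edge → ℝ} (hw : ∀ e, 0 ≤ w e) (e : T.Edge) :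
    T.base w e ≤ T.depth w e := by
  have := depth_eq w e
  have := hw e
  linarith

theorem depth_mono {w : T.Edge → ℝ} (hw : ∀ e, 0 ≤ w e) {e e' : T.Edge} (h : T.Path e e') :
    T.depth w e' ≤ T.depth w e := by
  by_cases hne : e = e'
  · rw [hne]
  · exact (depth_le_base hw h hne).trans (base_le_depth hw e)

theorem base_mono {w : T.Edge → ℝ} (hw : ∀ e, 0 ≤ w e) {e e' : T.Edge} (h : T.Path e e') :
    T.base w e' ≤ T.base w e := by
  by_cases hne : e = e'
  · rw [hne]
  · exact (base_le_depth hw e').trans (depth_le_base hw h hne)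

theorem base_nonneg {w : T.Edge → ℝ} (hw : ∀ e, 0 ≤ w e) (e : T.Edge) : 0 ≤ T.base w e := by
  have := base_mono hw (path_root e)
  rwa [base_of_parent_none T.parent_root] at this

theorem IsWeighting.depth_le_one {w : T.Edge → ℝ} (hw : T.IsWeighting w) (e : T.Edge) :
    T.depth w e ≤ 1 := by
  obtain ⟨x, hx⟩ := exists_path_leaf e
  have := depth_mono hw.1 hx
  rwa [(isWeighting_iff.1 hw).2 x] at this

theorem IsWeighting.le_one {w : T.Edge → ℝ} (hw : T.IsWeighting w) (e : T.Edge) :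
    w e ≤ 1 := by
  have h1 := hw.depth_le_one e
  have h2 := base_nonneg hw.1 e
  have h3 := depth_eq w e
  linarith

/-- A sum of non-negative terms vanishes only termwise. Afterwards a non-zero branch is used in the
form of an edge of non-zero weight. -/
theorem branchWeight_eq_zero_iff {w : T.Edge → ℝ} (hw : ∀ e, 0 ≤ w e) (X : Set T.L) :
    T.branchWeight w X = 0 ↔ ∀ e, T.leavesAbove e = X → w e = 0 := by
  constructor
  · intro h e he
    refine le_antisymm ?_ (hw e)
    rw [← h]
    refine (le_of_eq ?_).trans
      (single_le_finsum e (Set.toFinite _) fun e' => finsum_nonneg fun _ => hw e')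
    rw [finsum_eq_if, if_pos he]
  · intro h
    refine (finsum_congr fun e => ?_).trans finsum_zero
    exact (finsum_congr fun he => h e he).trans finsum_zero

/-! ## Branches -/

/-- `top` and `bot` are the topmost and the bottommost edge of the branch with set of leaves `Y`. -/
structure IsCut (T : RTree S) (Y : Set T.L) (top bot : T.Edge) : Prop where
  leaves_top : T.leavesAbove top = Y
  leaves_bot : T.leavesAbove bot = Y
  branch : ∀ e, T.leavesAbove e = Y → T.Path top e ∧ T.Path e bot

theorem IsCut.unique {Y : Set T.L} {t b t' b' : T.Edge} (h : T.IsCut Y t b)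
    (h' : T.IsCut Y t' b') : t = t' ∧ b = b' :=
  ⟨(h.branch _ h'.leaves_top).1.antisymm (h'.branch _ h.leaves_top).1,
    (h'.branch _ h.leaves_bot).2.antisymm (h.branch _ h'.leaves_bot).2⟩

theorem IsCut.nonempty {Y : Set T.L} {t b : T.Edge} (h : T.IsCut Y t b) : Y.Nonempty :=
  h.leaves_top ▸ exists_path_leaf t

/-- Edges with the same leaves lie on the path from a common leaf to the root, so they form a finite
chain, which has two extreme elements. -/
theorem exists_isCut {Y : Set T.L} (h : ∃ e, T.leavesAbove e = Y) :
    ∃ top bot, T.IsCut Y top bot := by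
  have htr : IsTrans T.Edge (fun a b => T.Path a b ∧ a ≠ b) :=
    ⟨fun a b c h h' => ⟨h.1.trans h'.1, fun hac => h.2 (h.1.antisymm (hac ▸ h'.1))⟩⟩
  have hir : Std.Irrefl (fun a b : T.Edge => T.Path a b ∧ a ≠ b) := ⟨fun a h => h.2 rfl⟩
  have htr' : IsTrans T.Edge (fun a b => T.Path b a ∧ b ≠ a) :=
    ⟨fun a b c h h' => htr.trans c b a h' h⟩
  have hir' : Std.Irrefl (fun a b : T.Edge => T.Path b a ∧ b ≠ a) := ⟨fun a h => h.2 rfl⟩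
  have comp : ∀ e e', T.leavesAbove e = Y → T.leavesAbove e' = Y →
      T.Path e e' ∨ T.Path e' e := by
    intro e e' he he'
    obtain ⟨x, hx⟩ := exists_path_leaf e
    exact path_or_path_of_mem hx (show x ∈ T.leavesAbove e' from he' ▸ he ▸ hx)
  obtain ⟨t, ht, ht'⟩ := (Finite.wellFounded_of_trans_of_irrefl
    (fun a b : T.Edge => T.Path a b ∧ a ≠ b)).has_min {e | T.leavesAbove e = Y} h
  obtain ⟨b, hb, hb'⟩ := (Finite.wellFounded_of_trans_of_irrefl
    (fun a b : T.Edge => T.Path b a ∧ b ≠ a)).has_min {e | T.leavesAbove e = Y} h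
  refine ⟨t, b, ht, hb, fun e he => ⟨?_, ?_⟩⟩
  · by_contra hcon
    rcases comp t e ht he with h | h
    · exact hcon h
    · exact ht' e he ⟨h, fun heq => hcon (heq ▸ Path.refl _)⟩
  · by_contra hcon
    rcases comp e b he hb with h | h
    · exact hcon h
    · exact hb' e he ⟨h, fun heq => hcon (heq ▸ Path.refl _)⟩

theorem leavesAbove_eq_of_path {Y : Set T.L} {e e₁ e₂ : T.Edge} (h₁ : T.leavesAbove e₁ = Y)
    (h₂ : T.leavesAbove e₂ = Y) (h : T.Path e₁ e) (h' : T.Path e e₂) : T.leavesAbove e = Y :=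
  Set.Subset.antisymm (h₂ ▸ leavesAbove_mono h') (h₁ ▸ leavesAbove_mono h)

theorem IsCut.mid_iff {Y : Set T.L} {top bot e : T.Edge} (h : T.IsCut Y top bot) :
    T.leavesAbove e = Y ↔ T.Path top e ∧ T.Path e bot :=
  ⟨h.branch e, fun h' => leavesAbove_eq_of_path h.leaves_top h.leaves_bot h'.1 h'.2⟩

/-- An edge below some leaf of the branch that is not below the branch lies above it. -/
theorem IsCut.path_top_iff {Y : Set T.L} {top bot e : T.Edge} (h : T.IsCut Y top bot) :
    T.Path top e ↔ Y ⊆ T.leavesAbove e := by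
  constructor
  · intro h'
    rw [← h.leaves_top]
    exact leavesAbove_mono h'
  · intro h'
    obtain ⟨x, hx⟩ := h.nonempty
    rcases path_or_path_of_mem (e := top) (h.leaves_top.symm ▸ hx) (h' hx) with h'' | h''
    · exact h''
    · exact (h.branch e (Set.Subset.antisymm (h.leaves_top ▸ leavesAbove_mono h'') h')).1

theorem IsCut.path_bot_iff {Y : Set T.L} {top bot e : T.Edge} (h : T.IsCut Y top bot) :
    T.Path e bot ↔ T.leavesAbove e ⊆ Y := by
  constructor
  · intro h'
    rw [← h.leaves_bot]
    exact leavesAbove_mono h'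
  · intro h'
    obtain ⟨x, hx⟩ := exists_path_leaf e
    rcases path_or_path_of_mem (e := bot) (h.leaves_bot.symm ▸ h' hx) hx with h'' | h''
    · exact (h.branch e (Set.Subset.antisymm h' (h.leaves_bot ▸ leavesAbove_mono h''))).2
    · exact h''

end RTree
end OpBar
end

noncomputable section
namespace OpBar

namespace RTree

variable {S S' S'' : Type} {T : RTree S} {T' : RTree S'} {T'' : RTree S''}

/-! ## Pieces and contractions of trees -/

open Classical in
/-- Identify the incoming edges of the vertices in `R` with their outgoing edges. -/
def col (T : RTree S) (R : Set T.V) (e : T.Edge) : T.Edge :=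
  (T.parent e).elim e (fun u => if u ∈ R then Sum.inl u else e)

theorem col_of_mem {R : Set T.V} {e : T.Edge} {u : T.V} (h : T.parent e = some u) (hu : u ∈ R) :
    T.col R e = Sum.inl u := by
  rw [col, h, Option.elim_some, if_pos hu]

theorem col_of_forall {R : Set T.V} {e : T.Edge} (h : ∀ u ∈ R, T.parent e ≠ some u) :
    T.col R e = e := by
  rw [col]
  cases hp : T.parent e with
  | none => rfl
  | some u => rw [Option.elim_some, if_neg fun hu => h u hu hp]

theorem col_cases (R : Set T.V) (e : T.Edge) :
    T.col R e = e ∨ ∃ u ∈ R, T.parent e = some u ∧ T.col R e = Sum.inl u := by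
  by_cases h : ∃ u ∈ R, T.parent e = some u
  · obtain ⟨u, hu, h⟩ := h
    exact Or.inr ⟨u, hu, h, col_of_mem h hu⟩
  · exact Or.inl (col_of_forall fun u hu h' => h ⟨u, hu, h'⟩)

theorem col_empty (e : T.Edge) : T.col ∅ e = e := col_of_forall fun _ h => h.elim

theorem col_singleton (v : T.V) (e : T.Edge) : T.col {v} e = T.collapse v e := by
  by_cases h : T.parent e = some v
  · rw [col_of_mem h (Set.mem_singleton v), collapse, if_pos h]
  · rw [collapse, if_neg h]
    exact col_of_forall fun u hu => by
      rw [Set.mem_singleton_iff.1 hu]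
      exact h

theorem path_col (R : Set T.V) (e : T.Edge) : T.Path e (T.col R e) := by
  rcases T.col_cases R e with h | ⟨u, -, h, h'⟩
  · rw [h]
    exact Path.refl _
  · rw [h']
    exact Path.of_parent h

/-- The map of edges given by a map of vertices and by images of the leaves. -/
def minorEdge (T' : RTree S') (T : RTree S) (lam : S' → T.Edge) (φ : T'.V → T.V) :
    T'.Edge → T.Edge :=
  Sum.elim (fun v => Sum.inl (φ v)) (fun x => lam (T'.label x))

/-- The edge of the leaf with label `s`. -/
def leaf (T : RTree S) (s : S) : T.Edge := Sum.inr (T.label.symm s)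

theorem leaf_label (x : T.L) : T.leaf (T.label x) = Sum.inr x := by
  rw [leaf, Equiv.symm_apply_apply]

theorem minorEdge_leaf (lam : S' → T.Edge) (φ : T'.V → T.V) (s : S') :
    minorEdge T' T lam φ (T'.leaf s) = lam s := by
  change lam (T'.label (T'.label.symm s)) = lam s
  rw [Equiv.apply_symm_apply]

/-- The tree `T'` is the part of `T` between the edge `bot` and the edges `lam s`, from which the
vertices in `R` are removed by contraction of their outgoing edges. -/
structure IsMinor (T' : RTree S') (T : RTree S) (lam : S' → T.Edge) (bot : T.Edge) (R : Set T.V)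
    (φ : T'.V → T.V) : Prop where
  inj : Function.Injective (minorEdge T' T lam φ)
  avoid : ∀ e, ∀ u ∈ R, minorEdge T' T lam φ e ≠ Sum.inl u
  parent_none : ∀ e, T'.parent e = none ↔
    minorEdge T' T lam φ e = bot ∨ T.col R (minorEdge T' T lam φ e) = bot
  parent_some : ∀ e u, T'.parent e = some u →
    T.parent (T.col R (minorEdge T' T lam φ e)) = some (φ u)

namespace IsMinor

variable {lam : S' → T.Edge} {bot : T.Edge} {R : Set T.V} {φ : T'.V → T.V}

local notation "κ" => minorEdge T' T lam φ

theorem injective_vertex (h : IsMinor T' T lam bot R φ) : Function.Injective φ := by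
  intro u u' huu
  exact Sum.inl_injective (h.inj (show κ (Sum.inl u) = κ (Sum.inl u') from congrArg Sum.inl huu))

theorem leaf_ne (h : IsMinor T' T lam bot R φ) (s : S') (u : T'.V) : lam s ≠ Sum.inl (φ u) := by
  intro heq
  rw [← minorEdge_leaf (T' := T') lam φ s] at heq
  cases h.inj (show κ (T'.leaf s) = κ (Sum.inl u) from heq)

theorem path_bot (h : IsMinor T' T lam bot R φ) (e : T'.Edge) : T.Path (κ e) bot := by
  refine T'.edge_induction (P := fun e => T.Path (κ e) bot) (fun e he => ?_)
    (fun e v hv ih => ?_) e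
  · rcases (h.parent_none e).1 he with h | h
    · rw [h]
      exact Path.refl _
    · rw [← h]
      exact path_col _ _
  · exact ((path_col R (κ e)).trans (Path.of_parent (h.parent_some e v hv))).trans ih

theorem path_map (h : IsMinor T' T lam bot R φ) {e e' : T'.Edge} (hp : T'.Path e e') :
    T.Path (κ e) (κ e') := by
  induction hp with
  | refl => exact Path.refl _
  | tail _ hstep ih =>
    obtain ⟨v, hv, rfl⟩ := hstep
    exact ih.trans ((path_col R _).trans (Path.of_parent (h.parent_some _ v hv)))

/-- One downward step in `T'` can be longer in `T`, since it may jump over a vertex of `R`. It never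
jumps over `ε`, because `ε` is not the outgoing edge of a vertex of `R`. -/
theorem path_step (h : IsMinor T' T lam bot R φ) {e : T'.Edge} {ε : T.Edge}
    (hε : ∀ u ∈ R, ε ≠ Sum.inl u) (hb : T.Path ε bot) (hp : T.Path (κ e) ε) (hne : κ e ≠ ε) :
    ∃ u, T'.parent e = some u ∧ T.Path (κ (Sum.inl u)) ε := by
  cases hpar : T'.parent e with
  | none =>
    exfalso
    rcases (h.parent_none e).1 hpar with h' | h'
    · exact hne (hp.antisymm (h' ▸ hb))
    · rcases T.col_cases R (κ e) with hc | ⟨u, hu, hpu, hc⟩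
      · rw [hc] at h'
        exact hne (hp.antisymm (h' ▸ hb))
      · rw [hc] at h'
        exact hε u hu ((path_parent hpu hp hne).antisymm (h' ▸ hb)).symm
  | some u =>
    refine ⟨u, rfl, ?_⟩
    have hs := h.parent_some e u hpar
    rcases T.col_cases R (κ e) with hc | ⟨w, hw, hpw, hc⟩
    · rw [hc] at hs
      exact path_parent hs hp hne
    · rw [hc] at hs
      exact path_parent hs (path_parent hpw hp hne) (hε w hw).symm

theorem path_iff (h : IsMinor T' T lam bot R φ) {e e' : T'.Edge} :
    T'.Path e e' ↔ T.Path (κ e) (κ e') := by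
  refine ⟨h.path_map, ?_⟩
  refine T'.edge_induction (P := fun e => T.Path (κ e) (κ e') → T'.Path e e')
    (fun e he hp => ?_) (fun e v hv ih hp => ?_) e
  all_goals
    by_cases hne : κ e = κ e'
    · rw [h.inj hne]
      exact Path.refl _
    obtain ⟨u, hu, hp'⟩ := h.path_step (h.avoid e') (h.path_bot e') hp hne
  · rw [he] at hu
    cases hu
  · rw [hv] at hu
    cases hu
    exact (Path.of_parent hv).trans (ih hp')

/-- The image of a minor is convex: descending from a leaf of `T'` by `path_step` meets every edge
below `lam s` and above `bot` that is not removed. So `lam`, `bot` and `R` determine the image. -/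
theorem mem_range_iff (h : IsMinor T' T lam bot R φ) {ε : T.Edge} :
    ε ∈ Set.range κ ↔ (∀ u ∈ R, ε ≠ Sum.inl u) ∧ T.Path ε bot ∧ ∃ s, T.Path (lam s) ε := by
  constructor
  · rintro ⟨e, rfl⟩
    refine ⟨h.avoid e, h.path_bot e, ?_⟩
    obtain ⟨x, hx⟩ := exists_path_leaf e
    exact ⟨T'.label x, h.path_map hx⟩
  · rintro ⟨hR, hb, s, hs⟩
    rw [← minorEdge_leaf (T' := T') lam φ s] at hs
    revert hs
    refine T'.edge_induction (P := fun e => T.Path (κ e) ε → ε ∈ Set.range κ)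
      (fun e he hp => ?_) (fun e v hv ih hp => ?_) _
    all_goals
      by_cases hne : κ e = ε
      · exact ⟨e, hne⟩
      obtain ⟨u, hu, hp'⟩ := h.path_step hR hb hp hne
    · rw [he] at hu
      cases hu
    · rw [hv] at hu
      cases hu
      exact ih hp'

theorem mem_range_vertex_iff (h : IsMinor T' T lam bot R φ) {v : T.V} :
    v ∈ Set.range φ ↔ Sum.inl v ∈ Set.range κ ∧ ∀ s, lam s ≠ Sum.inl v := by
  constructor
  · rintro ⟨u, rfl⟩
    exact ⟨⟨Sum.inl u, rfl⟩, fun s => h.leaf_ne s u⟩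
  · rintro ⟨⟨u | x, hu⟩, hs⟩
    · exact ⟨u, Sum.inl_injective hu⟩
    · exact absurd hu (hs _)

theorem parent_none_piece (h : IsMinor T' T lam bot ∅ φ) {e : T'.Edge} :
    T'.parent e = none ↔ κ e = bot := by
  rw [h.parent_none, col_empty, or_self_iff]

theorem parent_some_piece (h : IsMinor T' T lam bot ∅ φ) {e : T'.Edge} {u : T'.V}
    (hu : T'.parent e = some u) : T.parent (κ e) = some (φ u) := by
  rw [← h.parent_some e u hu, col_empty]

theorem map_root (h : IsMinor T' T lam bot ∅ φ) : κ T'.root = bot :=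
  h.parent_none_piece.1 T'.parent_root

theorem parent_iff_piece (h : IsMinor T' T lam bot ∅ φ) {e : T'.Edge} {u : T'.V} :
    T'.parent e = some u ↔ T.parent (κ e) = some (φ u) := by
  refine ⟨h.parent_some_piece, fun hp => ?_⟩
  cases hpar : T'.parent e with
  | none =>
    rw [h.parent_none_piece.1 hpar] at hp
    exact absurd (h.path_bot (Sum.inl u)) (not_path_of_parent hp)
  | some t =>
    rw [h.parent_some_piece hpar] at hp
    rw [h.injective_vertex (Option.some.inj hp)]

theorem comp {T₁ : RTree S''} {lam₁ : S'' → T'.Edge} {bot₁ : T'.Edge} {φ₁ : T₁.V → T'.V}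
    {bot' : T.Edge} (h₁ : IsMinor T₁ T' lam₁ bot₁ ∅ φ₁) (h : IsMinor T' T lam bot R φ)
    (hbot : ∀ e, e = bot₁ ↔ κ e = bot' ∨ T.col R (κ e) = bot') :
    IsMinor T₁ T (κ ∘ lam₁) bot' R (φ ∘ φ₁) := by
  have hκ : ∀ e, minorEdge T₁ T (κ ∘ lam₁) (φ ∘ φ₁) e = κ (minorEdge T₁ T' lam₁ φ₁ e) := by
    rintro (e | e) <;> rfl
  refine ⟨fun e e' he => ?_, fun e => ?_, fun e => ?_, fun e u hu => ?_⟩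
  · rw [hκ, hκ] at he
    exact h₁.inj (h.inj he)
  · rw [hκ]
    exact h.avoid _
  · rw [hκ, h₁.parent_none_piece]
    exact hbot _
  · rw [hκ]
    exact h.parent_some _ _ (h₁.parent_some_piece hu)

theorem mem_leavesAbove_iff (h : IsMinor T' T lam bot R φ) {x : T.L} {x' : T'.L}
    (hx : T.Path (Sum.inr x) (lam (T'.label x'))) (e : T'.Edge) :
    x ∈ T.leavesAbove (κ e) ↔ x' ∈ T'.leavesAbove e := by
  constructor
  · intro hxe
    change T'.Path _ _
    rw [h.path_iff]
    rcases Path.total hx hxe with hp | hp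
    · exact hp
    · obtain ⟨y, hy⟩ := exists_path_leaf e
      have h1 : T'.Path (Sum.inr y) (Sum.inr x') := h.path_iff.2 ((h.path_map hy).trans hp)
      have h2 := path_inr h1
      rw [h2] at hy
      exact h.path_map hy
  · intro hx'
    exact hx.trans (h.path_map hx')

/-- A set of leaves of a minor pulled back to the bigger tree. -/
theorem leavesAbove_iff (h : IsMinor T' T lam bot R φ)
    (hcov : ∀ x, T.Path (Sum.inr x) bot → ∃ s, T.Path (Sum.inr x) (lam s))
    {Z : Set T.L} {Z' : Set T'.L} (hZ : ∀ x ∈ Z, T.Path (Sum.inr x) bot)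
    (hZZ : ∀ x x', T.Path (Sum.inr x) (lam (T'.label x')) → (x ∈ Z ↔ x' ∈ Z')) (e : T'.Edge) :
    T'.leavesAbove e = Z' ↔ T.leavesAbove (κ e) = Z := by
  have key := fun x x' (hx : T.Path (Sum.inr x) (lam (T'.label x'))) =>
    h.mem_leavesAbove_iff hx e
  constructor
  · intro he
    ext x
    constructor
    · intro hx
      obtain ⟨s, hs⟩ := hcov x (Path.trans hx (h.path_bot e))
      rw [← T'.label.apply_symm_apply s] at hs
      rw [hZZ x _ hs, ← he, ← key x _ hs]
      exact hx
    · intro hx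
      obtain ⟨s, hs⟩ := hcov x (hZ x hx)
      rw [← T'.label.apply_symm_apply s] at hs
      rw [key x _ hs, he, ← hZZ x _ hs]
      exact hx
  · intro he
    ext x'
    obtain ⟨x, hx⟩ := exists_path_leaf (lam (T'.label x'))
    rw [← key x x' hx, ← hZZ x x' hx, he]

theorem leavesAbove_eq_iff (h : IsMinor T' T lam bot R φ)
    (hcov : ∀ x, T.Path (Sum.inr x) bot → ∃ s, T.Path (Sum.inr x) (lam s)) (e e' : T'.Edge) :
    T'.leavesAbove e = T'.leavesAbove e' ↔ T.leavesAbove (κ e) = T.leavesAbove (κ e') :=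
  h.leavesAbove_iff hcov (fun _ hx => Path.trans hx (h.path_bot e'))
    (fun _ _ hx => h.mem_leavesAbove_iff hx e') e

theorem isCut_of_isCut (h : IsMinor T' T lam bot R φ) {Z : Set T.L} {Z' : Set T'.L}
    (hZ : ∀ e, T'.leavesAbove e = Z' ↔ T.leavesAbove (κ e) = Z)
    (hran : ∀ e, T.leavesAbove e = Z → e ∈ Set.range κ) {t' b' : T'.Edge}
    (hc : T'.IsCut Z' t' b') : T.IsCut Z (κ t') (κ b') := by
  refine ⟨(hZ _).1 hc.leaves_top, (hZ _).1 hc.leaves_bot, fun e he => ?_⟩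
  obtain ⟨e', rfl⟩ := hran e he
  obtain ⟨h1, h2⟩ := hc.branch e' ((hZ _).2 he)
  exact ⟨h.path_map h1, h.path_map h2⟩

/-- A vertex of a piece keeps all its incoming edges, so its label can be copied. Otherwise some
`lam s` would lie strictly below a missing edge, hence at or below the outgoing edge of the vertex,
and a leaf of `T'` would lie below a vertex. -/
theorem exists_incoming (h : IsMinor T' T lam bot ∅ φ)
    (hcov : ∀ x, T.Path (Sum.inr x) bot → ∃ s, T.Path (Sum.inr x) (lam s)) (v : T'.V) :
    ∃ σ : T'.In v ≃ T.In (φ v), ∀ e, (σ e).1 = κ e.1 := by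
  let f : T'.In v → T.In (φ v) := fun e => ⟨κ e.1, h.parent_some_piece e.2⟩
  refine ⟨Equiv.ofBijective f ⟨fun e e' he => ?_, fun ε => ?_⟩, fun e => rfl⟩
  · exact Subtype.ext (h.inj (congrArg Subtype.val he))
  · have hbot : T.Path ε.1 bot := (Path.of_parent ε.2).trans (h.path_bot (Sum.inl v))
    have hmem : ε.1 ∈ Set.range κ := by
      refine h.mem_range_iff.2 ⟨fun u hu => hu.elim, hbot, ?_⟩
      obtain ⟨x, hx⟩ := exists_path_leaf ε.1
      obtain ⟨s, hs⟩ := hcov x (hx.trans hbot)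
      rcases Path.total hx hs with hp | hp
      · by_cases hne : ε.1 = lam s
        · exact ⟨s, hne ▸ Path.refl _⟩
        · exfalso
          have h1 : T.Path (κ (Sum.inl v)) (lam s) := path_parent ε.2 hp hne
          rw [← minorEdge_leaf (T' := T') lam φ s, ← h.path_iff] at h1
          cases path_inr h1
      · exact ⟨s, hp⟩
    obtain ⟨e, he⟩ := hmem
    refine ⟨⟨e, ?_⟩, Subtype.ext he⟩
    rw [h.parent_iff_piece, he]
    exact ε.2

end IsMinor

/-! ### Comparison of minors -/

/-- The vertices of a minor are among those of the piece between the same edges, because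
`mem_range_iff` describes both. The lift `ψ` is the comparison map for all relations between
degrafted trees. -/
theorem IsMinor.exists_lift {lam : S' → T.Edge} {bot : T.Edge} {R : Set T.V} {T₁ T₂ : RTree S'}
    {φ₁ : T₁.V → T.V} {φ₂ : T₂.V → T.V} (h₁ : IsMinor T₁ T lam bot ∅ φ₁)
    (h₂ : IsMinor T₂ T lam bot R φ₂) : ∃ ψ : T₂.V → T₁.V, ∀ u, φ₁ (ψ u) = φ₂ u := by
  refine Classical.axiomOfChoice (r := fun u t => φ₁ t = φ₂ u) fun u => ?_
  have h := h₂.mem_range_vertex_iff.1 ⟨u, rfl⟩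
  refine h₁.mem_range_vertex_iff.2 ⟨h₁.mem_range_iff.2 ⟨fun u hu => hu.elim, ?_⟩, h.2⟩
  exact (h₂.mem_range_iff.1 h.1).2

/-- The map of edges that is given by a map of vertices and preserves the labels of the leaves. -/
def liftEdge (T₂ T₁ : RTree S') (ψ : T₂.V → T₁.V) : T₂.Edge → T₁.Edge :=
  Sum.map ψ (fun x => T₁.label.symm (T₂.label x))

section Lift

variable {lam : S' → T.Edge} {bot : T.Edge} {R : Set T.V} {T₁ T₂ : RTree S'}
  {φ₁ : T₁.V → T.V} {φ₂ : T₂.V → T.V} {ψ : T₂.V → T₁.V}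

theorem minorEdge_liftEdge (hψ : ∀ u, φ₁ (ψ u) = φ₂ u) (e : T₂.Edge) :
    minorEdge T₁ T lam φ₁ (liftEdge T₂ T₁ ψ e) = minorEdge T₂ T lam φ₂ e := by
  rcases e with u | x
  · exact congrArg Sum.inl (hψ u)
  · change lam (T₁.label (T₁.label.symm (T₂.label x))) = lam (T₂.label x)
    rw [Equiv.apply_symm_apply]

theorem IsMinor.lift_injective (h₂ : IsMinor T₂ T lam bot R φ₂) (hψ : ∀ u, φ₁ (ψ u) = φ₂ u) :
    Function.Injective ψ := by
  intro u u' h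
  refine h₂.injective_vertex ?_
  rw [← hψ, ← hψ, h]

theorem IsMinor.lift_range (h₁ : IsMinor T₁ T lam bot ∅ φ₁) (h₂ : IsMinor T₂ T lam bot R φ₂)
    (hψ : ∀ u, φ₁ (ψ u) = φ₂ u) : Set.range ψ = {u | φ₁ u ∉ R} := by
  ext t
  constructor
  · rintro ⟨u, rfl⟩ hu
    rw [hψ] at hu
    exact h₂.avoid (Sum.inl u) _ hu rfl
  · intro ht
    have h := h₁.mem_range_vertex_iff.1 ⟨t, rfl⟩
    have h' : φ₁ t ∈ Set.range φ₂ := by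
      refine h₂.mem_range_vertex_iff.2 ⟨h₂.mem_range_iff.2 ⟨fun u hu heq => ?_,
        (h₁.mem_range_iff.1 h.1).2⟩, h.2⟩
      exact ht (Sum.inl_injective heq ▸ hu)
    obtain ⟨u, hu⟩ := h'
    exact ⟨u, h₁.injective_vertex ((hψ u).trans hu)⟩

theorem IsMinor.parent_ne_of_mem (h₁ : IsMinor T₁ T lam bot ∅ φ₁) (v : T₁.V) :
    T.parent bot ≠ some (φ₁ v) := fun h => not_path_of_parent h (h₁.path_bot (Sum.inl v))

theorem IsMinor.map_collapse (h₁ : IsMinor T₁ T lam bot ∅ φ₁) (v : T₁.V) (e : T₁.Edge) :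
    minorEdge T₁ T lam φ₁ (T₁.collapse v e) = T.col {φ₁ v} (minorEdge T₁ T lam φ₁ e) := by
  by_cases h : T₁.parent e = some v
  · rw [col_of_mem (h₁.parent_some_piece h) (Set.mem_singleton _), collapse, if_pos h]
    rfl
  · rw [collapse, if_neg h, col_of_forall]
    intro u hu
    rw [Set.mem_singleton_iff.1 hu]
    exact fun h' => h (h₁.parent_iff_piece.2 h')

/-- Cutting out a piece and removing one of its vertices commute. -/
theorem IsMinor.lift_parent (h₁ : IsMinor T₁ T lam bot ∅ φ₁) {v : T₁.V}
    (h₂ : IsMinor T₂ T lam bot {φ₁ v} φ₂) (hψ : ∀ u, φ₁ (ψ u) = φ₂ u) (e : T₂.Edge) :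
    T₁.parent (T₁.collapse v (liftEdge T₂ T₁ ψ e)) = (T₂.parent e).map ψ := by
  have hκ := h₁.map_collapse v (liftEdge T₂ T₁ ψ e)
  rw [minorEdge_liftEdge hψ] at hκ
  cases hp : T₂.parent e with
  | none =>
    refine h₁.parent_none_piece.2 ?_
    rw [hκ]
    rcases (h₂.parent_none e).1 hp with h | h
    · rw [h]
      refine col_of_forall fun u hu => ?_
      rw [Set.mem_singleton_iff.1 hu]
      exact h₁.parent_ne_of_mem v
    · exact h
  | some u =>
    refine h₁.parent_iff_piece.2 ?_
    rw [hκ, h₂.parent_some e u hp, hψ]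

/-- Removing vertices that do not belong to the piece leaves the piece alone: passing from an edge
to its `col` can only happen at such vertices. -/
theorem IsMinor.lift_parent_of_notMem (h₁ : IsMinor T₁ T lam bot ∅ φ₁)
    (h₂ : IsMinor T₂ T lam bot R φ₂) (hψ : ∀ u, φ₁ (ψ u) = φ₂ u)
    (hR : ∀ v ∈ R, v ∉ Set.range φ₁) (hR' : ∀ v ∈ R, ∀ s, lam s ≠ Sum.inl v) (e : T₂.Edge) :
    T₁.parent (liftEdge T₂ T₁ ψ e) = (T₂.parent e).map ψ := by
  have hv : ∀ v ∈ R, ∀ e, minorEdge T₁ T lam φ₁ e ≠ Sum.inl v := fun v hv e he =>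
    hR v hv (h₁.mem_range_vertex_iff.2 ⟨⟨e, he⟩, hR' v hv⟩)
  cases hp : T₂.parent e with
  | none =>
    refine h₁.parent_none_piece.2 ?_
    rw [minorEdge_liftEdge hψ]
    rcases (h₂.parent_none e).1 hp with h | h
    · exact h
    · rcases T.col_cases R (minorEdge T₂ T lam φ₂ e) with hc | ⟨u, hu, -, hc⟩
      · rw [← hc, h]
      · exfalso
        refine hv u hu T₁.root ?_
        rw [h₁.map_root, ← h, hc]
  | some u =>
    refine h₁.parent_iff_piece.2 ?_
    rw [minorEdge_liftEdge hψ, hψ, ← h₂.parent_some e u hp]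
    rcases T.col_cases R (minorEdge T₂ T lam φ₂ e) with hc | ⟨w, hw, hpw, -⟩
    · rw [hc]
    · exfalso
      cases hp₁ : T₁.parent (liftEdge T₂ T₁ ψ e) with
      | none =>
        have := h₁.parent_none_piece.1 hp₁
        rw [minorEdge_liftEdge hψ] at this
        rw [(h₂.parent_none e).2 (Or.inl this)] at hp
        cases hp
      | some t =>
        have := h₁.parent_some_piece hp₁
        rw [minorEdge_liftEdge hψ, hpw] at this
        exact hR w hw ⟨t, (Option.some.inj this).symm⟩

end Lift

/-! ### Existence of pieces -/

/-- The vertices of the piece are those strictly below some `lam s` whose outgoing edge is still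
above `bot`. The antichain condition keeps the edges `lam s` apart from each other and from the
outgoing edges of these vertices. -/
theorem exists_isMinor (T : RTree S) [Finite S'] [Nonempty S'] {lam : S' → T.Edge} {bot : T.Edge}
    (hbot : ∀ s, T.Path (lam s) bot) (hanti : ∀ s s', T.Path (lam s) (lam s') → s = s') :
    ∃ (T' : RTree S') (φ : T'.V → T.V), IsMinor T' T lam bot ∅ φ := by
  let V : Type := {v : T.V // (∃ s, T.Path (lam s) (Sum.inl v) ∧ lam s ≠ Sum.inl v) ∧
    T.Path (Sum.inl v) bot}
  let k : V ⊕ S' → T.Edge := Sum.elim (fun v => Sum.inl v.1) lam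
  have kinj : Function.Injective k := by
    have key : ∀ (v : V) (s : S'), lam s ≠ Sum.inl v.1 := by
      rintro ⟨v, ⟨s', h1, h2⟩, h3⟩ s h
      exact h2 (by rw [hanti s' s (h ▸ h1), h])
    rintro (v | s) (v' | s') h
    · exact congrArg Sum.inl (Subtype.ext (Sum.inl_injective h))
    · exact absurd h.symm (key v s')
    · exact absurd h (key v' s)
    · exact congrArg Sum.inr (hanti s s' (show T.Path (lam s) (lam s') from
        (show lam s = lam s' from h) ▸ Path.refl _))
  have kbot : ∀ e, T.Path (k e) bot := by
    rintro (v | s)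
    · exact v.2.2
    · exact hbot s
  have kleaf : ∀ e, ∃ s, T.Path (lam s) (k e) := by
    rintro (v | s)
    · obtain ⟨s, h, -⟩ := v.2.1
      exact ⟨s, h⟩
    · exact ⟨s, Path.refl _⟩
  have kmem : ∀ ε, T.Path ε bot → (∃ s, T.Path (lam s) ε) → ∃ e, k e = ε := by
    rintro ε hb ⟨s, hs⟩
    by_cases hne : lam s = ε
    · exact ⟨Sum.inr s, hne⟩
    · obtain ⟨v, c, rfl, -⟩ := path_tail hs hne
      exact ⟨Sum.inl ⟨v, ⟨s, hs, hne⟩, hb⟩, rfl⟩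
  have step : ∀ e, ∃ o : Option V, (o = none ↔ k e = bot) ∧
      ∀ u : V, o = some u → T.parent (k e) = some u.1 := by
    intro e
    by_cases he : k e = bot
    · exact ⟨none, by simp [he], by simp⟩
    · rcases path_iff_eq_or.1 (kbot e) with h | ⟨v, hv, hp⟩
      · exact absurd h he
      · obtain ⟨s, hs⟩ := kleaf e
        have hs' := hs.trans (Path.of_parent hv)
        refine ⟨some ⟨v, ⟨s, hs', fun h => ?_⟩, hp⟩, by simp [he], ?_⟩
        · rw [h] at hs
          exact not_path_of_parent hv hs
        · intro u hu
          rw [hv, ← Option.some.inj hu]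
  choose par hnone hsome using step
  obtain ⟨r, hr⟩ : ∃ r, k r = bot :=
    kmem bot (Path.refl _) ⟨Classical.arbitrary S', hbot _⟩
  let T' : RTree S' :=
    { V := V
      L := S'
      finV := inferInstance
      finL := inferInstance
      parent := par
      exists_root := by
        refine ⟨r, (hnone r).2 hr, fun e => ?_⟩
        -- The induction runs over the edges `ε` of `T`, as the new parent map is not yet known to
        -- define a tree.
        have key : ∀ ε e, k e = ε → Relation.ReflTransGen
            (fun x y => ∃ v, par x = some v ∧ y = Sum.inl v) e r := by
          have hroot : ∀ e, par e = none → e = r := fun e hp =>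
            kinj (((hnone e).1 hp).trans hr.symm)
          refine T.edge_induction (fun ε hε e he => ?_) (fun ε v hv ih e he => ?_)
          · cases hp : par e with
            | none => rw [hroot e hp]
            | some u =>
              have hu := hsome e u hp
              rw [he, hε] at hu
              cases hu
          · cases hp : par e with
            | none => rw [hroot e hp]
            | some u =>
              have hu := hsome e u hp
              rw [he, hv] at hu
              exact Relation.ReflTransGen.head ⟨u, hp, rfl⟩
                (ih (Sum.inl u) (congrArg Sum.inl (Option.some.inj hu).symm))
        exact key _ e rfl
      arity_pos := by
        rintro ⟨v, ⟨s, h1, h2⟩, h3⟩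
        obtain ⟨v', c, hvv, hc, hp⟩ := path_tail h1 h2
        cases hvv
        obtain ⟨e, he⟩ := kmem c ((Path.of_parent hc).trans h3) ⟨s, hp⟩
        refine ⟨e, ?_⟩
        cases hpe : par e with
        | none =>
          exfalso
          rw [← (hnone e).1 hpe, he] at h3
          exact not_path_of_parent hc h3
        | some u =>
          have hu := hsome e u hpe
          rw [he, hc] at hu
          exact congrArg some (Subtype.ext (Option.some.inj hu).symm)
      label := Equiv.refl S' }
  refine ⟨T', Subtype.val, ?_⟩
  have hk : minorEdge T' T lam Subtype.val = k := rfl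
  refine ⟨kinj, fun e u hu => hu.elim, fun e => ?_, fun e u hu => ?_⟩
  · rw [hk, col_empty, or_self_iff]
    exact hnone e
  · rw [hk, col_empty]
    exact hsome e u hu

end RTree
end OpBar
end

noncomputable section
namespace OpBar

open RTree

namespace WTree

variable {Q : SymSeq.{u}} {S S' S'' : Type}

/-- The total weight of the path from the top of an edge to the root. -/
abbrev depth (p : WTree Q S) (e : p.1.Edge) : ℝ := p.1.depth p.wt e

/-- The total weight of the path from the bottom of an edge to the root. -/
abbrev base (p : WTree Q S) (e : p.1.Edge) : ℝ := p.1.base p.wt e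

theorem wt_nonneg (p : WTree Q S) (e : p.1.Edge) : 0 ≤ p.wt e := p.2.2.2.1 e

theorem isWeighting (p : WTree Q S) : p.1.IsWeighting p.wt := p.2.2.2

theorem wt_eq (p : WTree Q S) (e : p.1.Edge) : p.wt e = p.depth e - p.base e := by
  rw [base, RTree.base]
  ring

theorem depth_inr (p : WTree Q S) (x : p.1.L) : p.depth (Sum.inr x) = 1 :=
  (isWeighting_iff.1 p.isWeighting).2 x

theorem edgeMap_eq_minorEdge (p' p : WTree Q S) (φ : p'.1.V → p.1.V) :
    edgeMap p' p φ = minorEdge p'.1 p.1 p.1.leaf φ := by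
  funext e
  rcases e with e | e <;> rfl

theorem edgeMap_eq_liftEdge (p' p : WTree Q S) (φ : p'.1.V → p.1.V) :
    edgeMap p' p φ = liftEdge p'.1 p.1 φ := rfl

/-! ## Agreement of labels -/

theorem LabelsAgree.trans {q' : WTree Q S''} {q : WTree Q S'} {p : WTree Q S}
    {κ' : q'.1.Edge → q.1.Edge} {κ : q.1.Edge → p.1.Edge} {u' : q'.1.V} {u : q.1.V} {v : p.1.V}
    (h' : LabelsAgree q' q κ' u' u) (h : LabelsAgree q p κ u v) :
    LabelsAgree q' p (κ ∘ κ') u' v := by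
  obtain ⟨σ', hσ', hl'⟩ := h'
  obtain ⟨σ, hσ, hl⟩ := h
  refine ⟨σ'.trans σ, fun e => ?_, ?_⟩
  · rw [Equiv.trans_apply, hσ, hσ']
    rfl
  · rw [Q.map_trans, hl', hl]

theorem LabelsAgree.congr {q : WTree Q S'} {p : WTree Q S} {κ κ' : q.1.Edge → p.1.Edge} {u : q.1.V}
    {v : p.1.V} (h : LabelsAgree q p κ u v) (hκ : ∀ e, q.1.parent e = some u → κ e = κ' e) :
    LabelsAgree q p κ' u v := by
  obtain ⟨σ, hσ, hl⟩ := h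
  exact ⟨σ, fun e => (hσ e).trans (hκ e.1 e.2), hl⟩

theorem LabelsAgree.parent {q : WTree Q S'} {p : WTree Q S} {κ : q.1.Edge → p.1.Edge} {u : q.1.V}
    {v : p.1.V} (h : LabelsAgree q p κ u v) {e : q.1.Edge} (he : q.1.parent e = some u) :
    p.1.parent (κ e) = some v := by
  obtain ⟨σ, hσ, -⟩ := h
  rw [← hσ ⟨e, he⟩]
  exact (σ ⟨e, he⟩).2

theorem LabelsAgree.exists_of_parent {q : WTree Q S'} {p : WTree Q S} {κ : q.1.Edge → p.1.Edge}
    {u : q.1.V} {v : p.1.V} (h : LabelsAgree q p κ u v) {ε : p.1.Edge}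
    (hε : p.1.parent ε = some v) : ∃ e, q.1.parent e = some u ∧ κ e = ε := by
  obtain ⟨σ, hσ, -⟩ := h
  refine ⟨(σ.symm ⟨ε, hε⟩).1, (σ.symm ⟨ε, hε⟩).2, ?_⟩
  rw [← hσ]
  exact congrArg Subtype.val (σ.apply_symm_apply ⟨ε, hε⟩)

theorem map_injective {X Y : Type} [Finite X] [Finite Y] (f : X ≃ Y) :
    Function.Injective (Q.map f) := by
  intro x y h
  have h' := congrArg (Q.map f.symm) h
  rwa [← Q.map_trans, ← Q.map_trans, Equiv.self_trans_symm, Q.map_refl, Q.map_refl] at h'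

theorem map_symm_eq_iff {X Y : Type} [Finite X] [Finite Y] (f : X ≃ Y) {x : Q.obj X}
    {y : Q.obj Y} : Q.map f.symm y = x ↔ y = Q.map f x := by
  constructor
  · rintro rfl
    rw [← Q.map_trans, Equiv.symm_trans_self, Q.map_refl]
  · rintro rfl
    rw [← Q.map_trans, Equiv.self_trans_symm, Q.map_refl]

theorem map_eq_pt_iff {X Y : Type} [Finite X] [Finite Y] (f : X ≃ Y) {x : Q.obj X} :
    Q.map f x = Based.pt ↔ x = Based.pt := by
  constructor
  · intro h
    exact map_injective f (h.trans (Q.map f).map_pt.symm)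
  · rintro rfl
    exact (Q.map f).map_pt

theorem LabelsAgree.lab_eq_pt_iff {q : WTree Q S'} {p : WTree Q S} {κ : q.1.Edge → p.1.Edge}
    {u : q.1.V} {v : p.1.V} (h : LabelsAgree q p κ u v) :
    q.lab u = Based.pt ↔ p.lab v = Based.pt := by
  obtain ⟨σ, -, hl⟩ := h
  rw [← hl, map_eq_pt_iff]

/-- Two pieces are compared through the tree that contains both: labels that agree with the same
label of `p` agree with each other. -/
theorem LabelsAgree.cancel {q' : WTree Q S''} {q : WTree Q S'} {p : WTree Q S}
    {κ' : q'.1.Edge → p.1.Edge} {κ : q.1.Edge → p.1.Edge} {g : q'.1.Edge → q.1.Edge}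
    {u' : q'.1.V} {u : q.1.V} {v : p.1.V} (h' : LabelsAgree q' p κ' u' v)
    (h : LabelsAgree q p κ u v) (hκ : Function.Injective κ)
    (hg : ∀ e, q'.1.parent e = some u' → κ (g e) = κ' e) : LabelsAgree q' q g u' u := by
  obtain ⟨σ', hσ', hl'⟩ := h'
  obtain ⟨σ, hσ, hl⟩ := h
  refine ⟨σ'.trans σ.symm, fun e => ?_, ?_⟩
  · apply hκ
    rw [← hσ, Equiv.trans_apply, Equiv.apply_symm_apply, hσ', hg e.1 e.2]
  · rw [Q.map_trans, hl', map_symm_eq_iff, hl]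

/-! ## Depth in isomorphic trees and after removal of a vertex -/

theorem base_eq_base {q : WTree Q S'} {p : WTree Q S} {ψ : q.1.V → p.1.V} {e : q.1.Edge}
    {ε : p.1.Edge} (hp : p.1.parent ε = (q.1.parent e).map ψ)
    (hd : ∀ u, q.depth (Sum.inl u) = p.depth (Sum.inl (ψ u))) : q.base e = p.base ε := by
  rw [base, base, base_eq, base_eq, hp]
  cases q.1.parent e with
  | none => rfl
  | some u => exact hd u

theorem depth_collapse (p : WTree Q S) (v : p.1.V) (e : p.1.Edge) [Decidable (p.1.parent e = some v)] :
    p.depth e = p.wt e + (if p.1.parent e = some v then p.wt (Sum.inl v) else 0) +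
      p.base (p.1.collapse v e) := by
  split_ifs with h
  · rw [collapse, if_pos h, depth, depth_eq, base_of_parent h, depth_eq]
    ring
  · rw [collapse, if_neg h, depth, depth_eq]
    ring

/-- The weight of the removed edge is added to the edges above it, so no surviving edge changes its
distance to the root. -/
theorem IsRemoval.depth_eq {p' p : WTree Q S} {v : p.1.V} {φ : p'.1.V → p.1.V}
    (h : IsRemoval p' p v φ) (e : p'.1.Edge) : p'.depth e = p.depth (edgeMap p' p φ e) := by
  classical
  symm
  refine depth_unique (f := fun e => p.depth (edgeMap p' p φ e)) (fun e => ?_) e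
  rw [depth_collapse p v, h.weight, base, base_eq, h.parent]
  congr 1
  cases p'.1.parent e <;> rfl

theorem IsIso.depth_eq {p' p : WTree Q S} {φ : p'.1.V ≃ p.1.V} (h : IsIso p' p φ)
    (e : p'.1.Edge) : p'.depth e = p.depth (edgeMap p' p φ e) := by
  symm
  refine depth_unique (f := fun e => p.depth (edgeMap p' p φ e)) (fun e => ?_) e
  rw [depth, RTree.depth_eq, h.weight, base_eq, h.parent]
  congr 1
  cases p'.1.parent e <;> rfl

theorem edgeMap_injective {p' p : WTree Q S} {φ : p'.1.V → p.1.V} (h : Function.Injective φ) :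
    Function.Injective (edgeMap p' p φ) :=
  Sum.map_injective.2 ⟨h, p.1.label.symm.injective.comp p'.1.label.injective⟩

theorem IsRemoval.isMinor {p' p : WTree Q S} {v : p.1.V} {φ : p'.1.V → p.1.V}
    (h : IsRemoval p' p v φ) : IsMinor p'.1 p.1 p.1.leaf p.1.root {v} φ := by
  have hne : ∀ u, φ u ≠ v := by
    intro u hu
    have : φ u ∈ Set.range φ := ⟨u, rfl⟩
    rw [h.range] at this
    exact this hu
  have hp : ∀ e, p.1.parent (p.1.col {v} (minorEdge p'.1 p.1 p.1.leaf φ e)) =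
      (p'.1.parent e).map φ := by
    intro e
    rw [← edgeMap_eq_minorEdge, col_singleton]
    exact h.parent e
  refine ⟨?_, ?_, fun e => ?_, fun e u hu => ?_⟩
  · rw [← edgeMap_eq_minorEdge]
    exact edgeMap_injective h.injective
  · rintro (u' | x) u hu heq
    · exact hne u' ((Sum.inl_injective heq).trans (Set.mem_singleton_iff.1 hu))
    · cases heq
  · have := hp e
    constructor
    · intro he
      rw [he] at this
      exact Or.inr (eq_root_iff.2 this)
    · rintro (he | he)
      · have he' : p.1.col {v} (minorEdge p'.1 p.1 p.1.leaf φ e) = p.1.root := by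
          rw [he]
          refine col_of_forall fun u _ hu => ?_
          rw [parent_root] at hu
          cases hu
        rw [he', parent_root] at this
        exact Option.map_eq_none_iff.1 this.symm
      · rw [he, parent_root] at this
        exact Option.map_eq_none_iff.1 this.symm
  · rw [hp, hu]
    rfl

theorem IsIso.isMinor {p' p : WTree Q S} {φ : p'.1.V ≃ p.1.V} (h : IsIso p' p φ) :
    IsMinor p'.1 p.1 p.1.leaf p.1.root ∅ φ := by
  have hp : ∀ e, p.1.parent (p.1.col ∅ (minorEdge p'.1 p.1 p.1.leaf φ e)) =
      (p'.1.parent e).map φ := by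
    intro e
    rw [← edgeMap_eq_minorEdge, col_empty]
    exact h.parent e
  refine ⟨?_, fun e u hu => hu.elim, fun e => ?_, fun e u hu => ?_⟩
  · rw [← edgeMap_eq_minorEdge]
    exact edgeMap_injective φ.injective
  · have := hp e
    rw [col_empty] at this ⊢
    rw [or_self_iff, eq_root_iff, this, Option.map_eq_none_iff]
  · rw [hp, hu]
    rfl

/-! ## Pieces of labelled weighted trees -/

/-- The labelled weighted tree `q` is the part of `p` between the edge `bot` and the edges `lam s`,
with the same labels, where the point at depth `d e` on top of the edge `e` gets depth `f e`. -/
structure IsPiece (q : WTree Q S') (p : WTree Q S) (lam : S' → p.1.Edge) (bot : p.1.Edge)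
    (φ : q.1.V → p.1.V) (f : p.1.Edge → ℝ) : Prop where
  minor : IsMinor q.1 p.1 lam bot ∅ φ
  labels : ∀ v, LabelsAgree q p (minorEdge q.1 p.1 lam φ) v (φ v)
  depth : ∀ e, q.depth e = f (minorEdge q.1 p.1 lam φ e)

variable {p : WTree Q S} {lam : S' → p.1.Edge} {bot : p.1.Edge} {f : p.1.Edge → ℝ}

theorem IsPiece.base {q : WTree Q S'} {φ : q.1.V → p.1.V} (h : IsPiece q p lam bot φ f)
    {e : q.1.Edge} (he : minorEdge q.1 p.1 lam φ e ≠ bot) :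
    ∃ v, p.1.parent (minorEdge q.1 p.1 lam φ e) = some v ∧ q.base e = f (Sum.inl v) := by
  cases hp : q.1.parent e with
  | none => exact absurd (h.minor.parent_none_piece.1 hp) he
  | some u =>
    refine ⟨φ u, h.minor.parent_some_piece hp, ?_⟩
    rw [WTree.base, base_of_parent hp]
    exact h.depth _

theorem IsPiece.base_of_eq_bot {q : WTree Q S'} {φ : q.1.V → p.1.V} (h : IsPiece q p lam bot φ f)
    {e : q.1.Edge} (he : minorEdge q.1 p.1 lam φ e = bot) : q.base e = 0 :=
  base_of_parent_none (h.minor.parent_none_piece.2 he)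

/-- Iterated decompositions become pieces of the original tree in this way. Only the values of the
depth function on the image matter, which leaves room for a convenient formula `F`. -/
theorem IsPiece.comp {p₀ : WTree Q S''} {q : WTree Q S'} {lam₀ : S → p₀.1.Edge}
    {bot₀ : p₀.1.Edge} {φ₀ : p.1.V → p₀.1.V} {f₀ : p₀.1.Edge → ℝ} {φ : q.1.V → p.1.V}
    {F : p₀.1.Edge → ℝ} {bot' : p₀.1.Edge}
    (h : IsPiece q p lam bot φ f) (h₀ : IsPiece p p₀ lam₀ bot₀ φ₀ f₀)
    (hbot : minorEdge p.1 p₀.1 lam₀ φ₀ bot = bot')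
    (hF : ∀ e ∈ Set.range (minorEdge q.1 p.1 lam φ), f e = F (minorEdge p.1 p₀.1 lam₀ φ₀ e)) :
    IsPiece q p₀ (minorEdge p.1 p₀.1 lam₀ φ₀ ∘ lam) bot' (φ₀ ∘ φ) F := by
  have hκ : minorEdge q.1 p₀.1 (minorEdge p.1 p₀.1 lam₀ φ₀ ∘ lam) (φ₀ ∘ φ) =
      minorEdge p.1 p₀.1 lam₀ φ₀ ∘ minorEdge q.1 p.1 lam φ := by
    funext e
    rcases e with e | e <;> rfl
  refine ⟨h.minor.comp h₀.minor fun e => ?_, fun v => ?_, fun e => ?_⟩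
  · rw [col_empty, or_self_iff, ← hbot, h₀.minor.inj.eq_iff]
  · rw [hκ]
    exact (h.labels v).trans (h₀.labels (φ v))
  · rw [hκ, h.depth, hF _ ⟨e, rfl⟩]
    rfl

/-- A minor without one or no vertex of a piece is isomorphic to the piece if the vertex does not
belong to the piece. -/
theorem IsPiece.exists_isIso {q₁ q₂ : WTree Q S'} {φ₁ : q₁.1.V → p.1.V} {φ₂ : q₂.1.V → p.1.V}
    {R : Set p.1.V} (h₁ : IsPiece q₁ p lam bot φ₁ f) (h₂ : IsMinor q₂.1 p.1 lam bot R φ₂)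
    (hR : ∀ v ∈ R, v ∉ Set.range φ₁) (hR' : ∀ v ∈ R, ∀ s, lam s ≠ Sum.inl v)
    (hlab : ∀ u, (∀ v ∈ R, p.1.parent (Sum.inl v) ≠ some (φ₂ u)) →
      LabelsAgree q₂ p (minorEdge q₂.1 p.1 lam φ₂) u (φ₂ u))
    (hd : ∀ e, q₂.depth e = f (minorEdge q₂.1 p.1 lam φ₂ e)) :
    ∃ ψ : q₂.1.V ≃ q₁.1.V, IsIso q₂ q₁ ψ := by
  obtain ⟨ψ, hψ⟩ := h₁.minor.exists_lift h₂
  have hbij : Function.Bijective ψ := by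
    refine ⟨h₂.lift_injective hψ, fun u => ?_⟩
    have : u ∈ Set.range ψ := by
      rw [h₁.minor.lift_range h₂ hψ]
      exact fun hu => hR _ hu ⟨u, rfl⟩
    exact this
  have hdep : ∀ e, q₂.depth e = q₁.depth (liftEdge q₂.1 q₁.1 ψ e) := by
    intro e
    rw [hd, h₁.depth, minorEdge_liftEdge hψ]
  have hpar := h₁.minor.lift_parent_of_notMem h₂ hψ hR hR'
  refine ⟨Equiv.ofBijective ψ hbij, fun e => hpar e, fun e => ?_, fun u => ?_⟩
  · have hb : q₂.base e = q₁.base (liftEdge q₂.1 q₁.1 ψ e) :=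
      base_eq_base (hpar e) fun u => hdep (Sum.inl u)
    change q₂.wt e = q₁.wt (liftEdge q₂.1 q₁.1 ψ e)
    rw [wt_eq, wt_eq, hb, hdep]
  · have hu := h₁.labels (ψ u)
    rw [hψ] at hu
    refine (hlab u fun v hv hp => ?_).cancel hu h₁.minor.inj
      fun e _ => minorEdge_liftEdge hψ e
    obtain ⟨e, -, he⟩ := hu.exists_of_parent hp
    exact hR v hv (h₁.minor.mem_range_vertex_iff.2 ⟨⟨e, he⟩, hR' v hv⟩)

/-- Here `q₁` is the piece of the tree before removal of the vertex and `q₂` the piece of the tree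
after it, viewed in the former as a minor. Equality of depths gives the rule for the weights,
because a weight is a depth minus a base. -/
theorem IsPiece.exists_isRemoval {q₁ q₂ : WTree Q S'} {φ₁ : q₁.1.V → p.1.V}
    {φ₂ : q₂.1.V → p.1.V} {v : q₁.1.V} (h₁ : IsPiece q₁ p lam bot φ₁ f)
    (h₂ : IsMinor q₂.1 p.1 lam bot {φ₁ v} φ₂)
    (hlab : ∀ u, p.1.parent (Sum.inl (φ₁ v)) ≠ some (φ₂ u) →
      LabelsAgree q₂ p (minorEdge q₂.1 p.1 lam φ₂) u (φ₂ u))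
    (hd : ∀ e, q₂.depth e = f (minorEdge q₂.1 p.1 lam φ₂ e)) :
    ∃ ψ : q₂.1.V → q₁.1.V, (∀ u, φ₁ (ψ u) = φ₂ u) ∧ IsRemoval q₂ q₁ v ψ := by
  obtain ⟨ψ, hψ⟩ := h₁.minor.exists_lift h₂
  have hdep : ∀ e, q₂.depth e = q₁.depth (liftEdge q₂.1 q₁.1 ψ e) := by
    intro e
    rw [hd, h₁.depth, minorEdge_liftEdge hψ]
  have hpar := h₁.minor.lift_parent h₂ hψ
  refine ⟨ψ, hψ, h₂.lift_injective hψ, ?_, fun e => hpar e, fun e => ?_, fun u hu => ?_⟩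
  · rw [h₁.minor.lift_range h₂ hψ]
    ext t
    rw [Set.mem_ofPred_eq, Set.mem_singleton_iff, h₁.minor.injective_vertex.eq_iff]
    rfl
  · classical
    have hb : q₂.base e = q₁.base (q₁.1.collapse v (liftEdge q₂.1 q₁.1 ψ e)) :=
      base_eq_base (hpar e) fun u => hdep (Sum.inl u)
    rw [wt_eq, hb, hdep, depth_collapse q₁ v, edgeMap_eq_liftEdge]
    simp only [add_sub_cancel_right]
  · have hl := h₁.labels (ψ u)
    rw [hψ] at hl
    refine (hlab u fun hp => hu ?_).cancel hl h₁.minor.inj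
      fun e _ => minorEdge_liftEdge hψ e
    refine h₁.minor.parent_iff_piece.2 ?_
    rw [hψ]
    exact hp

theorem IsPiece.exists_isUnstableRemoval {q₁ q₂ : WTree Q S'} {φ₁ : q₁.1.V → p.1.V}
    {φ₂ : q₂.1.V → p.1.V} {v : q₁.1.V} (h₁ : IsPiece q₁ p lam bot φ₁ f)
    (h₂ : IsMinor q₂.1 p.1 lam bot {φ₁ v} φ₂) (hv : p.1.Unstable (φ₁ v))
    (hlab : ∀ u, p.1.parent (Sum.inl (φ₁ v)) ≠ some (φ₂ u) →
      LabelsAgree q₂ p (minorEdge q₂.1 p.1 lam φ₂) u (φ₂ u))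
    (hlab' : ∀ u, p.1.parent (Sum.inl (φ₁ v)) = some (φ₂ u) →
      LabelsAgree q₂ p (p.1.collapse (φ₁ v) ∘ minorEdge q₂.1 p.1 lam φ₂) u (φ₂ u))
    (hd : ∀ e, q₂.depth e = f (minorEdge q₂.1 p.1 lam φ₂ e)) :
    ∃ ψ : q₂.1.V → q₁.1.V, IsUnstableRemoval q₂ q₁ v ψ := by
  obtain ⟨ψ, hψ, h⟩ := h₁.exists_isRemoval h₂ hlab hd
  refine ⟨ψ, h, ?_, fun u hu => ?_⟩
  · obtain ⟨σ, -, -⟩ := h₁.labels v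
    rw [Unstable, Nat.card_congr σ]
    exact hv
  · have hl := h₁.labels (ψ u)
    rw [hψ] at hl
    refine (hlab' u ?_).cancel hl h₁.minor.inj fun e _ => ?_
    · rw [← hψ]
      exact h₁.minor.parent_some_piece hu
    · rw [Function.comp_apply, h₁.minor.map_collapse, edgeMap_eq_liftEdge, minorEdge_liftEdge hψ,
        col_singleton]
      rfl

theorem _root_.OpBar.Operad.exists_comp_eq (Q : Operad.{u}) {A A' B B' C C' : Type}
    [Finite A] [Finite A'] [Finite B] [Finite B'] [Finite C] [Finite C'] {a : A} {a' : A'}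
    (σ : C' ≃ C) (τ : C ≃ Graft A a B) (f : A' ≃ A) (g : B' ≃ B) (ha : f a' = a)
    {x' : Q.obj A'} {y' : Q.obj B'} {z' : Q.obj C'}
    (h : Q.map τ (Q.map σ z') = Q.comp a (Q.map f x') (Q.map g y')) :
    ∃ τ' : C' ≃ Graft A' a' B', (∀ c, Sum.map (fun x => f x.1) g (τ' c) =
      Sum.map Subtype.val id (τ (σ c))) ∧ Q.map τ' z' = Q.comp a' x' y' := by
  subst ha
  refine ⟨(σ.trans τ).trans (graftCongr f a' g).symm, fun c => ?_, ?_⟩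
  · rw [Equiv.trans_apply, Equiv.trans_apply]
    generalize τ (σ c) = t
    rcases t with t | t
    · refine congrArg Sum.inl ?_
      exact f.apply_symm_apply t.1
    · refine congrArg Sum.inr ?_
      exact g.apply_symm_apply t
  · rw [Q.map_trans, map_symm_eq_iff, Q.map_trans, h, Q.comp_map]

/-- The hypothesis `hv` says that the contracted edge is not the bottom of the piece. Then the
vertex below it belongs to the piece as well, and the composition of the two labels can be carried
out there. -/
theorem IsPiece.exists_isContraction {Q : Operad.{u}} {p : WTree Q.toSymSeq S}
    {lam : S' → p.1.Edge} {bot : p.1.Edge} {f : p.1.Edge → ℝ} {q₁ q₂ : WTree Q.toSymSeq S'}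
    {p' : WTree Q.toSymSeq S} {φ : p'.1.V → p.1.V}
    {lam' : S' → p'.1.Edge} {φ' : q₂.1.V → p'.1.V} {φ₁ : q₁.1.V → p.1.V} {v : q₁.1.V}
    (hp : IsContraction p' p (φ₁ v) φ) (h₁ : IsPiece q₁ p lam bot φ₁ f)
    (h₂' : ∀ u, LabelsAgree q₂ p' (minorEdge q₂.1 p'.1 lam' φ') u (φ' u))
    (hlam : ∀ s, edgeMap p' p φ (lam' s) = lam s)
    (h₂ : IsMinor q₂.1 p.1 lam bot {φ₁ v} (φ ∘ φ')) (hv : Sum.inl (φ₁ v) ≠ bot)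
    (hd : ∀ e, q₂.depth e = f (minorEdge q₂.1 p.1 lam (φ ∘ φ') e)) :
    ∃ ψ : q₂.1.V → q₁.1.V, IsContraction q₂ q₁ v ψ := by
  have hκ : ∀ e, minorEdge q₂.1 p.1 lam (φ ∘ φ') e =
      edgeMap p' p φ (minorEdge q₂.1 p'.1 lam' φ' e) := by
    rintro (e | e)
    · rfl
    · exact (hlam _).symm
  obtain ⟨ψ, hψ, h⟩ := h₁.exists_isRemoval h₂ (fun u hu => by
    refine ((h₂' u).trans (hp.labels (φ' u) hu)).congr fun e _ => (hκ e).symm) hd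
  refine ⟨ψ, h, ?_, fun u hu => ?_⟩
  · intro hn
    exact hv (h₁.minor.parent_none_piece.1 hn)
  · have hpu : p.1.parent (Sum.inl (φ₁ v)) = some (φ (φ' u)) := by
      rw [show φ (φ' u) = φ₁ (ψ u) from (hψ u).symm]
      exact h₁.minor.parent_some_piece hu
    obtain ⟨τ, hτ, hτl⟩ := hp.label_below (φ' u) hpu
    obtain ⟨σ, hσ, hσl⟩ := h₂' u
    have hl : LabelsAgree q₁ p (minorEdge q₁.1 p.1 lam φ₁) (ψ u) (φ (φ' u)) := by
      have := h₁.labels (ψ u)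
      rwa [hψ] at this
    obtain ⟨α, hα, hαl⟩ := hl
    obtain ⟨β, hβ, hβl⟩ := h₁.labels v
    obtain ⟨τ', h1, h2⟩ := Q.exists_comp_eq (a' := ⟨Sum.inl v, hu⟩) (x' := q₁.lab (ψ u))
      (y' := q₁.lab v) (z' := q₂.lab u) σ τ α β (Subtype.ext (hα _)) (by
        rw [hσl, hτl, ← hαl, ← hβl])
    refine ⟨τ', fun e => h₁.minor.inj ?_, h2⟩
    rw [edgeMap_eq_liftEdge, minorEdge_liftEdge hψ]
    have h3 := hτ (σ e)
    rw [hσ] at h3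
    rw [hκ, ← h3]
    have h4 := h1 e
    generalize τ (σ e) = t at h3 h4 ⊢
    generalize τ' e = t' at h4 ⊢
    rcases t with t | t <;> rcases t' with t' | t'
    · have h5 := Sum.inl_injective h4
      change α t'.1 = t.1 at h5
      change minorEdge q₁.1 p.1 lam φ₁ t'.1.1 = t.1.1
      rw [← h5, hα]
    · cases h4
    · cases h4
    · have h5 := Sum.inr_injective h4
      change β t' = t at h5
      change minorEdge q₁.1 p.1 lam φ₁ t'.1 = t.1
      rw [← h5, hβ]

theorem _root_.OpBar.BarObj.mk_eq_of_isIso {Q : AugmentedOperad.{u}} {p p' : WTree Q.toSymSeq S}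
    (h : ∃ φ : p'.1.V ≃ p.1.V, IsIso p' p φ) : BarObj.mk p = BarObj.mk p' := by
  obtain ⟨φ, h⟩ := h
  exact Quot.sound (BarRel.iso p p' φ h)

/-- Two pieces between the same edges and with the same depths are isomorphic. -/
theorem IsPiece.mk_eq {Q : AugmentedOperad.{u}} {p : WTree Q.toSymSeq S} {lam lam' : S' → p.1.Edge}
    {bot bot' : p.1.Edge} {f f' : p.1.Edge → ℝ} {q₁ q₂ : WTree Q.toSymSeq S'}
    {φ₁ : q₁.1.V → p.1.V} {φ₂ : q₂.1.V → p.1.V} (h₁ : IsPiece q₁ p lam bot φ₁ f)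
    (h₂ : IsPiece q₂ p lam' bot' φ₂ f') (hlam : lam = lam') (hbot : bot = bot')
    (hf : ∀ e ∈ Set.range (minorEdge q₂.1 p.1 lam' φ₂), f e = f' e) :
    BarObj.mk q₁ = BarObj.mk q₂ := by
  subst hlam hbot
  exact BarObj.mk_eq_of_isIso (h₁.exists_isIso h₂.minor (fun v hv => hv.elim)
    (fun v hv => hv.elim) (fun u _ => h₂.labels u)
    (fun e => (h₂.depth e).trans (hf _ ⟨e, rfl⟩).symm))

/-- For the counit laws, where one factor of the decomposition has to be recognised as the tree
itself. -/
theorem isPiece_self (p : WTree Q S) : IsPiece p p p.1.leaf p.1.root id p.depth := by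
  have hκ : minorEdge p.1 p.1 p.1.leaf id = id := by
    funext e
    rcases e with e | x
    · rfl
    · exact leaf_label x
  refine ⟨⟨?_, fun e u hu => hu.elim, fun e => ?_, fun e u hu => ?_⟩, fun v => ?_, fun e => ?_⟩
  · rw [hκ]
    exact Function.injective_id
  · rw [hκ, col_empty, or_self_iff, id, eq_root_iff]
  · rw [hκ, col_empty]
    exact hu
  · rw [hκ]
    exact ⟨Equiv.refl _, fun _ => rfl, Q.map_refl _ _⟩
  · rw [hκ]
    rfl

end WTree
end OpBar
end

noncomputable section
namespace OpBar

namespace RTree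

/-! ## Degrafting of trees -/

section

variable {S : Type} {T : RTree S} {Y : Set T.L} {top bot : T.Edge} {w : T.Edge → ℝ}

/-- Depths telescope along the branch: `depth top - base bot` is its total weight. -/
theorem IsCut.base_lt_depth_iff (h : T.IsCut Y top bot) (hw : ∀ e, 0 ≤ w e) :
    T.base w bot < T.depth w top ↔ ∃ e, T.leavesAbove e = Y ∧ w e ≠ 0 := by
  constructor
  · intro hlt
    by_contra! hcon
    have key : ∀ e, T.Path top e → T.Path e bot → T.depth w e = T.base w bot := by
      refine T.edge_induction (fun e he h1 h2 => ?_) (fun e v hv ih h1 h2 => ?_)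
      all_goals
        have h0 := hcon e (h.mid_iff.2 ⟨h1, h2⟩)
        by_cases heb : e = bot
        · rw [heb, depth_eq, ← heb, h0, zero_add]
      · rcases path_iff_eq_or.1 h2 with h' | ⟨u, hu, -⟩
        · exact absurd h' heb
        · rw [he] at hu
          cases hu
      · rw [depth_eq, h0, zero_add, base_of_parent hv]
        exact ih (h1.trans (Path.of_parent hv)) (path_parent hv h2 heb)
    rw [key top (Path.refl _) (h.branch top h.leaves_top).2] at hlt
    exact lt_irrefl _ hlt
  · rintro ⟨e, he, hne⟩
    obtain ⟨h1, h2⟩ := h.branch e he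
    have h3 := base_mono hw h2
    have h4 := depth_mono hw h1
    have h5 := depth_eq w e
    have h6 := (hw e).lt_of_ne hne.symm
    linarith

open Classical in
/-- The depth in the lower tree of a degrafting. -/
def lowerDepth (T : RTree S) (w : T.Edge → ℝ) (Y : Set T.L) (top bot e : T.Edge) : ℝ :=
  if T.leavesAbove e = Y then
    T.base w bot + (1 - T.base w bot) / (T.depth w top - T.base w bot) *
      (T.depth w e - T.base w bot)
  else T.depth w e

/-- The depth in the upper tree of a degrafting. -/
def upperDepth (T : RTree S) (w : T.Edge → ℝ) (bot e : T.Edge) : ℝ :=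
  (T.depth w e - T.base w bot) / (1 - T.base w bot)

theorem lowerDepth_of_mid {e : T.Edge} (h : T.leavesAbove e = Y) :
    T.lowerDepth w Y top bot e = T.base w bot +
      (1 - T.base w bot) / (T.depth w top - T.base w bot) * (T.depth w e - T.base w bot) :=
  if_pos h

theorem lowerDepth_of_ne {e : T.Edge} (h : T.leavesAbove e ≠ Y) :
    T.lowerDepth w Y top bot e = T.depth w e :=
  if_neg h

open Classical in
-- This is the recursion required by `depth_unique`. The condition `he` says that `e` is not
-- strictly above the branch, so the edge below an edge off the branch is off the branch too.
theorem IsCut.lowerDepth_eq (h : T.IsCut Y top bot) {e : T.Edge}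
    (he : T.leavesAbove e ⊆ Y → T.leavesAbove e = Y) :
    T.lowerDepth w Y top bot e =
      (if T.leavesAbove e = Y then
        (1 - T.base w bot) / (T.depth w top - T.base w bot) * w e else w e) +
      (T.parent e).elim 0 (fun v => T.lowerDepth w Y top bot (Sum.inl v)) := by
  have hd := depth_eq w e
  by_cases hm : T.leavesAbove e = Y
  · rw [lowerDepth_of_mid hm, if_pos hm]
    cases hp : T.parent e with
    | none =>
      have heb : bot = e := by
        have := (h.branch e hm).2
        rw [eq_root_iff.2 hp] at this ⊢
        exact eq_root_of_path this
      rw [base_of_parent_none hp] at hd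
      rw [heb, base_of_parent_none hp, hd, Option.elim_none]
      ring
    | some v =>
      rw [base_of_parent hp] at hd
      rw [Option.elim_some]
      by_cases hv : T.leavesAbove (Sum.inl v) = Y
      · rw [lowerDepth_of_mid hv, hd]
        ring
      -- At the lower end of the branch the rescaled and the old depth take the same value `base
      -- bot`, so the two formulas fit together.
      · have heb : e = bot := by
          by_contra hne
          have h1 := h.branch e hm
          exact hv (h.mid_iff.2 ⟨h1.1.trans (Path.of_parent hp), path_parent hp h1.2 hne⟩)
        rw [lowerDepth_of_ne hv, ← heb, base_of_parent hp, hd]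
        ring
  · rw [lowerDepth_of_ne hm, if_neg hm]
    cases hp : T.parent e with
    | none => rw [hd, base_of_parent_none hp, Option.elim_none]
    | some v =>
      rw [Option.elim_some, lowerDepth_of_ne, hd, base_of_parent hp]
      intro hv
      exact hm (he (hv ▸ leavesAbove_mono (Path.of_parent hp)))

open Classical in
theorem upperDepth_eq {e : T.Edge} (he : T.Path e bot) :
    T.upperDepth w bot e = 1 / (1 - T.base w bot) * w e +
      if e = bot then 0 else (T.parent e).elim 0 (fun v => T.upperDepth w bot (Sum.inl v)) := by
  have hd := depth_eq w e
  rw [upperDepth]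
  split_ifs with hb
  · rw [hd, hb]
    ring
  · rcases path_iff_eq_or.1 he with h | ⟨v, hv, -⟩
    · exact absurd h hb
    · rw [hv, Option.elim_some, upperDepth, hd, base_of_parent hv]
      ring

end

section

variable {A B : Type} {a : A} {T : RTree (Graft A a B)} {top bot : T.Edge}

/-- The set of leaves with label in `B`. -/
def cutSet (T : RTree (Graft A a B)) : Set T.L := {x | ∃ b, T.label x = Sum.inr b}

open Classical in
/-- The leaves of the lower tree of a degrafting. -/
def lowerLeaf (T : RTree (Graft A a B)) (top : T.Edge) (s : A) : T.Edge :=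
  if h : s = a then top else T.leaf (Sum.inl ⟨s, h⟩)

/-- The leaves of the upper tree of a degrafting. -/
def upperLeaf (T : RTree (Graft A a B)) (b : B) : T.Edge := T.leaf (Sum.inr b)

theorem lowerLeaf_self : T.lowerLeaf top a = top := dif_pos rfl

theorem lowerLeaf_of_ne {s : A} (h : s ≠ a) : T.lowerLeaf top s = T.leaf (Sum.inl ⟨s, h⟩) :=
  dif_neg h

theorem mem_cutSet {x : T.L} : x ∈ T.cutSet ↔ ∃ b, T.label x = Sum.inr b := Iff.rfl

theorem label_symm_inl_notMem (s : {x : A // x ≠ a}) : T.label.symm (Sum.inl s) ∉ T.cutSet := by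
  rintro ⟨b, hb⟩
  rw [Equiv.apply_symm_apply] at hb
  cases hb

theorem label_symm_inr_mem (b : B) : T.label.symm (Sum.inr b) ∈ T.cutSet :=
  ⟨b, T.label.apply_symm_apply _⟩

theorem IsCut.lowerLeaf_anti (h : T.IsCut T.cutSet top bot) (s s' : A)
    (hp : T.Path (T.lowerLeaf top s) (T.lowerLeaf top s')) : s = s' := by
  by_cases hs : s = a <;> by_cases hs' : s' = a
  · rw [hs, hs']
  · rw [hs, lowerLeaf_self, lowerLeaf_of_ne hs'] at hp
    refine absurd ?_ (label_symm_inl_notMem (T := T) ⟨s', hs'⟩)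
    rw [← h.leaves_top, path_inr hp]
    exact Path.refl _
  · rw [hs', lowerLeaf_self, lowerLeaf_of_ne hs] at hp
    refine absurd ?_ (label_symm_inl_notMem (T := T) ⟨s, hs⟩)
    rw [← h.leaves_top]
    exact hp
  · rw [lowerLeaf_of_ne hs, lowerLeaf_of_ne hs'] at hp
    have := T.label.symm.injective (Sum.inr_injective (path_inr hp))
    exact congrArg Subtype.val (Sum.inl_injective this)

theorem IsCut.lowerLeaf_cover (h : T.IsCut T.cutSet top bot) (x : T.L) :
    ∃ s, T.Path (Sum.inr x) (T.lowerLeaf top s) := by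
  rcases hx : T.label x with s | b
  · refine ⟨s.1, ?_⟩
    rw [lowerLeaf_of_ne s.2, ← hx, leaf_label]
    exact Path.refl _
  · refine ⟨a, ?_⟩
    rw [lowerLeaf_self]
    have : x ∈ T.leavesAbove top := by
      rw [h.leaves_top]
      exact ⟨b, hx⟩
    exact this

theorem upperLeaf_anti (b b' : B) (hp : T.Path (T.upperLeaf b) (T.upperLeaf b')) : b = b' :=
  Sum.inr_injective (T.label.symm.injective (Sum.inr_injective (path_inr hp)))

theorem IsCut.path_upperLeaf (h : T.IsCut T.cutSet top bot) (b : B) :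
    T.Path (T.upperLeaf b) bot := by
  have : T.label.symm (Sum.inr b) ∈ T.leavesAbove bot := by
    rw [h.leaves_bot]
    exact label_symm_inr_mem b
  exact this

theorem IsCut.upperLeaf_cover (h : T.IsCut T.cutSet top bot) (x : T.L)
    (hx : T.Path (Sum.inr x) bot) : ∃ b, T.Path (Sum.inr x) (T.upperLeaf b) := by
  have : x ∈ T.leavesAbove bot := hx
  rw [h.leaves_bot] at this
  obtain ⟨b, hb⟩ := this
  refine ⟨b, ?_⟩
  rw [upperLeaf, ← hb, leaf_label]
  exact Path.refl _

theorem IsCut.nonempty_right (h : T.IsCut T.cutSet top bot) : Nonempty B := by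
  obtain ⟨x, b, -⟩ := h.nonempty
  exact ⟨b⟩

theorem IsCut.exists_lower [Finite A] (h : T.IsCut T.cutSet top bot) :
    ∃ (T' : RTree A) (φ : T'.V → T.V), IsMinor T' T (T.lowerLeaf top) T.root ∅ φ := by
  have : Nonempty A := ⟨a⟩
  exact exists_isMinor T (fun _ => path_root _) h.lowerLeaf_anti

theorem IsCut.exists_upper [Finite B] (h : T.IsCut T.cutSet top bot) :
    ∃ (T' : RTree B) (φ : T'.V → T.V), IsMinor T' T T.upperLeaf bot ∅ φ := by
  have := h.nonempty_right
  exact exists_isMinor T h.path_upperLeaf upperLeaf_anti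

/-- An edge is lost from the lower tree exactly if it is strictly above the branch. An edge off the
branch that is kept either has a leaf outside the cut set above it, or it is excluded by the
implication. -/
theorem IsCut.mem_range_lower_iff (h : T.IsCut T.cutSet top bot) {T' : RTree A}
    {φ : T'.V → T.V} (hm : IsMinor T' T (T.lowerLeaf top) T.root ∅ φ) {e : T.Edge} :
    e ∈ Set.range (minorEdge T' T (T.lowerLeaf top) φ) ↔
      (T.leavesAbove e ⊆ T.cutSet → T.leavesAbove e = T.cutSet) := by
  rw [hm.mem_range_iff]
  constructor
  · rintro ⟨-, -, s, hs⟩ hsub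
    by_cases hsa : s = a
    · rw [hsa, lowerLeaf_self] at hs
      exact Set.Subset.antisymm hsub (h.path_top_iff.1 hs)
    · rw [lowerLeaf_of_ne hsa] at hs
      exact absurd (hsub hs) (label_symm_inl_notMem _)
  · intro he
    refine ⟨fun u hu => hu.elim, path_root _, ?_⟩
    by_cases hm : T.leavesAbove e = T.cutSet
    · exact ⟨a, lowerLeaf_self (T := T) ▸ (h.branch e hm).1⟩
    · obtain ⟨x, hx, hxc⟩ := Set.not_subset.1 fun hsub => hm (he hsub)
      rcases hl : T.label x with s | b
      · refine ⟨s.1, ?_⟩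
        rw [lowerLeaf_of_ne s.2, ← hl, leaf_label]
        exact hx
      · exact absurd ⟨b, hl⟩ hxc

theorem IsCut.mem_range_upper_iff (h : T.IsCut T.cutSet top bot) {T' : RTree B}
    {φ : T'.V → T.V} (hm : IsMinor T' T T.upperLeaf bot ∅ φ) {e : T.Edge} :
    e ∈ Set.range (minorEdge T' T T.upperLeaf φ) ↔ T.leavesAbove e ⊆ T.cutSet := by
  rw [hm.mem_range_iff, ← h.path_bot_iff]
  refine ⟨fun h' => h'.2.1, fun he => ⟨fun u hu => hu.elim, he, ?_⟩⟩
  obtain ⟨x, hx⟩ := exists_path_leaf e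
  obtain ⟨b, hb⟩ := h.upperLeaf_cover x (hx.trans he)
  have hxb : Sum.inr x = T.upperLeaf b := path_inr hb
  exact ⟨b, hxb ▸ hx⟩

end

end RTree

open RTree

/-! ### Degrafting of labelled weighted trees -/

namespace WTree

section

variable {Q : SymSeq.{u}} {A B : Type} {a : A}

/-- The bijections of incoming edges are chosen once for the tree, not for each cell. Therefore the
labels of the piece depend continuously on those of `T`. -/
theorem exists_labels {S S' : Type} {T : RTree S} {T' : RTree S'} {lam : S' → T.Edge}
    {bot : T.Edge} {φ : T'.V → T.V} (h : IsMinor T' T lam bot ∅ φ)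
    (hcov : ∀ x, T.Path (Sum.inr x) bot → ∃ s, T.Path (Sum.inr x) (lam s)) (Q : SymSeq.{u}) :
    ∃ lab : (∀ v : T.V, Q.obj (T.In v)) → ∀ v : T'.V, Q.obj (T'.In v), Continuous lab ∧
      ∀ (c : Cell Q T) (w' : {w : T'.Edge → ℝ // T'.IsWeighting w}) (v : T'.V),
        LabelsAgree (Q := Q) ⟨T', (lab c.1, w')⟩ ⟨T, c⟩ (minorEdge T' T lam φ) v (φ v) := by
  choose σ hσ using h.exists_incoming hcov
  refine ⟨fun l v => Q.map (σ v).symm (l (φ v)), ?_, fun c w' v => ⟨σ v, hσ v, ?_⟩⟩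
  · exact continuous_pi fun v => (Q.map (σ v).symm).continuous_toFun.comp (continuous_apply _)
  · exact ((map_symm_eq_iff (σ v)).1 rfl).symm

/-- The trees `pA` and `pB` are obtained from `p` by degrafting. -/
structure IsSplit (pA : WTree Q A) (pB : WTree Q B) (p : WTree Q (Graft A a B))
    (top bot : p.1.Edge) (φA : pA.1.V → p.1.V) (φB : pB.1.V → p.1.V) : Prop where
  cut : p.1.IsCut p.1.cutSet top bot
  live : p.base bot < p.depth top
  lower : IsPiece pA p (p.1.lowerLeaf top) p.1.root φA (p.1.lowerDepth p.wt p.1.cutSet top bot)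
  upper : IsPiece pB p p.1.upperLeaf bot φB (p.1.upperDepth p.wt bot)

theorem base_lt_one {p : WTree Q A} {top bot : p.1.Edge} (h : p.base bot < p.depth top) :
    p.base bot < 1 := h.trans_le (p.isWeighting.depth_le_one top)

/-- Only the path to the new leaf `a` needs the scaling. All other leaves are leaves of `p` off the
branch and keep depth `1`. -/
theorem exists_lower_weighting {p : WTree Q (Graft A a B)} {top bot : p.1.Edge}
    (hc : p.1.IsCut p.1.cutSet top bot) (hl : p.base bot < p.depth top) {T' : RTree A}
    {φ : T'.V → p.1.V} (h : IsMinor T' p.1 (p.1.lowerLeaf top) p.1.root ∅ φ) :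
    ∃ w' : {w : T'.Edge → ℝ // T'.IsWeighting w}, ∀ e, T'.depth w'.1 e =
      p.1.lowerDepth p.wt p.1.cutSet top bot (minorEdge T' p.1 (p.1.lowerLeaf top) φ e) := by
  classical
  set k := minorEdge T' p.1 (p.1.lowerLeaf top) φ with hk
  let w' : T'.Edge → ℝ := fun e => if p.1.leavesAbove (k e) = p.1.cutSet then
        (1 - p.base bot) / (p.depth top - p.base bot) * p.wt (k e) else p.wt (k e)
  have hd : ∀ e, p.1.lowerDepth p.wt p.1.cutSet top bot (k e) = T'.depth w' e := by
    refine depth_unique (f := fun e => p.1.lowerDepth p.wt p.1.cutSet top bot (k e)) fun e => ?_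
    rw [hc.lowerDepth_eq ((hc.mem_range_lower_iff h).1 ⟨e, rfl⟩)]
    congr 1
    cases hp : T'.parent e with
    | none => rw [h.parent_none_piece.1 hp, parent_root]; rfl
    | some u => rw [h.parent_some_piece hp]; rfl
  have h1 := base_lt_one hl
  refine ⟨⟨w', isWeighting_iff.2 ⟨fun e => ?_, fun x => ?_⟩⟩, fun e => (hd e).symm⟩
  · change 0 ≤ ite _ _ _
    have h2 := p.wt_nonneg (k e)
    split_ifs
    · exact mul_nonneg (div_nonneg (by linarith) (by linarith)) h2
    · exact h2
  · rw [← hd]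
    change p.1.lowerDepth p.wt p.1.cutSet top bot (p.1.lowerLeaf top (T'.label x)) = 1
    by_cases hx : T'.label x = a
    -- The factor `(1 - base bot) / (depth top - base bot)` is the one that moves the top of the
    -- branch to depth `1`.
    · rw [hx, lowerLeaf_self, lowerDepth_of_mid hc.leaves_top,
        div_mul_cancel₀ _ (sub_ne_zero.2 hl.ne')]
      ring
    · rw [lowerLeaf_of_ne hx, lowerDepth_of_ne]
      · exact p.depth_inr _
      · rw [leaf, leavesAbove_inr]
        intro heq
        exact label_symm_inl_notMem (T := p.1) ⟨_, hx⟩ (heq ▸ Set.mem_singleton _)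

theorem exists_upper_weighting {p : WTree Q (Graft A a B)} {top bot : p.1.Edge}
    (hl : p.base bot < p.depth top) {T' : RTree B}
    {φ : T'.V → p.1.V} (h : IsMinor T' p.1 p.1.upperLeaf bot ∅ φ) :
    ∃ w' : {w : T'.Edge → ℝ // T'.IsWeighting w}, ∀ e, T'.depth w'.1 e =
      p.1.upperDepth p.wt bot (minorEdge T' p.1 p.1.upperLeaf φ e) := by
  classical
  set k := minorEdge T' p.1 p.1.upperLeaf φ with hk
  let w' : T'.Edge → ℝ := fun e => 1 / (1 - p.base bot) * p.wt (k e)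
  have hd : ∀ e, p.1.upperDepth p.wt bot (k e) = T'.depth w' e := by
    refine depth_unique (f := fun e => p.1.upperDepth p.wt bot (k e)) fun e => ?_
    rw [upperDepth_eq (h.path_bot e)]
    congr 1
    cases hp : T'.parent e with
    | none => rw [if_pos (h.parent_none_piece.1 hp)]; rfl
    | some u =>
      rw [h.parent_some_piece hp, if_neg]
      · rfl
      · intro hb
        rw [h.parent_none_piece.2 hb] at hp
        cases hp
  have h1 := base_lt_one hl
  refine ⟨⟨w', isWeighting_iff.2 ⟨fun e => ?_, fun x => ?_⟩⟩, fun e => (hd e).symm⟩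
  · exact mul_nonneg (div_nonneg zero_le_one (by linarith)) (p.wt_nonneg _)
  · rw [← hd]
    change (p.depth (Sum.inr _) - p.base bot) / (1 - p.base bot) = 1
    rw [depth_inr, div_self (by linarith)]

theorem IsSplit.wt_lower {pA : WTree Q A} {pB : WTree Q B} {p : WTree Q (Graft A a B)}
    {top bot : p.1.Edge} {φA : pA.1.V → p.1.V} {φB : pB.1.V → p.1.V}
    (h : IsSplit pA pB p top bot φA φB) (e : pA.1.Edge)
    [Decidable (p.1.leavesAbove (minorEdge pA.1 p.1 (p.1.lowerLeaf top) φA e) = p.1.cutSet)] :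
    pA.wt e = if p.1.leavesAbove (minorEdge pA.1 p.1 (p.1.lowerLeaf top) φA e) = p.1.cutSet
      then (1 - p.base bot) / (p.depth top - p.base bot) *
        p.wt (minorEdge pA.1 p.1 (p.1.lowerLeaf top) φA e)
      else p.wt (minorEdge pA.1 p.1 (p.1.lowerLeaf top) φA e) := by
  classical
  have h1 := h.cut.lowerDepth_eq (w := p.wt) ((h.cut.mem_range_lower_iff h.lower.minor).1 ⟨e, rfl⟩)
  rw [← h.lower.depth, depth, depth_eq, base_eq] at h1
  have h2 : (pA.1.parent e).elim 0 (fun v => pA.1.depth pA.wt (Sum.inl v)) =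
      (p.1.parent (minorEdge pA.1 p.1 (p.1.lowerLeaf top) φA e)).elim 0
        (fun v => p.1.lowerDepth p.wt p.1.cutSet top bot (Sum.inl v)) := by
    cases hp : pA.1.parent e with
    | none => rw [h.lower.minor.parent_none_piece.1 hp, parent_root]; rfl
    | some u =>
      rw [h.lower.minor.parent_some_piece hp]
      exact h.lower.depth _
  rw [h2] at h1
  convert add_right_cancel h1

theorem IsSplit.wt_upper {pA : WTree Q A} {pB : WTree Q B} {p : WTree Q (Graft A a B)}
    {top bot : p.1.Edge} {φA : pA.1.V → p.1.V} {φB : pB.1.V → p.1.V}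
    (h : IsSplit pA pB p top bot φA φB) (e : pB.1.Edge) :
    pB.wt e = 1 / (1 - p.base bot) * p.wt (minorEdge pB.1 p.1 p.1.upperLeaf φB e) := by
  classical
  have h1 := upperDepth_eq (w := p.wt) (h.upper.minor.path_bot e)
  rw [← h.upper.depth, depth, depth_eq, base_eq] at h1
  have h2 : (pB.1.parent e).elim 0 (fun v => pB.1.depth pB.wt (Sum.inl v)) =
      if minorEdge pB.1 p.1 p.1.upperLeaf φB e = bot then 0 else
      (p.1.parent (minorEdge pB.1 p.1 p.1.upperLeaf φB e)).elim 0
        (fun v => p.1.upperDepth p.wt bot (Sum.inl v)) := by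
    cases hp : pB.1.parent e with
    | none => rw [if_pos (h.upper.minor.parent_none_piece.1 hp)]; rfl
    | some u =>
      rw [h.upper.minor.parent_some_piece hp, if_neg]
      · exact h.upper.depth _
      · intro hb
        rw [h.upper.minor.parent_none_piece.2 hb] at hp
        cases hp
  rw [h2] at h1
  exact add_right_cancel h1

/-- Some edge of the branch at which the tree is to be degrafted has non-zero weight. -/
def IsLive (p : WTree Q (Graft A a B)) : Prop :=
  ∃ e, p.1.leavesAbove e = p.1.cutSet ∧ p.wt e ≠ 0

theorem IsSplit.isLive {pA : WTree Q A} {pB : WTree Q B} {p : WTree Q (Graft A a B)}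
    {top bot : p.1.Edge} {φA : pA.1.V → p.1.V} {φB : pB.1.V → p.1.V}
    (h : IsSplit pA pB p top bot φA φB) : p.IsLive :=
  (h.cut.base_lt_depth_iff p.wt_nonneg).1 h.live

theorem IsLive.exists_isSplit [Finite A] [Finite B] {p : WTree Q (Graft A a B)} (h : p.IsLive) :
    ∃ (pA : WTree Q A) (pB : WTree Q B) (top bot : p.1.Edge) (φA : pA.1.V → p.1.V)
      (φB : pB.1.V → p.1.V), IsSplit pA pB p top bot φA φB := by
  obtain ⟨top, bot, hc⟩ := exists_isCut (h.imp fun _ h => h.1)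
  have hl := (hc.base_lt_depth_iff p.wt_nonneg).2 h
  obtain ⟨TA, φA, hA⟩ := hc.exists_lower
  obtain ⟨TB, φB, hB⟩ := hc.exists_upper
  obtain ⟨labA, -, hlA⟩ := exists_labels hA (fun x _ => hc.lowerLeaf_cover x) Q
  obtain ⟨labB, -, hlB⟩ := exists_labels hB hc.upperLeaf_cover Q
  obtain ⟨wA, hwA⟩ := exists_lower_weighting hc hl hA
  obtain ⟨wB, hwB⟩ := exists_upper_weighting hl hB
  exact ⟨⟨TA, (labA p.2.1, wA)⟩, ⟨TB, (labB p.2.1, wB)⟩, top, bot, φA, φB, hc, hl,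
    ⟨hA, hlA p.2 wA, hwA⟩, ⟨hB, hlB p.2 wB, hwB⟩⟩

/-- `IsSplit` speaks of depths, which behave well under composition and removal of vertices. This
translates it into the description by scaled weights in the statement. -/
theorem IsSplit.isDegrafting {pA : WTree Q A} {pB : WTree Q B} {p : WTree Q (Graft A a B)}
    {top bot : p.1.Edge} {φA : pA.1.V → p.1.V} {φB : pB.1.V → p.1.V}
    (h : IsSplit pA pB p top bot φA φB) : IsDegrafting pA pB p top bot φA φB := by
  have hA : lowerEdge pA p top φA = minorEdge pA.1 p.1 (p.1.lowerLeaf top) φA := rfl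
  have hB : upperEdge pB p φB = minorEdge pB.1 p.1 p.1.upperLeaf φB := by
    funext e
    rcases e with e | e <;> rfl
  refine
    { leaves_top := h.cut.leaves_top
      leaves_bot := h.cut.leaves_bot
      branch := h.cut.branch
      injective_lower := h.lower.minor.injective_vertex
      injective_upper := h.upper.minor.injective_vertex
      range_lower := ?_
      range_upper := ?_
      parent_lower := fun e => ?_
      parent_upper := fun e => ?_
      labels_lower := h.lower.labels
      labels_upper := fun v => hB ▸ h.upper.labels v
      weight_lower := ⟨_, fun e => h.wt_lower e⟩
      weight_upper := ⟨_, fun e => hB ▸ h.wt_upper e⟩ }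
  · ext v
    rw [h.lower.minor.mem_range_vertex_iff, h.cut.mem_range_lower_iff h.lower.minor]
    change _ ↔ ¬ p.1.leavesAbove (Sum.inl v) ⊆ p.1.cutSet ∨
      (p.1.leavesAbove (Sum.inl v) = p.1.cutSet ∧ Sum.inl v ≠ top)
    have htop : (∀ s, p.1.lowerLeaf top s ≠ Sum.inl v) ↔ Sum.inl v ≠ top := by
      constructor
      · intro h' heq
        exact h' a (lowerLeaf_self.trans heq.symm)
      · intro h' s hs
        by_cases hsa : s = a
        · rw [hsa, lowerLeaf_self] at hs
          exact h' hs.symm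
        · rw [lowerLeaf_of_ne hsa] at hs
          cases hs
    rw [htop]
    constructor
    · rintro ⟨h1, h2⟩
      by_cases hs : p.1.leavesAbove (Sum.inl v) ⊆ p.1.cutSet
      · exact Or.inr ⟨h1 hs, h2⟩
      · exact Or.inl hs
    · rintro (h1 | ⟨h1, h2⟩)
      · exact ⟨fun hs => absurd hs h1, fun heq => h1 (heq ▸ h.cut.leaves_top.subset)⟩
      · exact ⟨fun _ => h1, h2⟩
  · ext v
    rw [h.upper.minor.mem_range_vertex_iff, h.cut.mem_range_upper_iff h.upper.minor]
    constructor
    · exact fun h' => h'.1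
    · exact fun h' => ⟨h', fun s hs => by cases hs⟩
  · rw [hA]
    cases hp : pA.1.parent e with
    | none => rw [h.lower.minor.parent_none_piece.1 hp, parent_root]; rfl
    | some u => rw [h.lower.minor.parent_some_piece hp]; rfl
  · rw [hB]
    cases hp : pB.1.parent e with
    | none => rw [if_pos (h.upper.minor.parent_none_piece.1 hp)]; rfl
    | some u =>
      rw [h.upper.minor.parent_some_piece hp, if_neg]
      · rfl
      · intro hb
        rw [h.upper.minor.parent_none_piece.2 hb] at hp
        cases hp

end

section

variable {Q : AugmentedOperad.{u}} {A B : Type} {a : A}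

theorem IsSplit.mk_eq {p : WTree Q.toSymSeq (Graft A a B)} {pA pA' : WTree Q.toSymSeq A}
    {pB pB' : WTree Q.toSymSeq B} {top bot top' bot' : p.1.Edge} {φA : pA.1.V → p.1.V}
    {φB : pB.1.V → p.1.V} {φA' : pA'.1.V → p.1.V} {φB' : pB'.1.V → p.1.V}
    (h : IsSplit pA pB p top bot φA φB) (h' : IsSplit pA' pB' p top' bot' φA' φB') :
    BarObj.mk pA = BarObj.mk pA' ∧ BarObj.mk pB = BarObj.mk pB' := by
  obtain ⟨rfl, rfl⟩ := h.cut.unique h'.cut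
  exact ⟨h.lower.mk_eq h'.lower rfl rfl fun _ _ => rfl,
    h.upper.mk_eq h'.upper rfl rfl fun _ _ => rfl⟩

open Classical in
/-- The decomposition of a labelled weighted tree. -/
def decomp [Finite A] [Finite B] (p : WTree Q.toSymSeq (Graft A a B)) :
    Smash (BarObj Q A) (BarObj Q B) :=
  if h : p.IsLive then
    Smash.mk (BarObj.mk h.exists_isSplit.choose) (BarObj.mk h.exists_isSplit.choose_spec.choose)
  else Based.pt

theorem decomp_of_not_isLive [Finite A] [Finite B] {p : WTree Q.toSymSeq (Graft A a B)}
    (h : ¬ p.IsLive) : p.decomp = Based.pt := dif_neg h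

theorem IsSplit.decomp_eq [Finite A] [Finite B] {p : WTree Q.toSymSeq (Graft A a B)}
    {pA : WTree Q.toSymSeq A} {pB : WTree Q.toSymSeq B} {top bot : p.1.Edge} {φA : pA.1.V → p.1.V}
    {φB : pB.1.V → p.1.V} (h : IsSplit pA pB p top bot φA φB) :
    p.decomp = Smash.mk (BarObj.mk pA) (BarObj.mk pB) := by
  have hl := h.isLive
  rw [decomp, dif_pos hl]
  obtain ⟨top', bot', φA', φB', h'⟩ := hl.exists_isSplit.choose_spec.choose_spec
  obtain ⟨h1, h2⟩ := h'.mk_eq h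
  rw [h1, h2]

end

end WTree
end OpBar
end

noncomputable section
namespace OpBar

/-! ### Unstable vertices and branches -/

namespace RTree

variable {S S' : Type} {T : RTree S} {T' : RTree S}

theorem isMinor_of_parent {R : Set T.V} {φ : T'.V → T.V} (hinj : Function.Injective φ)
    (havoid : ∀ u, φ u ∉ R)
    (hp : ∀ e, T.parent (T.col R (minorEdge T' T T.leaf φ e)) = (T'.parent e).map φ) :
    IsMinor T' T T.leaf T.root R φ := by
  refine ⟨?_, ?_, fun e => ?_, fun e u hu => ?_⟩
  · rintro (u | x) (u' | x') h
    · exact congrArg Sum.inl (hinj (Sum.inl_injective h))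
    · cases h
    · cases h
    · have := T.label.symm.injective (Sum.inr_injective h)
      exact congrArg Sum.inr (T'.label.injective this)
  · rintro (u' | x) u hu heq
    · exact havoid u' (Sum.inl_injective heq ▸ hu)
    · cases heq
  · have := hp e
    constructor
    · intro he
      rw [he] at this
      exact Or.inr (eq_root_iff.2 this)
    · rintro (he | he)
      · have he' : T.col R (minorEdge T' T T.leaf φ e) = T.root := by
          rw [he]
          refine col_of_forall fun u _ hu => ?_
          rw [parent_root] at hu
          cases hu
        rw [he', parent_root] at this
        exact Option.map_eq_none_iff.1 this.symm
      · rw [he, parent_root] at this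
        exact Option.map_eq_none_iff.1 this.symm
  · rw [hp, hu]
    rfl

theorem leavesAbove_eq_of_unstable {v : T.V} (h : T.Unstable v) {c : T.Edge}
    (hc : T.parent c = some v) : T.leavesAbove c = T.leavesAbove (Sum.inl v) := by
  refine Set.Subset.antisymm (leavesAbove_mono (Path.of_parent hc)) fun x hx => ?_
  obtain ⟨v', c', hv, hc', hp⟩ := path_tail hx Sum.inr_ne_inl
  cases hv
  obtain ⟨hs, -⟩ := Nat.card_eq_one_iff_unique.1 h
  obtain rfl : c' = c := congrArg Subtype.val (hs.elim ⟨c', hc'⟩ ⟨c, hc⟩)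
  exact hp

/-- Distinct incoming edges of a vertex have disjoint sets of leaves above them. If one incoming
edge already has all the leaves, there is no other. -/
theorem unstable_of_leavesAbove_eq {v : T.V} {c : T.Edge} (hc : T.parent c = some v)
    (h : T.leavesAbove c = T.leavesAbove (Sum.inl v)) : T.Unstable v := by
  refine Nat.card_eq_one_iff_unique.2 ⟨⟨?_⟩, ⟨⟨c, hc⟩⟩⟩
  have key : ∀ e : T.In v, e.1 = c := by
    rintro ⟨e, he⟩
    obtain ⟨x, hx⟩ := exists_path_leaf e
    have hx' : x ∈ T.leavesAbove c := h ▸ hx.trans (Path.of_parent he)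
    rcases path_or_path_of_mem hx hx' with hp | hp
    · exact eq_of_path_of_parent_eq he hc hp
    · exact (eq_of_path_of_parent_eq hc he hp).symm
  intro e e'
  exact Subtype.ext ((key e).trans (key e').symm)

end RTree

open RTree

namespace WTree

/-! ## Degrafting and removal of vertices -/

section

variable {Q : SymSeq.{u}} {A B : Type} {a : A} {p p' : WTree Q (Graft A a B)} {R : Set p.1.V}
  {φ : p'.1.V → p.1.V}

local notation "κ" => minorEdge (Sigma.fst p') (Sigma.fst p) (leaf (Sigma.fst p)) φ

theorem IsMinor.cut_iff (h : IsMinor p'.1 p.1 p.1.leaf p.1.root R φ) (e : p'.1.Edge) :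
    p'.1.leavesAbove e = p'.1.cutSet ↔ p.1.leavesAbove (κ e) = p.1.cutSet := by
  refine h.leavesAbove_iff (fun x _ => ⟨p.1.label x, ?_⟩) (fun x _ => path_root _)
    (fun x x' hx => ?_) e
  · rw [leaf_label]
    exact RTree.Path.refl _
  · rw [mem_cutSet, mem_cutSet, Sum.inr_injective (path_inr hx), Equiv.apply_symm_apply]

theorem IsMinor.eq_root_iff (h : IsMinor p'.1 p.1 p.1.leaf p.1.root R φ) (e : p'.1.Edge) :
    e = p'.1.root ↔ κ e = p.1.root ∨ p.1.col R (κ e) = p.1.root := by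
  rw [RTree.eq_root_iff, h.parent_none]

theorem IsMinor.lowerLeaf_comp {top : p.1.Edge} {top' : p'.1.Edge} (h : κ top' = top) :
    κ ∘ p'.1.lowerLeaf top' = p.1.lowerLeaf top := by
  funext s
  by_cases hs : s = a
  · rw [Function.comp_apply, hs, lowerLeaf_self, lowerLeaf_self, h]
  · rw [Function.comp_apply, lowerLeaf_of_ne hs, lowerLeaf_of_ne hs, minorEdge_leaf]

theorem IsMinor.upperLeaf_comp : κ ∘ p'.1.upperLeaf = p.1.upperLeaf := by
  funext s
  exact minorEdge_leaf _ _ _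

theorem IsMinor.lowerDepth_eq (h : IsMinor p'.1 p.1 p.1.leaf p.1.root R φ)
    (hd : ∀ e, p'.depth e = p.depth (κ e)) {top bot : p.1.Edge} {top' bot' : p'.1.Edge}
    (htop : κ top' = top) (hbot : p'.base bot' = p.base bot) (e : p'.1.Edge) :
    p'.1.lowerDepth p'.wt p'.1.cutSet top' bot' e =
      p.1.lowerDepth p.wt p.1.cutSet top bot (κ e) := by
  have hdt : p'.1.depth p'.wt top' = p.1.depth p.wt top := htop ▸ hd top'
  have hde : p'.1.depth p'.wt e = p.1.depth p.wt (κ e) := hd e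
  have hb : p'.1.base p'.wt bot' = p.1.base p.wt bot := hbot
  by_cases hm : p'.1.leavesAbove e = p'.1.cutSet
  · rw [lowerDepth_of_mid hm, lowerDepth_of_mid ((IsMinor.cut_iff h e).1 hm), hde, hdt, hb]
  · rw [lowerDepth_of_ne hm, lowerDepth_of_ne (mt (IsMinor.cut_iff h e).2 hm), hde]

theorem IsMinor.upperDepth_eq (hd : ∀ e, p'.depth e = p.depth (κ e)) {bot : p.1.Edge}
    {bot' : p'.1.Edge} (hbot : p'.base bot' = p.base bot) (e : p'.1.Edge) :
    p'.1.upperDepth p'.wt bot' e = p.1.upperDepth p.wt bot (κ e) := by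
  have hde : p'.1.depth p'.wt e = p.1.depth p.wt (κ e) := hd e
  have hb : p'.1.base p'.wt bot' = p.1.base p.wt bot := hbot
  rw [upperDepth, upperDepth, hde, hb]

theorem IsRemoval.depth_eq' {v : p.1.V} (h : IsRemoval p' p v φ) (e : p'.1.Edge) :
    p'.depth e = p.depth (κ e) := by
  rw [h.depth_eq, edgeMap_eq_minorEdge]

theorem IsRemoval.base_eq {v : p.1.V} (h : IsRemoval p' p v φ) (e : p'.1.Edge) :
    p'.base e = p.base (p.1.collapse v (κ e)) := by
  refine base_eq_base ?_ fun u => h.depth_eq' _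
  rw [← edgeMap_eq_minorEdge]
  exact h.parent e

theorem IsRemoval.mem_range {v : p.1.V} (h : IsRemoval p' p v φ) {e : p.1.Edge}
    (he : e ≠ Sum.inl v) : ∃ e', κ e' = e := by
  refine h.isMinor.mem_range_iff.2 ⟨fun u hu => ?_, path_root _, ?_⟩
  · rw [Set.mem_singleton_iff.1 hu]
    exact he
  · obtain ⟨x, hx⟩ := exists_path_leaf e
    exact ⟨p.1.label x, leaf_label (T := p.1) x ▸ hx⟩

/-- If the removed edge carries weight, then `v` is unstable and the weight passes to the edge above
`v`, which lies on the same branch. -/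
theorem IsRemoval.isLive_iff {v : p.1.V} (h : IsRemoval p' p v φ)
    (hv : p.wt (Sum.inl v) = 0 ∨ p.1.Unstable v) : p.IsLive ↔ p'.IsLive := by
  classical
  have hw : ∀ e, p'.wt e = p.wt (κ e) +
      if p.1.parent (κ e) = some v then p.wt (Sum.inl v) else 0 := by
    rw [← edgeMap_eq_minorEdge]
    intro e
    convert h.weight e
  constructor
  · rintro ⟨e, he, hne⟩
    by_cases hev : e = Sum.inl v
    · have hu : p.1.Unstable v := hv.resolve_left fun h0 => hne (hev ▸ h0)
      obtain ⟨c, hc⟩ := p.1.arity_pos v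
      obtain ⟨e', he'⟩ := h.mem_range (e := c) fun hcv => by
        rw [hcv] at hc
        exact not_path_of_parent hc (RTree.Path.refl _)
      refine ⟨e', ?_, ?_⟩
      · rw [IsMinor.cut_iff h.isMinor, he', leavesAbove_eq_of_unstable hu hc, ← hev, he]
      · rw [hw, he', if_pos hc, ← hev]
        have h1 := p.wt_nonneg c
        have h2 := (p.wt_nonneg e).lt_of_ne hne.symm
        linarith
    · obtain ⟨e', rfl⟩ := h.mem_range hev
      refine ⟨e', (IsMinor.cut_iff h.isMinor e').2 he, ?_⟩
      rw [hw]
      have h1 : 0 ≤ if p.1.parent (κ e') = some v then p.wt (Sum.inl v) else 0 := by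
        split_ifs
        · exact p.wt_nonneg _
        · exact le_rfl
      have h2 := (p.wt_nonneg (κ e')).lt_of_ne hne.symm
      linarith
  · rintro ⟨e', he', hne⟩
    rw [IsMinor.cut_iff h.isMinor] at he'
    by_cases h0 : p.wt (κ e') = 0
    · rw [hw, h0, zero_add] at hne
      split_ifs at hne with hp
      · refine ⟨Sum.inl v, ?_, hne⟩
        rw [← leavesAbove_eq_of_unstable (hv.resolve_left hne) hp, he']
      · exact absurd rfl hne
    · exact ⟨κ e', he', h0⟩

/-- A branch of non-zero weight whose bottom edge has weight `0` has a further edge above it, so the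
vertex on top of `bot` lies inside the branch. -/
theorem IsRemoval.unstable_of_eq_bot {v : p.1.V} {top bot : p.1.Edge}
    (hv : p.wt (Sum.inl v) = 0 ∨ p.1.Unstable v) (hl : p.IsLive)
    (hc : p.1.IsCut p.1.cutSet top bot) (hb : Sum.inl v = bot) : p.1.Unstable v := by
  refine hv.elim (fun h0 => ?_) id
  obtain ⟨e, he, hne⟩ := hl
  have hp := (hc.branch e he).2
  rw [← hb] at hp
  obtain ⟨v', c, hvv, hcv, hp'⟩ := path_tail hp fun h => hne (h ▸ h0)
  cases hvv
  have h1 : p.1.leavesAbove (Sum.inl v) = p.1.cutSet := hb ▸ hc.leaves_bot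
  exact unstable_of_leavesAbove_eq hcv
    ((leavesAbove_eq_of_path he h1 hp' (Path.of_parent hcv)).trans h1.symm)

variable {top bot : p.1.Edge} {top' bot' : p'.1.Edge}

/-- The bottom edge of the branch survives unless it is the outgoing edge of `v`. In that case `v`
is unstable and its incoming edge becomes the new bottom, which is the alternative with `col`. -/
theorem IsRemoval.eq_bot_iff {v : p.1.V} (h : IsRemoval p' p v φ)
    (hv : p.wt (Sum.inl v) = 0 ∨ p.1.Unstable v) (hl : p.IsLive)
    (hc : p.1.IsCut p.1.cutSet top bot) (hc' : p'.1.IsCut p'.1.cutSet top' bot') (e : p'.1.Edge) :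
    e = bot' ↔ κ e = bot ∨ p.1.col {v} (κ e) = bot := by
  have hu := IsRemoval.unstable_of_eq_bot hv hl hc
  have hm := h.isMinor
  have hκv : ∀ e, κ e ≠ Sum.inl v := fun e => hm.avoid e v rfl
  have hb' : p.1.leavesAbove (κ bot') = p.1.cutSet := (IsMinor.cut_iff hm _).1 hc'.leaves_bot
  have hlow : ∀ e, p.1.leavesAbove (κ e) = p.1.cutSet → p.1.Path (κ e) (κ bot') := fun e he =>
    hm.path_map (hc'.branch e ((IsMinor.cut_iff hm e).2 he)).2
  constructor
  · rintro rfl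
    by_cases hvb : Sum.inl v = bot
    · right
      obtain ⟨c, hcv⟩ := p.1.arity_pos v
      have hcm : p.1.leavesAbove c = p.1.cutSet := by
        rw [leavesAbove_eq_of_unstable (hu hvb) hcv, hvb, hc.leaves_bot]
      obtain ⟨e'', rfl⟩ := h.mem_range (e := c) fun hcv' => by
        rw [hcv'] at hcv
        exact not_path_of_parent hcv (RTree.Path.refl _)
      have h1 := hlow e'' hcm
      have h2 := (hc.branch _ hb').2
      have h3 : κ e'' = κ e := by
        by_contra hne
        exact hκv e ((path_parent hcv h1 hne).antisymm (hvb ▸ h2)).symm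
      rw [← h3, col_of_mem hcv (Set.mem_singleton v), hvb]
    · left
      obtain ⟨e'', he''⟩ := h.mem_range (Ne.symm hvb)
      have h1 := hlow e'' (he'' ▸ hc.leaves_bot)
      rw [he''] at h1
      exact (hc.branch _ hb').2.antisymm h1
  · have main : p.1.leavesAbove (κ e) = p.1.cutSet → (κ e = bot ∨ p.1.col {v} (κ e) = bot) →
        e = bot' := by
      intro he hor
      refine hm.inj ?_
      have h1 := hlow e he
      have h2 := (hc.branch _ hb').2
      rcases p.1.col_cases {v} (κ e) with hcol | ⟨w, hw, hpw, hcol⟩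
      · rw [hcol, or_self_iff] at hor
        rw [← hor] at h2
        exact h1.antisymm h2
      · rcases hor with hor | hor
        · rw [← hor] at h2
          exact h1.antisymm h2
        · rw [hcol] at hor
          rw [Set.mem_singleton_iff.1 hw] at hpw hor
          by_contra hne
          rw [← hor] at h2
          exact hκv bot' ((path_parent hpw h1 hne).antisymm h2).symm
    rintro (he | he)
    · exact main (he ▸ hc.leaves_bot) (Or.inl he)
    · refine main ?_ (Or.inr he)
      rcases p.1.col_cases {v} (κ e) with hcol | ⟨w, hw, hpw, hcol⟩
      · rw [← hcol, he, hc.leaves_bot]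
      · rw [hcol] at he
        rw [Set.mem_singleton_iff.1 hw] at hpw he
        rw [leavesAbove_eq_of_unstable (hu he) hpw, he, hc.leaves_bot]

/-- If `bot` itself enters `v`, then `v` is not unstable, since the branch would otherwise continue
below `bot`. Hence the removed edge has weight `0` and nothing moves. -/
theorem IsRemoval.base_bot_eq {v : p.1.V} (h : IsRemoval p' p v φ)
    (hv : p.wt (Sum.inl v) = 0 ∨ p.1.Unstable v) (hl : p.IsLive)
    (hc : p.1.IsCut p.1.cutSet top bot) (hc' : p'.1.IsCut p'.1.cutSet top' bot') :
    p'.base bot' = p.base bot := by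
  rw [h.base_eq, ← col_singleton]
  rcases (h.eq_bot_iff hv hl hc hc' bot').1 rfl with hb | hb
  · rw [hb]
    by_cases hp : p.1.parent bot = some v
    · have h0 : p.wt (Sum.inl v) = 0 := by
        refine hv.resolve_right fun hu => not_path_of_parent hp (hc.branch _ ?_).2
        rw [← leavesAbove_eq_of_unstable hu hp, hc.leaves_bot]
      rw [col_of_mem hp (Set.mem_singleton v), base, base, base_of_parent hp, RTree.depth_eq, h0, zero_add]
    · rw [col_of_forall]
      intro u hu
      rw [Set.mem_singleton_iff.1 hu]
      exact hp
  · rw [hb]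

theorem IsRemoval.map_top {v : p.1.V} (h : IsRemoval p' p v φ)
    (hc : p.1.IsCut p.1.cutSet top bot) (hc' : p'.1.IsCut p'.1.cutSet top' bot')
    (hv : Sum.inl v ≠ top) : κ top' = top := by
  have hm := h.isMinor
  obtain ⟨e, he⟩ := h.mem_range hv.symm
  have h1 := hm.path_map (hc'.branch e ((IsMinor.cut_iff hm e).2 (he ▸ hc.leaves_top))).1
  rw [he] at h1
  exact h1.antisymm (hc.branch _ ((IsMinor.cut_iff hm top').1 hc'.leaves_top)).1

/-- The branch continues above an unstable vertex. -/
theorem IsRemoval.top_ne {v : p.1.V} (hc : p.1.IsCut p.1.cutSet top bot) (hv : p.1.Unstable v) :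
    Sum.inl v ≠ top := by
  rintro rfl
  obtain ⟨c, hcv⟩ := p.1.arity_pos v
  exact not_path_of_parent hcv
    (hc.branch c ((leavesAbove_eq_of_unstable hv hcv).trans hc.leaves_top)).1

variable {pA : WTree Q A} {pB : WTree Q B} {φA : pA.1.V → p.1.V} {φB : pB.1.V → p.1.V}
  {pA' : WTree Q A} {pB' : WTree Q B} {φA' : pA'.1.V → p'.1.V} {φB' : pB'.1.V → p'.1.V}

theorem IsSplit.lower_isMinor (hs' : IsSplit pA' pB' p' top' bot' φA' φB')
    (h : IsMinor p'.1 p.1 p.1.leaf p.1.root R φ) (htop : κ top' = top) :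
    IsMinor pA'.1 p.1 (p.1.lowerLeaf top) p.1.root R (φ ∘ φA') :=
  IsMinor.lowerLeaf_comp htop ▸ hs'.lower.minor.comp h (IsMinor.eq_root_iff h)

theorem IsSplit.upper_isMinor (hs' : IsSplit pA' pB' p' top' bot' φA' φB')
    (h : IsMinor p'.1 p.1 p.1.leaf p.1.root R φ)
    (hbot : ∀ e, e = bot' ↔ κ e = bot ∨ p.1.col R (κ e) = bot) :
    IsMinor pB'.1 p.1 p.1.upperLeaf bot R (φ ∘ φB') :=
  IsMinor.upperLeaf_comp (p := p) (p' := p') (φ := φ) ▸ hs'.upper.minor.comp h hbot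

theorem minorEdge_comp_lower (htop : κ top' = top) (e : pA'.1.Edge) :
    minorEdge pA'.1 p.1 (p.1.lowerLeaf top) (φ ∘ φA') e =
      κ (minorEdge pA'.1 p'.1 (p'.1.lowerLeaf top') φA' e) := by
  rw [← IsMinor.lowerLeaf_comp htop]
  rcases e with e | e <;> rfl

theorem minorEdge_comp_upper (e : pB'.1.Edge) :
    minorEdge pB'.1 p.1 p.1.upperLeaf (φ ∘ φB') e =
      κ (minorEdge pB'.1 p'.1 p'.1.upperLeaf φB' e) := by
  rw [← IsMinor.upperLeaf_comp (p := p) (p' := p') (φ := φ)]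
  rcases e with e | e <;> rfl

theorem IsSplit.lower_depth_eq (hs' : IsSplit pA' pB' p' top' bot' φA' φB')
    (h : IsMinor p'.1 p.1 p.1.leaf p.1.root R φ) (hd : ∀ e, p'.depth e = p.depth (κ e))
    (htop : κ top' = top) (hbot : p'.base bot' = p.base bot) (e : pA'.1.Edge) :
    pA'.depth e = p.1.lowerDepth p.wt p.1.cutSet top bot
      (minorEdge pA'.1 p.1 (p.1.lowerLeaf top) (φ ∘ φA') e) := by
  rw [minorEdge_comp_lower htop, ← IsMinor.lowerDepth_eq h hd htop hbot]
  exact hs'.lower.depth e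

theorem IsSplit.upper_depth_eq (hs' : IsSplit pA' pB' p' top' bot' φA' φB')
    (hd : ∀ e, p'.depth e = p.depth (κ e))
    (hbot : p'.base bot' = p.base bot) (e : pB'.1.Edge) :
    pB'.depth e = p.1.upperDepth p.wt bot
      (minorEdge pB'.1 p.1 p.1.upperLeaf (φ ∘ φB') e) := by
  rw [minorEdge_comp_upper, ← IsMinor.upperDepth_eq hd hbot]
  exact hs'.upper.depth e

theorem IsSplit.lower_labels (hs' : IsSplit pA' pB' p' top' bot' φA' φB') (htop : κ top' = top)
    {u : pA'.1.V} (h : LabelsAgree p' p κ (φA' u) (φ (φA' u))) :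
    LabelsAgree pA' p (minorEdge pA'.1 p.1 (p.1.lowerLeaf top) (φ ∘ φA')) u (φ (φA' u)) :=
  ((hs'.lower.labels u).trans h).congr fun e _ => (minorEdge_comp_lower htop e).symm

theorem IsSplit.upper_labels (hs' : IsSplit pA' pB' p' top' bot' φA' φB')
    {u : pB'.1.V} (h : LabelsAgree p' p κ (φB' u) (φ (φB' u))) :
    LabelsAgree pB' p (minorEdge pB'.1 p.1 p.1.upperLeaf (φ ∘ φB')) u (φ (φB' u)) :=
  ((hs'.upper.labels u).trans h).congr fun e _ => (minorEdge_comp_upper e).symm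

theorem IsSplit.mem_range_or (h : IsSplit pA pB p top bot φA φB) (v : p.1.V) :
    v ∈ Set.range φA ∨ v ∈ Set.range φB := by
  rw [h.isDegrafting.range_lower, h.isDegrafting.range_upper]
  by_cases hv : p.1.leavesAbove (Sum.inl v) ⊆ p.cutLeaves
  · exact Or.inr hv
  · exact Or.inl (Or.inl hv)

theorem lowerLeaf_ne_inl {v : p.1.V} (hv : Sum.inl v ≠ top) (s : A) :
    p.1.lowerLeaf top s ≠ Sum.inl v := by
  by_cases hs : s = a
  · rw [hs, lowerLeaf_self]
    exact hv.symm
  · rw [lowerLeaf_of_ne hs]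
    exact Sum.inr_ne_inl

/-- Degrafting after removal of an unstable vertex: the lower tree. -/
theorem IsUnstableRemoval.lower {v : p.1.V} (h : IsUnstableRemoval p' p v φ)
    (hs : IsSplit pA pB p top bot φA φB) (hs' : IsSplit pA' pB' p' top' bot' φA' φB') :
    (∃ ψ : pA'.1.V ≃ pA.1.V, IsIso pA' pA ψ) ∨
      ∃ (u : pA.1.V) (ψ : pA'.1.V → pA.1.V), φA u = v ∧ IsUnstableRemoval pA' pA u ψ := by
  have hr := h.toIsRemoval
  have htv := IsRemoval.top_ne hs.cut h.unstable
  have htop := hr.map_top hs.cut hs'.cut htv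
  have hbot := hr.base_bot_eq (Or.inr h.unstable) hs.isLive hs.cut hs'.cut
  have hm := hs'.lower_isMinor hr.isMinor htop
  have hd := hs'.lower_depth_eq hr.isMinor hr.depth_eq' htop hbot
  have hlab : ∀ u, p.1.parent (Sum.inl v) ≠ some (φ (φA' u)) →
      LabelsAgree pA' p (minorEdge pA'.1 p.1 (p.1.lowerLeaf top) (φ ∘ φA')) u (φ (φA' u)) :=
    fun u hu => hs'.lower_labels htop (edgeMap_eq_minorEdge p' p φ ▸ hr.labels _ hu)
  by_cases hv : v ∈ Set.range φA
  · right
    obtain ⟨u, rfl⟩ := hv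
    obtain ⟨ψ, hψ⟩ := hs.lower.exists_isUnstableRemoval hm h.unstable hlab (fun t ht => by
      refine ((hs'.lower.labels t).trans (h.label_below _ ht)).congr fun e _ => ?_
      rw [Function.comp_apply, Function.comp_apply, edgeMap_eq_minorEdge, Function.comp_apply,
        minorEdge_comp_lower htop]) hd
    exact ⟨u, ψ, rfl, hψ⟩
  · left
    exact hs.lower.exists_isIso hm (fun w hw => Set.mem_singleton_iff.1 hw ▸ hv)
      (fun w hw => Set.mem_singleton_iff.1 hw ▸ lowerLeaf_ne_inl htv)
      (fun u hu => hlab u (hu v rfl)) hd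

/-- Degrafting after removal of an unstable vertex: the upper tree. -/
theorem IsUnstableRemoval.upper {v : p.1.V} (h : IsUnstableRemoval p' p v φ)
    (hs : IsSplit pA pB p top bot φA φB) (hs' : IsSplit pA' pB' p' top' bot' φA' φB') :
    (∃ ψ : pB'.1.V ≃ pB.1.V, IsIso pB' pB ψ) ∨
      ∃ (u : pB.1.V) (ψ : pB'.1.V → pB.1.V), φB u = v ∧ IsUnstableRemoval pB' pB u ψ := by
  have hr := h.toIsRemoval
  have hbot := hr.base_bot_eq (Or.inr h.unstable) hs.isLive hs.cut hs'.cut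
  have hm := hs'.upper_isMinor hr.isMinor
    (hr.eq_bot_iff (Or.inr h.unstable) hs.isLive hs.cut hs'.cut)
  have hd := hs'.upper_depth_eq hr.depth_eq' hbot
  have hlab : ∀ u, p.1.parent (Sum.inl v) ≠ some (φ (φB' u)) →
      LabelsAgree pB' p (minorEdge pB'.1 p.1 p.1.upperLeaf (φ ∘ φB')) u (φ (φB' u)) :=
    fun u hu => hs'.upper_labels (edgeMap_eq_minorEdge p' p φ ▸ hr.labels _ hu)
  by_cases hv : v ∈ Set.range φB
  · right
    obtain ⟨u, rfl⟩ := hv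
    obtain ⟨ψ, hψ⟩ := hs.upper.exists_isUnstableRemoval hm h.unstable hlab (fun t ht => by
      refine ((hs'.upper.labels t).trans (h.label_below _ ht)).congr fun e _ => ?_
      rw [Function.comp_apply, Function.comp_apply, edgeMap_eq_minorEdge, Function.comp_apply,
        minorEdge_comp_upper]) hd
    exact ⟨u, ψ, rfl, hψ⟩
  · left
    exact hs.upper.exists_isIso hm (fun w hw => Set.mem_singleton_iff.1 hw ▸ hv)
      (fun w hw s => Sum.inr_ne_inl)
      (fun u hu => hlab u (hu v rfl)) hd

end

end WTree
end OpBar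
end

/-! ### Degrafting and contraction of an edge of weight zero -/

noncomputable section
namespace OpBar
open RTree

namespace WTree

section

variable {Q : AugmentedOperad.{u}} {A B : Type} {a : A} {p p' : WTree Q.toSymSeq (Graft A a B)}
  {φ : p'.1.V → p.1.V} {top bot : p.1.Edge} {top' bot' : p'.1.Edge}
  {pA : WTree Q.toSymSeq A} {pB : WTree Q.toSymSeq B} {φA : pA.1.V → p.1.V} {φB : pB.1.V → p.1.V}
  {pA' : WTree Q.toSymSeq A} {pB' : WTree Q.toSymSeq B} {φA' : pA'.1.V → p'.1.V}
  {φB' : pB'.1.V → p'.1.V} {v : p.1.V}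

local notation "κ" => minorEdge (Sigma.fst p') (Sigma.fst p) (leaf (Sigma.fst p)) φ

theorem IsSplit.wt_lower_eq_zero (h : IsSplit pA pB p top bot φA φB) (e : pA.1.Edge)
    (he : p.wt (minorEdge pA.1 p.1 (p.1.lowerLeaf top) φA e) = 0) : pA.wt e = 0 := by
  classical
  rw [h.wt_lower, he, mul_zero, ite_self]

theorem IsSplit.wt_upper_eq_zero (h : IsSplit pA pB p top bot φA φB) (e : pB.1.Edge)
    (he : p.wt (minorEdge pB.1 p.1 p.1.upperLeaf φB e) = 0) : pB.wt e = 0 := by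
  rw [h.wt_upper, he, mul_zero]

/-- Degrafting after contraction of an edge of weight `0`: the upper tree. -/
theorem IsContraction.upper (h : IsContraction (Q := Q.toOperad) p' p v φ)
    (h₀ : p.wt (Sum.inl v) = 0)
    (hs : IsSplit pA pB p top bot φA φB) (hs' : IsSplit pA' pB' p' top' bot' φA' φB') :
    (∃ ψ : pB'.1.V ≃ pB.1.V, IsIso pB' pB ψ) ∨
      (∃ (u : pB.1.V) (ψ : pB'.1.V → pB.1.V), pB.wt (Sum.inl u) = 0 ∧
        IsContraction (Q := Q.toOperad) pB' pB u ψ) ∨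
      ∃ (u : pB.1.V) (ψ : pB'.1.V → pB.1.V), pB.HasZeroEnd u ∧ IsUnstableRemoval pB' pB u ψ := by
  have hr := h.toIsRemoval
  have hbot := hr.base_bot_eq (Or.inl h₀) hs.isLive hs.cut hs'.cut
  have hm := hs'.upper_isMinor hr.isMinor (hr.eq_bot_iff (Or.inl h₀) hs.isLive hs.cut hs'.cut)
  have hd := hs'.upper_depth_eq hr.depth_eq' hbot
  have hlab : ∀ u, p.1.parent (Sum.inl v) ≠ some (φ (φB' u)) →
      LabelsAgree pB' p (minorEdge pB'.1 p.1 p.1.upperLeaf (φ ∘ φB')) u (φ (φB' u)) :=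
    fun u hu => hs'.upper_labels (edgeMap_eq_minorEdge p' p φ ▸ hr.labels _ hu)
  by_cases hv : v ∈ Set.range φB
  · right
    obtain ⟨u, rfl⟩ := hv
    have hu₀ : pB.wt (Sum.inl u) = 0 := hs.wt_upper_eq_zero _ h₀
    -- If the contracted edge is the bottom of the branch, the vertex below it is missing in the
    -- upper tree. There `v` is an unstable vertex on a root edge of weight `0` and is removed
    -- instead of composed.
    by_cases hub : Sum.inl (φB u) = bot
    · right
      obtain ⟨ψ, hψ⟩ := hs.upper.exists_isUnstableRemoval hm
        (IsRemoval.unstable_of_eq_bot (Or.inl h₀) hs.isLive hs.cut hub) hlab (fun t ht => by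
          rw [hub] at ht
          exact absurd (hm.path_bot (Sum.inl t)) (not_path_of_parent ht)) hd
      exact ⟨u, ψ, Or.inl ⟨hs.upper.minor.parent_none_piece.2 hub, hu₀⟩, hψ⟩
    · left
      obtain ⟨ψ, hψ⟩ := IsPiece.exists_isContraction h hs.upper hs'.upper.labels (fun s => by
        rw [edgeMap_eq_minorEdge]
        exact minorEdge_leaf _ _ _) hm hub hd
      exact ⟨u, ψ, hu₀, hψ⟩
  · left
    exact hs.upper.exists_isIso hm (fun w hw => Set.mem_singleton_iff.1 hw ▸ hv)
      (fun w hw s => Sum.inr_ne_inl) (fun u hu => hlab u (hu v rfl)) hd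

/-- The topmost edge of a branch of non-zero weight is contracted. -/
theorem IsContraction.lower_of_eq_top (h : IsContraction (Q := Q.toOperad) p' p v φ)
    (h₀ : p.wt (Sum.inl v) = 0) (hv : Sum.inl v = top)
    (hs : IsSplit pA pB p top bot φA φB) (hs' : IsSplit pA' pB' p' top' bot' φA' φB') :
    ∃ (u : pA.1.V) (ψ : pA'.1.V → pA.1.V), pA.HasZeroEnd u ∧ IsUnstableRemoval pA' pA u ψ := by
  classical
  have hr := h.toIsRemoval
  have hm := hr.isMinor
  have hκv : ∀ e, κ e ≠ Sum.inl v := fun e => hm.avoid e v rfl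
  -- The branch has non-zero weight but its top edge has weight `0`, so there is an unstable vertex
  -- `u` below the top edge.
  have hne : top ≠ bot := by
    intro htb
    have := hs.live
    rw [← htb, ← hv, base, depth, RTree.depth_eq, h₀, zero_add] at this
    exact lt_irrefl _ this
  have htb := (hs.cut.branch top hs.cut.leaves_top).2
  rw [← hv] at hne htb
  obtain ⟨u, hu⟩ := Option.ne_none_iff_exists'.1 h.internal
  have hub := path_parent hu htb hne
  have htu : p.1.Path top (Sum.inl u) := hv ▸ Path.of_parent hu
  have hum : p.1.leavesAbove (Sum.inl u) = p.1.cutSet := hs.cut.mid_iff.2 ⟨htu, hub⟩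
  have huu : p.1.Unstable u := by
    refine unstable_of_leavesAbove_eq hu ?_
    rw [hv, hs.cut.leaves_top, hum]
  have huv : u ≠ v := by
    rintro rfl
    exact not_path_of_parent hu (RTree.Path.refl _)
  have honly : ∀ e, p.1.parent e = some u → e = Sum.inl v := by
    intro e he
    obtain ⟨hsub, -⟩ := Nat.card_eq_one_iff_unique.1 huu
    exact congrArg Subtype.val (hsub.elim ⟨e, he⟩ ⟨_, hu⟩)
  have hκu : κ top' = Sum.inl u := by
    obtain ⟨e, he⟩ := hr.mem_range (e := Sum.inl u) fun h => huv (Sum.inl_injective h)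
    have h1 := hm.path_map (hs'.cut.branch e ((IsMinor.cut_iff hm e).2 (he ▸ hum))).1
    rw [he] at h1
    have h2 := (hs.cut.branch _ ((IsMinor.cut_iff hm top').1 hs'.cut.leaves_top)).1
    rw [← hv] at h2
    exact h1.antisymm (path_parent hu h2 (hκv _).symm)
  obtain ⟨w₀, rfl⟩ : ∃ w₀, top' = Sum.inl w₀ := by
    rcases top' with w | x
    · exact ⟨w, rfl⟩
    · cases hκu
  have hw₀ : φ w₀ = u := Sum.inl_injective hκu
  -- The merged vertex `w₀` is recorded by `φ` at the place of `u`. As the edge below `v` has weight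
  -- `0`, it may be recorded at the place of `v` instead, at the same depth. This exhibits the tree
  -- of `p'` as that of `p` with the unstable vertex `u` removed. The label of `w₀` need not match
  -- that of `v`, but `w₀` is not a vertex of the lower tree.
  let φ₁ : p'.1.V → p.1.V := fun w => if φ w = u then v else φ w
  have hφ₁ : φ₁ w₀ = v := if_pos hw₀
  have hφ₁' : ∀ w, φ w ≠ u → φ₁ w = φ w := fun w hw => if_neg hw
  have hφv : ∀ w, φ w ≠ v := fun w hw => hκv (Sum.inl w) (congrArg Sum.inl hw)
  have hedge : ∀ e, (κ e = Sum.inl u ∧ minorEdge p'.1 p.1 p.1.leaf φ₁ e = Sum.inl v) ∨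
      (κ e ≠ Sum.inl u ∧ minorEdge p'.1 p.1 p.1.leaf φ₁ e = κ e) := by
    rintro (w | x)
    · by_cases hw : φ w = u
      · exact Or.inl ⟨congrArg Sum.inl hw, congrArg Sum.inl (if_pos hw)⟩
      · exact Or.inr ⟨fun h => hw (Sum.inl_injective h), congrArg Sum.inl (if_neg hw)⟩
    · exact Or.inr ⟨Sum.inr_ne_inl, rfl⟩
  have hpar : ∀ e, p.1.parent (p.1.collapse v (κ e)) = (p'.1.parent e).map φ := by
    rw [← edgeMap_eq_minorEdge]
    exact hr.parent
  have hm₁ : IsMinor p'.1 p.1 p.1.leaf p.1.root {u} φ₁ := by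
    refine isMinor_of_parent (fun w w' hww => ?_) (fun w hw => ?_) (fun e => ?_)
    · by_cases h1 : φ w = u <;> by_cases h2 : φ w' = u
      · exact hr.injective (h1.trans h2.symm)
      · rw [hφ₁' w' h2] at hww
        exact absurd (hww.symm.trans (if_pos h1)) (hφv w')
      · rw [hφ₁' w h1] at hww
        exact absurd (hww.trans (if_pos h2)) (hφv w)
      · rw [hφ₁' w h1, hφ₁' w' h2] at hww
        exact hr.injective hww
    · rw [Set.mem_singleton_iff] at hw
      by_cases h1 : φ w = u
      · exact huv (hw.symm.trans (if_pos h1))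
      · rw [hφ₁' w h1] at hw
        exact h1 hw
    · have hp := hpar e
      have hback : ∀ o : Option p'.1.V, o.map φ ≠ some u → o.map φ₁ = o.map φ := by
        rintro (_ | w) hw
        · rfl
        · exact congrArg some (hφ₁' w fun h => hw (congrArg some h))
      rcases hedge e with ⟨he, he₁⟩ | ⟨he, he₁⟩
      · rw [he₁, col_of_mem hu (Set.mem_singleton u)]
        rw [he, collapse, if_neg] at hp
        · rw [hback, hp]
          rw [← hp]
          intro h'
          exact not_path_of_parent h' (RTree.Path.refl _)
        · intro h'
          exact not_path_of_parent h' (Path.of_parent hu)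
      · have hnu : p.1.parent (κ e) ≠ some u := fun h' => hκv e (honly _ h')
        rw [he₁, col_of_forall fun w hw => Set.mem_singleton_iff.1 hw ▸ hnu]
        by_cases hev : p.1.parent (κ e) = some v
        · rw [collapse, if_pos hev, hu] at hp
          rw [hev]
          cases hpe : p'.1.parent e with
          | none =>
            rw [hpe] at hp
            cases hp
          | some w =>
            rw [hpe] at hp
            exact congrArg some (if_pos (Option.some.inj hp).symm).symm
        · rw [collapse, if_neg hev] at hp
          rw [hback, hp]
          rw [← hp]
          exact hnu
  have hd₁ : ∀ e, p'.depth e = p.depth (minorEdge p'.1 p.1 p.1.leaf φ₁ e) := by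
    intro e
    rw [hr.depth_eq']
    rcases hedge e with ⟨he, he₁⟩ | ⟨he, he₁⟩
    · rw [he, he₁, depth, depth, RTree.depth_eq p.wt (Sum.inl v), h₀, zero_add, base_of_parent hu]
    · rw [he₁]
  have hbot := hr.base_bot_eq (Or.inl h₀) hs.isLive hs.cut hs'.cut
  have htop₁ : minorEdge p'.1 p.1 p.1.leaf φ₁ (Sum.inl w₀) = top :=
    (congrArg Sum.inl hφ₁).trans hv
  have hmin := hs'.lower_isMinor hm₁ htop₁
  have hdep := hs'.lower_depth_eq hm₁ hd₁ htop₁ hbot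
  have hφA' : ∀ t, φ (φA' t) ≠ u := by
    intro t ht
    have h1 := hs'.lower.minor.leaf_ne a t
    rw [lowerLeaf_self] at h1
    exact h1 (congrArg Sum.inl (hr.injective (hw₀.trans ht.symm)))
  have hlab : ∀ t, LabelsAgree p' p κ (φA' t) (φ (φA' t)) := by
    intro t
    rw [← edgeMap_eq_minorEdge]
    refine hr.labels _ ?_
    rw [hu]
    exact fun h => hφA' t (Option.some.inj h).symm
  have huA : u ∈ Set.range φA := by
    rw [hs.isDegrafting.range_lower]
    refine Or.inr ⟨hum, fun h => ?_⟩
    exact huv (Sum.inl_injective (h.trans hv.symm))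
  obtain ⟨u₁, rfl⟩ := huA
  obtain ⟨ψ, hψ⟩ := hs.lower.exists_isUnstableRemoval hmin huu (fun t ht => by
      have ht' : p.1.parent (Sum.inl (φA u₁)) ≠ some (φ₁ (φA' t)) := ht
      refine hs'.lower_labels htop₁ ?_
      rw [hφ₁' _ (hφA' t)] at ht' ⊢
      refine (hlab t).congr fun e he => ?_
      rcases hedge e with ⟨h1, -⟩ | ⟨-, h1⟩
      · have := (hlab t).parent he
        rw [h1] at this
        exact absurd this ht'
      · exact h1.symm) (fun t _ => by
      change LabelsAgree pA' p _ t (φ₁ (φA' t))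
      rw [hφ₁' _ (hφA' t)]
      refine ((hs'.lower.labels t).trans (hlab t)).congr fun e he => ?_
      have he' := ((hs'.lower.labels t).trans (hlab t)).parent he
      rw [Function.comp_apply] at he' ⊢
      rw [Function.comp_apply, minorEdge_comp_lower htop₁]
      generalize minorEdge pA'.1 p'.1 (p'.1.lowerLeaf (Sum.inl w₀)) φA' e = e' at he' ⊢
      rcases hedge e' with ⟨h1, h2⟩ | ⟨h1, h2⟩
      · rw [h1, h2, collapse, if_pos hu]
      · rw [h2, collapse, if_neg]
        rw [he']
        exact fun h => hφA' t (Option.some.inj h)) hdep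
  -- The leaf `a` of the lower tree is the copy of `top`: it has weight `0` and ends at the removed
  -- vertex.
  refine ⟨u₁, ψ, Or.inr ⟨pA.1.label.symm a, ?_, ?_⟩, hψ⟩
  · refine hs.lower.minor.parent_iff_piece.2 ?_
    change p.1.parent (minorEdge pA.1 p.1 _ φA (pA.1.leaf a)) = _
    rw [minorEdge_leaf, lowerLeaf_self, ← hv, hu]
  · refine hs.wt_lower_eq_zero _ ?_
    change p.wt (minorEdge pA.1 p.1 _ φA (pA.1.leaf a)) = _
    rw [minorEdge_leaf, lowerLeaf_self, ← hv, h₀]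

/-- Degrafting after contraction of an edge of weight `0`: the lower tree. -/
theorem IsContraction.lower (h : IsContraction (Q := Q.toOperad) p' p v φ)
    (h₀ : p.wt (Sum.inl v) = 0)
    (hs : IsSplit pA pB p top bot φA φB) (hs' : IsSplit pA' pB' p' top' bot' φA' φB') :
    (∃ ψ : pA'.1.V ≃ pA.1.V, IsIso pA' pA ψ) ∨
      (∃ (u : pA.1.V) (ψ : pA'.1.V → pA.1.V), pA.wt (Sum.inl u) = 0 ∧
        IsContraction (Q := Q.toOperad) pA' pA u ψ) ∨
      ∃ (u : pA.1.V) (ψ : pA'.1.V → pA.1.V), pA.HasZeroEnd u ∧ IsUnstableRemoval pA' pA u ψ := by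
  by_cases hvt : Sum.inl v = top
  · exact Or.inr (Or.inr (h.lower_of_eq_top h₀ hvt hs hs'))
  have hr := h.toIsRemoval
  have htop := hr.map_top hs.cut hs'.cut hvt
  have hbot := hr.base_bot_eq (Or.inl h₀) hs.isLive hs.cut hs'.cut
  have hm := hs'.lower_isMinor hr.isMinor htop
  have hd := hs'.lower_depth_eq hr.isMinor hr.depth_eq' htop hbot
  by_cases hv : v ∈ Set.range φA
  · obtain ⟨u, rfl⟩ := hv
    obtain ⟨ψ, hψ⟩ := IsPiece.exists_isContraction h hs.lower hs'.lower.labels (fun s => by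
        rw [edgeMap_eq_minorEdge]
        exact congrFun (IsMinor.lowerLeaf_comp htop) s) hm
        (fun h' => h.internal (eq_root_iff.1 h')) hd
    exact Or.inr (Or.inl ⟨u, ψ, hs.wt_lower_eq_zero _ h₀, hψ⟩)
  · left
    exact hs.lower.exists_isIso hm (fun w hw => Set.mem_singleton_iff.1 hw ▸ hv)
      (fun w hw => Set.mem_singleton_iff.1 hw ▸ lowerLeaf_ne_inl hvt)
      (fun u hu => hs'.lower_labels htop (edgeMap_eq_minorEdge p' p φ ▸ hr.labels _ (hu v rfl))) hd

end

end WTree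
end OpBar
end

noncomputable section
namespace OpBar
open RTree

/-! ## The decomposition respects the identifications of the bar construction -/

theorem AugmentedOperad.StronglyAugmented.aug_ne_pt {Q : AugmentedOperad.{u}}
    (hQ : Q.StronglyAugmented) {X : Type} [Finite X] (hX : Nat.card X = 1) {x : Q.obj X}
    (hx : x ≠ Based.pt) : Q.aug.app X x ≠ Based.pt := by
  obtain ⟨h1, ⟨y⟩⟩ := Nat.card_eq_one_iff_unique.1 hX
  let σ : X ≃ Unit := ⟨fun _ => (), fun _ => y, fun z => h1.elim _ _, fun _ => rfl⟩
  have h2 := hQ (Q.map σ x) (fun h => hx ((WTree.map_eq_pt_iff σ).1 h))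
  rw [Q.aug.app_map] at h2
  intro h
  rw [h] at h2
  exact h2 (unitOperad.map σ).map_pt

theorem aug_map_eq_pt_iff (Q : AugmentedOperad.{u}) {X Y : Type} [Finite X] [Finite Y] (σ : X ≃ Y)
    (x : Q.obj X) : Q.aug.app Y (Q.map σ x) = Based.pt ↔ Q.aug.app X x = Based.pt := by
  rw [Q.aug.app_map]
  exact WTree.map_eq_pt_iff (Q := unitOperad.toSymSeq) σ

namespace WTree

section

variable {Q : AugmentedOperad.{u}} {S S' : Type} {A B : Type} {a : A}

theorem mk_eq_pt_of_lab {p : WTree Q.toSymSeq S} {v : p.1.V} (h : p.lab v = Based.pt) :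
    BarObj.mk p = Based.pt := Quot.sound (BarRel.label_pt p v h)

/-- Strong augmentation turns the removal of an unstable vertex at a zero root or leaf edge into
relation (3), whatever its label may be other than the base point. This covers the exceptional
contractions. -/
theorem mk_eq_of_hasZeroEnd (hQ : Q.StronglyAugmented) {p p' : WTree Q.toSymSeq S} {v : p.1.V}
    {φ : p'.1.V → p.1.V} (h : IsUnstableRemoval p' p v φ) (h₀ : p.HasZeroEnd v)
    (hv : p.lab v ≠ Based.pt) : BarObj.mk p = BarObj.mk p' :=
  Quot.sound (BarRel.augment p p' v φ h h₀ (hQ.aug_ne_pt h.unstable hv))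

theorem LabelsAgree.aug_eq_pt_iff {q : WTree Q.toSymSeq S'} {p : WTree Q.toSymSeq S}
    {κ : q.1.Edge → p.1.Edge} {u : q.1.V} {v : p.1.V} (h : LabelsAgree q p κ u v) :
    Q.aug.app _ (q.lab u) = Based.pt ↔ Q.aug.app _ (p.lab v) = Based.pt := by
  obtain ⟨σ, -, hl⟩ := h
  rw [← hl, aug_map_eq_pt_iff]

/-- By `leavesAbove_eq_iff`, edges on one branch of the piece come from one branch of `p`, and
scaling keeps zero weights zero. -/
theorem IsPiece.mk_eq_pt_of_zero_branch {p : WTree Q.toSymSeq S} {lam : S' → p.1.Edge}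
    {bot : p.1.Edge} {f : p.1.Edge → ℝ} {q : WTree Q.toSymSeq S'} {φ : q.1.V → p.1.V}
    (h : IsPiece q p lam bot φ f)
    (hcov : ∀ x, p.1.Path (Sum.inr x) bot → ∃ s, p.1.Path (Sum.inr x) (lam s))
    (hw : ∀ e, p.wt (minorEdge q.1 p.1 lam φ e) = 0 → q.wt e = 0) {e : p.1.Edge}
    (he : p.1.parent e = none ∨ ∃ x, e = Sum.inr x)
    (h₀ : p.1.branchWeight p.wt (p.1.leavesAbove e) = 0)
    (hr : e ∈ Set.range (minorEdge q.1 p.1 lam φ)) : BarObj.mk q = Based.pt := by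
  obtain ⟨ε, rfl⟩ := hr
  refine Quot.sound (BarRel.zero_branch q ε ?_ ?_)
  · rcases he with he | ⟨x, hx⟩
    · left
      have h1 := h.minor.path_bot ε
      rw [← eq_root_iff] at he
      rw [he] at h1
      refine h.minor.parent_none_piece.2 ?_
      rw [he, eq_root_of_path h1]
    · right
      rcases ε with u | x
      · cases hx
      · exact ⟨x, rfl⟩
  · rw [branchWeight_eq_zero_iff q.wt_nonneg]
    intro e' he'
    rw [branchWeight_eq_zero_iff p.wt_nonneg] at h₀
    exact hw e' (h₀ _ ((h.minor.leavesAbove_eq_iff hcov e' ε).1 he'))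

theorem IsPiece.hasZeroEnd {p : WTree Q.toSymSeq S} {lam : S' → p.1.Edge}
    {bot : p.1.Edge} {f : p.1.Edge → ℝ} {q : WTree Q.toSymSeq S'} {φ : q.1.V → p.1.V}
    (h : IsPiece q p lam bot φ f)
    (hw : ∀ e, p.wt (minorEdge q.1 p.1 lam φ e) = 0 → q.wt e = 0) {u : q.1.V}
    (h₀ : p.HasZeroEnd (φ u)) : q.HasZeroEnd u := by
  rcases h₀ with ⟨h1, h2⟩ | ⟨x, hx, h2⟩
  · refine Or.inl ⟨h.minor.parent_none_piece.2 ?_, hw (Sum.inl u) h2⟩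
    have h3 := h.minor.path_bot (Sum.inl u)
    rw [← eq_root_iff] at h1
    change p.1.Path (Sum.inl (φ u)) bot at h3
    rw [h1] at h3
    exact h1.trans (eq_root_of_path h3).symm
  · obtain ⟨e, he, hex⟩ := (h.labels u).exists_of_parent hx
    rcases e with t | y
    · cases hex
    · exact Or.inr ⟨y, he, hw _ (by rw [hex, h2])⟩

variable [Finite A] [Finite B] {p p' : WTree Q.toSymSeq (Graft A a B)}

theorem decomp_eq_pt_of_lab {v : p.1.V} (h : p.lab v = Based.pt) : p.decomp = Based.pt := by
  by_cases hl : p.IsLive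
  · obtain ⟨pA, pB, top, bot, φA, φB, hs⟩ := hl.exists_isSplit
    rw [hs.decomp_eq]
    rcases hs.mem_range_or v with ⟨u, rfl⟩ | ⟨u, rfl⟩
    · exact Smash.mk_eq_pt (Or.inl (mk_eq_pt_of_lab ((hs.lower.labels u).lab_eq_pt_iff.2 h)))
    · exact Smash.mk_eq_pt (Or.inr (mk_eq_pt_of_lab ((hs.upper.labels u).lab_eq_pt_iff.2 h)))
  · exact decomp_of_not_isLive hl

theorem decomp_eq_pt_of_zero_branch {e : p.1.Edge}
    (he : p.1.parent e = none ∨ ∃ x, e = Sum.inr x)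
    (h₀ : p.1.branchWeight p.wt (p.1.leavesAbove e) = 0) : p.decomp = Based.pt := by
  by_cases hl : p.IsLive
  · obtain ⟨pA, pB, top, bot, φA, φB, hs⟩ := hl.exists_isSplit
    rw [hs.decomp_eq]
    by_cases hsub : p.1.leavesAbove e ⊆ p.1.cutSet
    · exact Smash.mk_eq_pt (Or.inr (hs.upper.mk_eq_pt_of_zero_branch hs.cut.upperLeaf_cover
        hs.wt_upper_eq_zero he h₀ ((hs.cut.mem_range_upper_iff hs.upper.minor).2 hsub)))
    · exact Smash.mk_eq_pt (Or.inl (hs.lower.mk_eq_pt_of_zero_branch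
        (fun x _ => hs.cut.lowerLeaf_cover x) hs.wt_lower_eq_zero he h₀
        ((hs.cut.mem_range_lower_iff hs.lower.minor).2 fun h => absurd h hsub)))
  · exact decomp_of_not_isLive hl

theorem IsContraction.decomp_eq (hQ : Q.StronglyAugmented) {v : p.1.V} {φ : p'.1.V → p.1.V}
    (h : IsContraction (Q := Q.toOperad) p' p v φ) (h₀ : p.wt (Sum.inl v) = 0) :
    p.decomp = p'.decomp := by
  have hlive := h.toIsRemoval.isLive_iff (Or.inl h₀)
  by_cases hl : p.IsLive
  swap
  · rw [decomp_of_not_isLive hl, decomp_of_not_isLive (mt hlive.2 hl)]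
  have hran : ∀ w, w ≠ v → ∃ w', φ w' = w := by
    intro w hw
    have : w ∈ Set.range φ := by
      rw [h.range]
      exact hw
    exact this
  -- Labels at the base point are treated separately because relation (3) could not be used for
  -- them. Composition and transport of labels preserve their presence, so both decompositions are
  -- trivial.
  by_cases hpt : ∃ w, p.lab w = Based.pt
  · obtain ⟨w, hw⟩ := hpt
    rw [decomp_eq_pt_of_lab hw]
    symm
    obtain ⟨u, hu⟩ := Option.ne_none_iff_exists'.1 h.internal
    obtain ⟨u', rfl⟩ := hran u fun huv => by
      rw [huv] at hu
      exact not_path_of_parent hu (RTree.Path.refl _)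
    by_cases hwu : w = φ u' ∨ w = v
    · obtain ⟨σ, -, hσ⟩ := h.label_below u' hu
      refine decomp_eq_pt_of_lab (v := u') ((map_eq_pt_iff σ).1 (hσ.trans ?_))
      rcases hwu with rfl | rfl
      · rw [hw]
        exact Q.comp_pt_left _ _
      · rw [hw]
        exact Q.comp_pt_right _ _
    · rw [not_or] at hwu
      obtain ⟨w', rfl⟩ := hran w hwu.2
      refine decomp_eq_pt_of_lab (v := w') ((h.labels w' fun hp => ?_).lab_eq_pt_iff.2 hw)
      rw [hu] at hp
      exact hwu.1 (Option.some.inj hp).symm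
  · push Not at hpt
    obtain ⟨pA, pB, top, bot, φA, φB, hs⟩ := hl.exists_isSplit
    obtain ⟨pA', pB', top', bot', φA', φB', hs'⟩ := (hlive.1 hl).exists_isSplit
    rw [hs.decomp_eq, hs'.decomp_eq]
    congr 1
    · rcases h.lower h₀ hs hs' with h1 | ⟨u, ψ, h1, h2⟩ | ⟨u, ψ, h1, h2⟩
      · exact BarObj.mk_eq_of_isIso h1
      · exact Quot.sound (BarRel.contract pA pA' u ψ h2 h1)
      · exact mk_eq_of_hasZeroEnd hQ h2 h1 fun h => hpt _ ((hs.lower.labels u).lab_eq_pt_iff.1 h)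
    · rcases h.upper h₀ hs hs' with h1 | ⟨u, ψ, h1, h2⟩ | ⟨u, ψ, h1, h2⟩
      · exact BarObj.mk_eq_of_isIso h1
      · exact Quot.sound (BarRel.contract pB pB' u ψ h2 h1)
      · exact mk_eq_of_hasZeroEnd hQ h2 h1 fun h => hpt _ ((hs.upper.labels u).lab_eq_pt_iff.1 h)

/-- The hypothesis `H` stands for the reason why the vertex may be removed, its label being the unit
or the augmentation applying to it. It is needed for pieces in general, since a vertex on the branch
occurs in both trees. -/
theorem IsUnstableRemoval.decomp_eq {v : p.1.V} {φ : p'.1.V → p.1.V}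
    (h : IsUnstableRemoval p' p v φ)
    (H : ∀ {S' : Type} {q q' : WTree Q.toSymSeq S'} {lam : S' → p.1.Edge} {bot : p.1.Edge}
      {f : p.1.Edge → ℝ} {ξ : q.1.V → p.1.V} {u : q.1.V} {ψ : q'.1.V → q.1.V},
      IsPiece q p lam bot ξ f → (∀ e, p.wt (minorEdge q.1 p.1 lam ξ e) = 0 → q.wt e = 0) →
      ξ u = v → IsUnstableRemoval q' q u ψ → BarObj.mk q = BarObj.mk q') :
    p.decomp = p'.decomp := by
  have hlive := h.toIsRemoval.isLive_iff (Or.inr h.unstable)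
  by_cases hl : p.IsLive
  · obtain ⟨pA, pB, top, bot, φA, φB, hs⟩ := hl.exists_isSplit
    obtain ⟨pA', pB', top', bot', φA', φB', hs'⟩ := (hlive.1 hl).exists_isSplit
    rw [hs.decomp_eq, hs'.decomp_eq]
    congr 1
    · rcases h.lower hs hs' with h1 | ⟨u, ψ, hu, h2⟩
      · exact BarObj.mk_eq_of_isIso h1
      · exact H hs.lower hs.wt_lower_eq_zero hu h2
    · rcases h.upper hs hs' with h1 | ⟨u, ψ, hu, h2⟩
      · exact BarObj.mk_eq_of_isIso h1
      · exact H hs.upper hs.wt_upper_eq_zero hu h2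
  · rw [decomp_of_not_isLive hl, decomp_of_not_isLive (mt hlive.2 hl)]

theorem IsIso.decomp_eq {φ : p'.1.V ≃ p.1.V} (h : IsIso p' p φ) : p.decomp = p'.decomp := by
  have hm := h.isMinor
  have hsurj : ∀ e, e ∈ Set.range (minorEdge p'.1 p.1 p.1.leaf φ) := by
    intro e
    refine hm.mem_range_iff.2 ⟨fun u hu => hu.elim, path_root _, ?_⟩
    obtain ⟨x, hx⟩ := exists_path_leaf e
    exact ⟨p.1.label x, leaf_label (T := p.1) x ▸ hx⟩
  have hw : ∀ e, p'.wt e = p.wt (minorEdge p'.1 p.1 p.1.leaf φ e) := by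
    rw [← edgeMap_eq_minorEdge]
    exact h.weight
  by_cases hl : p.IsLive
  · have hl' : p'.IsLive := by
      obtain ⟨e, he, hne⟩ := hl
      obtain ⟨e', rfl⟩ := hsurj e
      exact ⟨e', (IsMinor.cut_iff hm e').2 he, by rwa [hw]⟩
    obtain ⟨pA, pB, top, bot, φA, φB, hs⟩ := hl.exists_isSplit
    obtain ⟨pA', pB', top', bot', φA', φB', hs'⟩ := hl'.exists_isSplit
    rw [hs.decomp_eq, hs'.decomp_eq]
    have hd : ∀ e, p'.depth e = p.depth (minorEdge p'.1 p.1 p.1.leaf φ e) := by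
      rw [← edgeMap_eq_minorEdge]
      exact h.depth_eq
    have hp : IsPiece p' p p.1.leaf p.1.root φ p.depth := by
      refine ⟨hm, fun v => ?_, hd⟩
      rw [← edgeMap_eq_minorEdge]
      exact h.labels v
    obtain ⟨htop, hbot⟩ := hs.cut.unique
      (hm.isCut_of_isCut (IsMinor.cut_iff hm) (fun e _ => hsurj e) hs'.cut)
    have hb : p'.base bot' = p.base bot := by
      have h1 := p'.wt_eq bot'
      have h2 := p.wt_eq bot
      have h3 := hw bot'
      have h4 := hd bot'
      rw [← hbot] at h3 h4
      linarith
    congr 1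
    · exact hs.lower.mk_eq (hs'.lower.comp hp (F := p.1.lowerDepth p.wt p.1.cutSet top bot)
        hp.minor.map_root (fun e _ => IsMinor.lowerDepth_eq hm hd htop.symm hb e))
        (IsMinor.lowerLeaf_comp htop.symm).symm rfl fun _ _ => rfl
    · exact hs.upper.mk_eq (hs'.upper.comp hp (F := p.1.upperDepth p.wt bot)
        hbot.symm (fun e _ => IsMinor.upperDepth_eq hd hb e))
        IsMinor.upperLeaf_comp.symm rfl fun _ _ => rfl
  · have hl' : ¬ p'.IsLive := by
      rintro ⟨e', he', hne⟩
      exact hl ⟨_, (IsMinor.cut_iff hm e').1 he', by rwa [← hw]⟩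
    rw [decomp_of_not_isLive hl, decomp_of_not_isLive hl']

end

end WTree

section

variable {Q : AugmentedOperad.{u}} {A B : Type} {a : A} [Finite A] [Finite B]

/-- The decomposition before passage to the quotient. -/
def preDecomp : PreBar Q.toSymSeq (Graft A a B) → Smash (BarObj Q A) (BarObj Q B) :=
  Sum.elim (fun _ => Based.pt) WTree.decomp

theorem BarRel.preDecomp_eq (hQ : Q.StronglyAugmented) {x y : PreBar Q.toSymSeq (Graft A a B)}
    (h : BarRel Q (Graft A a B) x y) : preDecomp x = preDecomp y := by
  cases h with
  | iso p p' φ h => exact h.decomp_eq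
  | label_pt p v h => exact WTree.decomp_eq_pt_of_lab h
  | zero_branch p e he h => exact WTree.decomp_eq_pt_of_zero_branch he h
  | contract p p' v φ h h₀ => exact h.decomp_eq hQ h₀
  | unit p p' v φ h σ h₁ =>
    refine h.decomp_eq ?_
    rintro S' q q' lam bot f ξ u ψ hp - rfl h'
    obtain ⟨τ, -, hτ⟩ := hp.labels u
    refine Quot.sound (BarRel.unit q q' u ψ h' (σ.trans τ.symm) ?_)
    rw [Q.map_trans, ← h₁, ← hτ, ← Q.map_trans, Equiv.self_trans_symm, Q.map_refl]
  | augment p p' v φ h h₀ h₁ =>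
    refine h.decomp_eq ?_
    rintro S' q q' lam bot f ξ u ψ hp hw rfl h'
    exact Quot.sound (BarRel.augment q q' u ψ h' (hp.hasZeroEnd hw h₀)
      (mt (hp.labels u).aug_eq_pt_iff.1 h₁))
  | augment_pt p v hv h₀ h₁ =>
    -- By strong augmentation the label itself is the base point.
    refine WTree.decomp_eq_pt_of_lab (v := v) ?_
    by_contra hne
    exact hQ.aug_ne_pt hv hne h₁

/-- The decomposition maps of the bar construction. -/
def BarObj.decomp (hQ : Q.StronglyAugmented) :
    BarObj Q (Graft A a B) → Smash (BarObj Q A) (BarObj Q B) :=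
  Quot.lift preDecomp fun _ _ h => h.preDecomp_eq hQ

end

end OpBar
end

noncomputable section
namespace OpBar
open RTree

/-! ## Continuity of the decomposition -/

theorem tendsto_of_tendsto_seqCoreflection {X : Type*} (t : TopologicalSpace X) {s : ℕ → X} {x : X}
    (hs : Tendsto s atTop (@nhds X (seqCoreflection t) x)) : Tendsto s atTop (@nhds X t x) :=
  hs.mono_right (nhds_mono (seqCoreflection_le t))

/-- The coreflection has the same convergent sequences as the ordinary product, so convergence may
be checked in each factor. -/
theorem Smash.tendsto_mk {X Y : Type*} [Based X] [Based Y] [TopologicalSpace X]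
    [TopologicalSpace Y] {s : ℕ → X} {t : ℕ → Y} {x : X} {y : Y} (hs : Tendsto s atTop (𝓝 x))
    (ht : Tendsto t atTop (𝓝 y)) :
    Tendsto (fun n => Smash.mk (s n) (t n)) atTop (𝓝 (Smash.mk x y)) := by
  have h1 : Tendsto (fun n => ((s n, t n) : X × Y)) atTop (𝓝 (x, y)) := hs.prodMk_nhds ht
  have h2 : Tendsto (fun n => ((s n, t n) : SeqProd X Y)) atTop
      (@nhds (SeqProd X Y) _ ((x, y) : X × Y)) :=
    tendsto_seqCoreflection instTopologicalSpaceProd h1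
  have h3 : Continuous (Quot.mk _ : SeqProd X Y → Smash X Y) := continuous_quot_mk
  exact (h3.tendsto _).comp h2

namespace RTree

variable {S : Type} (T : RTree S)

theorem continuous_depth (e : T.Edge) : Continuous fun w : T.Edge → ℝ => T.depth w e := by
  have h : ∀ w : T.Edge → ℝ, T.depth w e =
      ∑ e' ∈ (Set.toFinite {e' | T.Path e e'}).toFinset, w e' := fun w =>
    finsum_mem_eq_finite_toFinset_sum w (Set.toFinite {e' | T.Path e e'})
  simp_rw [h]
  exact continuous_finsetSum _ fun e' _ => continuous_apply e'

theorem continuous_base (e : T.Edge) : Continuous fun w : T.Edge → ℝ => T.base w e :=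
  (T.continuous_depth e).sub (continuous_apply e)

theorem isClosed_isWeighting : IsClosed {w : T.Edge → ℝ | T.IsWeighting w} := by
  have h : {w : T.Edge → ℝ | T.IsWeighting w} =
      (⋂ e, {w | 0 ≤ w e}) ∩ ⋂ x, {w | T.depth w (Sum.inr x) = 1} := by
    ext w
    simp only [Set.mem_inter_iff, Set.mem_iInter, Set.mem_ofPred_eq]
    exact isWeighting_iff
  rw [h]
  exact (isClosed_iInter fun e => isClosed_le continuous_const (continuous_apply e)).inter
    (isClosed_iInter fun x => isClosed_eq (T.continuous_depth _) continuous_const)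

/-- Weightings form a closed subset of a cube. Compactness supplies limits of the degrafted weights
even where the scaling factors fail to converge. -/
instance : CompactSpace {w : T.Edge → ℝ // T.IsWeighting w} := by
  have h : IsCompact {w : T.Edge → ℝ | T.IsWeighting w} := by
    refine (isCompact_univ_pi fun _ : T.Edge => isCompact_Icc (a := (0 : ℝ)) (b := 1)).of_isClosed_subset
      T.isClosed_isWeighting fun w hw e _ => ⟨hw.1 e, hw.le_one e⟩
  exact isCompact_iff_compactSpace.1 h

end RTree

namespace WTree

variable {Q : AugmentedOperad.{u}} {A B : Type} {a : A}

theorem tendsto_mk {S : Type} {T : RTree S} {l : ℕ → ∀ v : T.V, Q.obj (T.In v)}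
    {l₀ : ∀ v : T.V, Q.obj (T.In v)} {w : ℕ → {w : T.Edge → ℝ // T.IsWeighting w}}
    {w₀ : {w : T.Edge → ℝ // T.IsWeighting w}} (hl : Tendsto l atTop (𝓝 l₀))
    (hw : Tendsto w atTop (𝓝 w₀)) :
    Tendsto (fun n => (BarObj.mk ⟨T, (l n, w n)⟩ : BarObj Q S)) atTop
      (𝓝 (BarObj.mk ⟨T, (l₀, w₀)⟩)) := by
  have h1 := tendsto_seqCoreflection _ (hl.prodMk_nhds hw)
  have h2 : Continuous fun c : Cell Q.toSymSeq T => (BarObj.mk ⟨T, c⟩ : BarObj Q S) :=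
    continuous_quot_mk.comp (continuous_inr.comp
      (continuous_sigmaMk (σ := fun T : RTree S => Cell Q.toSymSeq T) (i := T)))
  exact (h2.tendsto (l₀, w₀)).comp h1

section Limit

variable {T : RTree (Graft A a B)} {top bot : T.Edge} {TA : RTree A} {TB : RTree B}
  {φA : TA.V → T.V} {φB : TB.V → T.V} {c : ℕ → Cell Q.toSymSeq T} {c₀ : Cell Q.toSymSeq T}
  {cA : ℕ → Cell Q.toSymSeq TA} {cB : ℕ → Cell Q.toSymSeq TB}
  {cA₀ : Cell Q.toSymSeq TA} {cB₀ : Cell Q.toSymSeq TB}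

/-- Limits of degraftings are degraftings if the limit tree can be degrafted. -/
theorem isSplit_of_tendsto
    (hs : ∀ n, IsSplit (Q := Q.toSymSeq) ⟨TA, cA n⟩ ⟨TB, cB n⟩ ⟨T, c n⟩ top bot φA φB)
    (hlA : ∀ v, LabelsAgree (Q := Q.toSymSeq) ⟨TA, cA₀⟩ ⟨T, c₀⟩
      (minorEdge TA T (T.lowerLeaf top) φA) v (φA v))
    (hlB : ∀ v, LabelsAgree (Q := Q.toSymSeq) ⟨TB, cB₀⟩ ⟨T, c₀⟩
      (minorEdge TB T T.upperLeaf φB) v (φB v))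
    (hc : Tendsto (fun n => (c n).2.1) atTop (𝓝 c₀.2.1))
    (hA : Tendsto (fun n => (cA n).2.1) atTop (𝓝 cA₀.2.1))
    (hB : Tendsto (fun n => (cB n).2.1) atTop (𝓝 cB₀.2.1))
    (hl : T.base c₀.2.1 bot < T.depth c₀.2.1 top) :
    IsSplit (Q := Q.toSymSeq) ⟨TA, cA₀⟩ ⟨TB, cB₀⟩ ⟨T, c₀⟩ top bot φA φB := by
  have hd : ∀ e, Tendsto (fun n => T.depth (c n).2.1 e) atTop (𝓝 (T.depth c₀.2.1 e)) := fun e =>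
    ((T.continuous_depth e).tendsto _).comp hc
  have hb : Tendsto (fun n => T.base (c n).2.1 bot) atTop (𝓝 (T.base c₀.2.1 bot)) :=
    ((T.continuous_base bot).tendsto _).comp hc
  have h1 : T.base c₀.2.1 bot < 1 := base_lt_one (Q := Q.toSymSeq) (p := ⟨T, c₀⟩) hl
  refine ⟨(hs 0).cut, hl, ⟨(hs 0).lower.minor, hlA, fun e => ?_⟩,
    ⟨(hs 0).upper.minor, hlB, fun e => ?_⟩⟩
  · have h2 : Tendsto (fun n => TA.depth (cA n).2.1 e) atTop (𝓝 (TA.depth cA₀.2.1 e)) :=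
      ((TA.continuous_depth e).tendsto _).comp hA
    refine tendsto_nhds_unique h2 ?_
    have h3 : ∀ n, TA.depth (cA n).2.1 e = T.lowerDepth (c n).2.1 T.cutSet top bot
        (minorEdge TA T (T.lowerLeaf top) φA e) := fun n => (hs n).lower.depth e
    simp_rw [h3]
    by_cases hm : T.leavesAbove (minorEdge TA T (T.lowerLeaf top) φA e) = T.cutSet
    · simp_rw [lowerDepth_of_mid hm]
      exact hb.add ((((tendsto_const_nhds (x := (1 : ℝ))).sub hb).div ((hd top).sub hb)
        (sub_ne_zero.2 hl.ne')).mul ((hd _).sub hb))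
    · simp_rw [lowerDepth_of_ne hm]
      exact hd _
  · have h2 : Tendsto (fun n => TB.depth (cB n).2.1 e) atTop (𝓝 (TB.depth cB₀.2.1 e)) :=
      ((TB.continuous_depth e).tendsto _).comp hB
    refine tendsto_nhds_unique h2 ?_
    have h3 : ∀ n, TB.depth (cB n).2.1 e = T.upperDepth (c n).2.1 bot
        (minorEdge TB T T.upperLeaf φB e) := fun n => (hs n).upper.depth e
    simp_rw [h3]
    exact ((hd _).sub hb).div ((tendsto_const_nhds (x := (1 : ℝ))).sub hb)
      (sub_ne_zero.2 h1.ne')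

/-- If the weight of the branch tends to `0`, then one of the limits of the two trees of the
degrafting represents the base point. -/
theorem mk_eq_pt_of_tendsto
    (hs : ∀ n, IsSplit (Q := Q.toSymSeq) ⟨TA, cA n⟩ ⟨TB, cB n⟩ ⟨T, c n⟩ top bot φA φB)
    (hc : Tendsto (fun n => (c n).2.1) atTop (𝓝 c₀.2.1))
    (hA : Tendsto (fun n => (cA n).2.1) atTop (𝓝 cA₀.2.1))
    (hB : Tendsto (fun n => (cB n).2.1) atTop (𝓝 cB₀.2.1))
    (hl : ¬ IsLive (Q := Q.toSymSeq) ⟨T, c₀⟩) :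
    BarObj.mk (Q := Q) ⟨TA, cA₀⟩ = Based.pt ∨ BarObj.mk (Q := Q) ⟨TB, cB₀⟩ = Based.pt := by
  classical
  have hcut : T.IsCut T.cutSet top bot := (hs 0).cut
  have hmA : IsMinor TA T (T.lowerLeaf top) T.root ∅ φA := (hs 0).lower.minor
  have hmB : IsMinor TB T T.upperLeaf bot ∅ φB := (hs 0).upper.minor
  have hc' : ∀ e, Tendsto (fun n => (c n).2.1 e) atTop (𝓝 (c₀.2.1 e)) := tendsto_pi_nhds.1 hc
  have hA' : ∀ e, Tendsto (fun n => (cA n).2.1 e) atTop (𝓝 (cA₀.2.1 e)) := tendsto_pi_nhds.1 hA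
  have hB' : ∀ e, Tendsto (fun n => (cB n).2.1 e) atTop (𝓝 (cB₀.2.1 e)) := tendsto_pi_nhds.1 hB
  have hb : Tendsto (fun n => T.base (c n).2.1 bot) atTop (𝓝 (T.base c₀.2.1 bot)) :=
    ((T.continuous_base bot).tendsto _).comp hc
  have h0 : ∀ e, T.leavesAbove e = T.cutSet → c₀.2.1 e = 0 := by
    intro e he
    by_contra hne
    exact hl ⟨e, he, hne⟩
  have hle : T.base c₀.2.1 bot ≤ 1 :=
    (base_le_depth c₀.2.2.1 bot).trans (c₀.2.2.depth_le_one bot)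
  -- While `base bot` stays away from `1`, the factor of the upper tree is bounded and its root
  -- branch inherits the limit weight `0`. Otherwise the branch of the leaf `a` is squeezed into the
  -- interval from `base bot` to `1`, whose length tends to `0`.
  rcases hle.lt_or_eq with h1 | h1
  · right
    refine Quot.sound (BarRel.zero_branch ⟨TB, cB₀⟩ TB.root (Or.inl TB.parent_root) ?_)
    refine (branchWeight_eq_zero_iff cB₀.2.2.1 _).2 fun e he => ?_
    have hm := (hmB.leavesAbove_eq_iff hcut.upperLeaf_cover e TB.root).1 he
    rw [hmB.map_root, hcut.leaves_bot] at hm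
    refine tendsto_nhds_unique (hB' e) ?_
    have h2 : ∀ n, (cB n).2.1 e = 1 / (1 - T.base (c n).2.1 bot) *
        (c n).2.1 (minorEdge TB T T.upperLeaf φB e) := fun n => (hs n).wt_upper e
    simp_rw [h2]
    have h3 := ((tendsto_const_nhds (x := (1 : ℝ))).div
      ((tendsto_const_nhds (x := (1 : ℝ))).sub hb) (sub_ne_zero.2 h1.ne')).mul
      (hc' (minorEdge TB T T.upperLeaf φB e))
    rwa [h0 _ hm, mul_zero] at h3
  · left
    refine Quot.sound (BarRel.zero_branch ⟨TA, cA₀⟩ (TA.leaf a) (Or.inr ⟨_, rfl⟩) ?_)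
    refine (branchWeight_eq_zero_iff cA₀.2.2.1 _).2 fun e he => ?_
    have hm := (hmA.leavesAbove_eq_iff (fun x _ => hcut.lowerLeaf_cover x) e (TA.leaf a)).1 he
    rw [minorEdge_leaf, lowerLeaf_self, hcut.leaves_top] at hm
    refine le_antisymm ?_ (cA₀.2.2.1 e)
    have h8 : Tendsto (fun n => 1 - T.base (c n).2.1 bot) atTop (𝓝 0) := by
      have := (tendsto_const_nhds (x := (1 : ℝ))).sub hb
      rwa [h1, sub_self] at this
    · refine le_of_tendsto_of_tendsto' (hA' e) h8 fun n => ?_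
      have h2 : (cA n).2.1 e = _ := (hs n).wt_lower e
      have hpos : T.base (c n).2.1 bot < T.depth (c n).2.1 top := (hs n).live
      have hlt : T.base (c n).2.1 bot < 1 := base_lt_one (p := ⟨T, c n⟩) (hs n).live
      rw [h2, if_pos hm]
      change (1 - T.base (c n).2.1 bot) / (T.depth (c n).2.1 top - T.base (c n).2.1 bot) *
        (c n).2.1 (minorEdge TA T (T.lowerLeaf top) φA e) ≤ _
      obtain ⟨h3, h4⟩ := hcut.branch _ hm
      have h5 := depth_mono (c n).2.2.1 h3
      have h6 := base_mono (c n).2.2.1 h4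
      have h7 := depth_eq (c n).2.1 (minorEdge TA T (T.lowerLeaf top) φA e)
      -- An edge of the branch weighs at most `depth top - base bot`. This cancels the denominator
      -- and leaves the bound `1 - base bot`.
      rw [div_mul_eq_mul_div, div_le_iff₀ (by linarith)]
      exact mul_le_mul_of_nonneg_left (by linarith) (by linarith)

end Limit

theorem continuous_decomp [Finite A] [Finite B] (T : RTree (Graft A a B)) :
    Continuous fun c : Cell Q.toSymSeq T => decomp (Q := Q) ⟨T, c⟩ := by
  by_cases hex : ∃ e, T.leavesAbove e = T.cutSet
  swap
  · have : ∀ c : Cell Q.toSymSeq T, decomp (Q := Q) ⟨T, c⟩ = Based.pt := fun c =>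
      decomp_of_not_isLive fun ⟨e, he, _⟩ => hex ⟨e, he⟩
    simp_rw [this]
    exact continuous_const
  obtain ⟨top, bot, hcut⟩ := exists_isCut hex
  obtain ⟨TA, φA, hA⟩ := hcut.exists_lower
  obtain ⟨TB, φB, hB⟩ := hcut.exists_upper
  obtain ⟨labA, hcA, hlA⟩ := exists_labels hA (fun x _ => hcut.lowerLeaf_cover x) Q.toSymSeq
  obtain ⟨labB, hcB, hlB⟩ := exists_labels hB hcut.upperLeaf_cover Q.toSymSeq
  have hlive : ∀ c : Cell Q.toSymSeq T, IsLive (Q := Q.toSymSeq) ⟨T, c⟩ ↔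
      T.base c.2.1 bot < T.depth c.2.1 top := fun c =>
    (hcut.base_lt_depth_iff c.2.2.1).symm
  rw [continuous_iff_seqContinuous]
  intro c c₀ hc
  have hc1 : Tendsto (fun n => ((c n).1, (c n).2)) atTop (𝓝 (c₀.1, c₀.2)) :=
    tendsto_of_tendsto_seqCoreflection _ hc
  have hlab : Tendsto (fun n => (c n).1) atTop (𝓝 c₀.1) := (continuous_fst.tendsto _).comp hc1
  have hwt : Tendsto (fun n => (c n).2.1) atTop (𝓝 c₀.2.1) :=
    (continuous_subtype_val.tendsto _).comp ((continuous_snd.tendsto _).comp hc1)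
  -- It suffices to find, in every subsequence, a further one along which the values converge to the
  -- right limit. If the branch is non-zero infinitely often, the indices are thinned to these.
  refine tendsto_of_subseq_tendsto fun ns hns => ?_
  by_cases hfreq : ∃ᶠ n in atTop, IsLive (Q := Q.toSymSeq) ⟨T, c (ns n)⟩
  · obtain ⟨θ, hθ, hθl⟩ := extraction_of_frequently_atTop hfreq
    have hwA := fun n => exists_lower_weighting (p := ⟨T, c (ns (θ n))⟩) hcut
      ((hlive _).1 (hθl n)) hA
    have hwB := fun n => exists_upper_weighting (p := ⟨T, c (ns (θ n))⟩)
      ((hlive _).1 (hθl n)) hB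
    choose wA hwA using hwA
    choose wB hwB using hwB
    have : FirstCountableTopology {w : TA.Edge → ℝ // TA.IsWeighting w} :=
      Topology.IsInducing.subtypeVal.firstCountableTopology
    have : FirstCountableTopology {w : TB.Edge → ℝ // TB.IsWeighting w} :=
      Topology.IsInducing.subtypeVal.firstCountableTopology
    -- Labels converge by themselves. Only the weightings need a subsequence.
    obtain ⟨⟨wA₀, wB₀⟩, ξ, hξ, hlim⟩ := CompactSpace.tendsto_subseq (fun n => (wA n, wB n))
    have hsub : Tendsto (fun n => ns (θ (ξ n))) atTop atTop :=
      hns.comp (hθ.tendsto_atTop.comp hξ.tendsto_atTop)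
    have hlimA : Tendsto (fun n => wA (ξ n)) atTop (𝓝 wA₀) := (continuous_fst.tendsto _).comp hlim
    have hlimB : Tendsto (fun n => wB (ξ n)) atTop (𝓝 wB₀) := (continuous_snd.tendsto _).comp hlim
    have hs : ∀ n, IsSplit (Q := Q.toSymSeq)
        ⟨TA, (labA (c (ns (θ (ξ n)))).1, wA (ξ n))⟩ ⟨TB, (labB (c (ns (θ (ξ n)))).1, wB (ξ n))⟩
        ⟨T, c (ns (θ (ξ n)))⟩ top bot φA φB := fun n =>
      ⟨hcut, (hlive _).1 (hθl _), ⟨hA, hlA _ _, hwA _⟩, ⟨hB, hlB _ _, hwB _⟩⟩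
    refine ⟨fun n => θ (ξ n), ?_⟩
    have hval : ∀ n, ((fun c : Cell Q.toSymSeq T => decomp (Q := Q) ⟨T, c⟩) ∘ c)
        (ns (θ (ξ n))) = _ := fun n => (hs n).decomp_eq
    simp_rw [hval]
    have hc2 := hwt.comp hsub
    have hA2 := (continuous_subtype_val.tendsto _).comp hlimA
    have hB2 := (continuous_subtype_val.tendsto _).comp hlimB
    have heq : decomp (Q := Q) ⟨T, c₀⟩ = Smash.mk (BarObj.mk ⟨TA, (labA c₀.1, wA₀)⟩)
        (BarObj.mk ⟨TB, (labB c₀.1, wB₀)⟩) := by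
      by_cases hl : IsLive (Q := Q.toSymSeq) ⟨T, c₀⟩
      · exact (isSplit_of_tendsto (cA₀ := (labA c₀.1, wA₀)) (cB₀ := (labB c₀.1, wB₀)) hs
          (hlA c₀ wA₀) (hlB c₀ wB₀) hc2 hA2 hB2 ((hlive c₀).1 hl)).decomp_eq
      · rw [decomp_of_not_isLive hl]
        exact (Smash.mk_eq_pt (mk_eq_pt_of_tendsto (cA₀ := (labA c₀.1, wA₀))
          (cB₀ := (labB c₀.1, wB₀)) hs hc2 hA2 hB2 hl)).symm
    change Tendsto _ atTop (𝓝 (decomp (Q := Q) ⟨T, c₀⟩))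
    rw [heq]
    exact Smash.tendsto_mk
      (tendsto_mk ((hcA.tendsto _).comp (hlab.comp hsub)) hlimA)
      (tendsto_mk ((hcB.tendsto _).comp (hlab.comp hsub)) hlimB)
  · rw [not_frequently] at hfreq
    -- Having non-zero weight on the branch is an open condition, so the limit has none if the terms
    -- eventually have none.
    have hl : ¬ IsLive (Q := Q.toSymSeq) ⟨T, c₀⟩ := by
      rintro ⟨e, he, hne⟩
      have h1 : Tendsto (fun n => (c (ns n)).2.1 e) atTop (𝓝 (c₀.2.1 e)) :=
        (tendsto_pi_nhds.1 hwt e).comp hns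
      have h2 : ∀ᶠ n in atTop, (c (ns n)).2.1 e ≠ 0 := h1.eventually_ne hne
      obtain ⟨n, h3, h4⟩ := (hfreq.and h2).exists
      exact h3 ⟨e, he, h4⟩
    refine ⟨id, ?_⟩
    change Tendsto _ atTop (𝓝 (decomp (Q := Q) ⟨T, c₀⟩))
    rw [decomp_of_not_isLive hl]
    refine tendsto_const_nhds.congr' ?_
    filter_upwards [hfreq] with n hn
    exact (decomp_of_not_isLive hn).symm

end WTree

theorem BarObj.continuous_decomp {Q : AugmentedOperad.{u}} {A B : Type} {a : A} [Finite A]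
    [Finite B] (hQ : Q.StronglyAugmented) :
    Continuous (BarObj.decomp (a := a) (A := A) (B := B) hQ) :=
  continuous_quot_lift _ (continuous_const.sumElim
    (continuous_sigma fun T => WTree.continuous_decomp T))

end OpBar
end

noncomputable section
namespace OpBar
open RTree

namespace WTree

/-! ## Naturality of the decomposition -/

section

variable {Q : SymSeq.{u}} {S S' S'' : Type}

theorem minorEdge_relabel {T' : RTree S'} {T : RTree S} (lam : S' → T.Edge) (φ : T'.V → T.V)
    (g : S' ≃ S'') :
    minorEdge (T'.relabel g) T (lam ∘ g.symm) φ = minorEdge T' T lam φ := by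
  funext e
  rcases e with e | e
  · rfl
  · change lam (g.symm (g (T'.label e))) = lam (T'.label e)
    rw [Equiv.symm_apply_apply]

theorem IsPiece.relabel {q : WTree Q S'} {p : WTree Q S} {lam : S' → p.1.Edge} {bot : p.1.Edge}
    {φ : q.1.V → p.1.V} {f : p.1.Edge → ℝ} (h : IsPiece q p lam bot φ f) (g : S' ≃ S'') :
    IsPiece (q.relabel g) p (lam ∘ g.symm) bot φ f := by
  have key := minorEdge_relabel (T' := q.1) (T := p.1) lam φ g
  refine ⟨⟨?_, ?_, ?_, ?_⟩, fun v => ?_, fun e => ?_⟩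
  · rw [key]; exact h.minor.inj
  · rw [key]; exact h.minor.avoid
  · rw [key]; exact h.minor.parent_none
  · rw [key]; exact h.minor.parent_some
  · rw [key]; exact h.labels v
  · rw [key]; exact h.depth e

theorem IsPiece.of_relabel {q : WTree Q S'} {p : WTree Q S} {g : S ≃ S''} {lam : S' → p.1.Edge}
    {bot : p.1.Edge} {φ : q.1.V → p.1.V} {f : p.1.Edge → ℝ}
    (h : IsPiece q (p.relabel g) lam bot φ f) : IsPiece q p lam bot φ f :=
  ⟨⟨h.minor.inj, h.minor.avoid, h.minor.parent_none, h.minor.parent_some⟩, h.labels, h.depth⟩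

theorem IsPiece.to_relabel {q : WTree Q S'} {p : WTree Q S} {lam : S' → p.1.Edge}
    {bot : p.1.Edge} {φ : q.1.V → p.1.V} {f : p.1.Edge → ℝ} (h : IsPiece q p lam bot φ f)
    (g : S ≃ S'') : IsPiece q (p.relabel g) lam bot φ f :=
  ⟨⟨h.minor.inj, h.minor.avoid, h.minor.parent_none, h.minor.parent_some⟩, h.labels, h.depth⟩

variable {A A' B B' : Type} {a : A}

theorem cutSet_relabel (T : RTree (Graft A a B)) (f : A ≃ A') (g : B ≃ B') :
    (T.relabel (graftCongr f a g)).cutSet = T.cutSet := by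
  ext x
  rw [mem_cutSet, mem_cutSet]
  change (∃ b, graftCongr f a g (T.label x) = Sum.inr b) ↔ _
  rcases T.label x with s | b
  · exact ⟨fun ⟨b, hb⟩ => (Sum.inl_ne_inr hb).elim, fun ⟨b, hb⟩ => (Sum.inl_ne_inr hb).elim⟩
  · exact ⟨fun _ => ⟨b, rfl⟩, fun _ => ⟨g b, rfl⟩⟩

theorem IsSplit.relabel {pA : WTree Q A} {pB : WTree Q B} {p : WTree Q (Graft A a B)}
    {top bot : p.1.Edge} {φA : pA.1.V → p.1.V} {φB : pB.1.V → p.1.V}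
    (h : IsSplit pA pB p top bot φA φB) (f : A ≃ A') (g : B ≃ B') :
    IsSplit (pA.relabel f) (pB.relabel g) (p.relabel (graftCongr f a g)) top bot φA φB := by
  have hc := cutSet_relabel p.1 f g
  have hlow : (p.relabel (graftCongr f a g)).1.lowerLeaf top = p.1.lowerLeaf top ∘ f.symm := by
    funext s
    obtain ⟨s, rfl⟩ := f.surjective s
    rw [Function.comp_apply, Equiv.symm_apply_apply]
    by_cases hs : s = a
    · subst hs
      rw [lowerLeaf_self, lowerLeaf_self]
    · rw [lowerLeaf_of_ne hs, lowerLeaf_of_ne (f.injective.ne hs)]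
      change Sum.inr (p.1.label.symm ((graftCongr f a g).symm (graftCongr f a g
        (Sum.inl ⟨s, hs⟩)))) = _
      rw [Equiv.symm_apply_apply]
      rfl
  have hup : (p.relabel (graftCongr f a g)).1.upperLeaf = p.1.upperLeaf ∘ g.symm := rfl
  refine ⟨?_, h.live, ?_, ?_⟩
  · rw [hc]
    exact ⟨h.cut.leaves_top, h.cut.leaves_bot, h.cut.branch⟩
  · rw [hlow, hc]
    exact (h.lower.relabel f).to_relabel _
  · rw [hup]
    exact (h.upper.relabel g).to_relabel _

theorem isLive_relabel_iff {p : WTree Q (Graft A a B)} (f : A ≃ A') (g : B ≃ B') :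
    IsLive (p.relabel (graftCongr f a g)) ↔ IsLive p := by
  rw [IsLive, cutSet_relabel]
  rfl

end

theorem decomp_relabel {Q : AugmentedOperad.{u}} {A A' B B' : Type} {a : A} [Finite A] [Finite A']
    [Finite B] [Finite B'] (f : A ≃ A') (g : B ≃ B') (p : WTree Q.toSymSeq (Graft A a B)) :
    decomp (p.relabel (graftCongr f a g)) =
      Smash.map (BarObj.map f) (BarObj.map g) p.decomp := by
  by_cases hl : p.IsLive
  · obtain ⟨pA, pB, top, bot, φA, φB, hs⟩ := hl.exists_isSplit
    rw [hs.decomp_eq, (hs.relabel f g).decomp_eq]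
    rfl
  · rw [decomp_of_not_isLive hl, decomp_of_not_isLive (mt (isLive_relabel_iff f g).1 hl)]
    rfl

/-! ## The counit -/

section

variable {Q : AugmentedOperad.{u}} {S : Type} {p p' : WTree Q.toSymSeq S}

/-- The augmentation does not send any label to the base point. -/
def AugNonzero (p : WTree Q.toSymSeq S) : Prop :=
  ∀ v, Q.aug.app _ (p.lab v) ≠ Based.pt

theorem IsIso.augNonzero_iff {φ : p'.1.V ≃ p.1.V} (h : IsIso p' p φ) :
    AugNonzero p' ↔ AugNonzero p :=
  ⟨fun h' v => by
    obtain ⟨u, rfl⟩ := φ.surjective v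
    exact mt (h.labels u).aug_eq_pt_iff.2 (h' u),
  fun h' u => mt (h.labels u).aug_eq_pt_iff.1 (h' _)⟩

theorem IsRemoval.exists_eq {v : p.1.V} {φ : p'.1.V → p.1.V} (h : IsRemoval p' p v φ) {t : p.1.V}
    (ht : t ≠ v) : ∃ u, φ u = t := by
  have : t ∈ Set.range φ := by
    rw [h.range]
    exact ht
  exact this

theorem IsUnstableRemoval.augNonzero_iff {v : p.1.V} {φ : p'.1.V → p.1.V}
    (h : IsUnstableRemoval p' p v φ) (hv : Q.aug.app _ (p.lab v) ≠ Based.pt) :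
    AugNonzero p' ↔ AugNonzero p := by
  have key : ∀ u, Q.aug.app _ (p'.lab u) = Based.pt ↔ Q.aug.app _ (p.lab (φ u)) = Based.pt := by
    intro u
    by_cases hu : p.1.parent (Sum.inl v) = some (φ u)
    · exact (h.label_below u hu).aug_eq_pt_iff
    · exact (h.labels u hu).aug_eq_pt_iff
  refine ⟨fun h' t => ?_, fun h' u => mt (key u).1 (h' _)⟩
  by_cases ht : t = v
  · rw [ht]
    exact hv
  · obtain ⟨u, rfl⟩ := h.exists_eq ht
    exact mt (key u).2 (h' u)

theorem unitOperad_comp_eq_pt_iff {X Y : Type} [Finite X] [Finite Y] (a : X)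
    (x : unitOperad.obj X) (y : unitOperad.obj Y) :
    unitOperad.comp a x y = Based.pt ↔ x = Based.pt ∨ y = Based.pt := by
  have key : ∀ {Z : Type} (z : UnitObj Z), z = Based.pt ↔ z.1 = false :=
    fun z => ⟨fun h => congrArg Subtype.val h, fun h => unitObj_ext h⟩
  exact (key _).trans (Bool.and_eq_false_iff.trans (or_congr (key x).symm (key y).symm))

/-- The augmentation is a map of operads, and a composite in the unit operad is the base point
exactly if one of its two factors is. -/
theorem IsContraction.augNonzero_iff {v : p.1.V} {φ : p'.1.V → p.1.V}
    (h : IsContraction (Q := Q.toOperad) p' p v φ) : AugNonzero p' ↔ AugNonzero p := by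
  have key : ∀ u, p.1.parent (Sum.inl v) = some (φ u) → (Q.aug.app _ (p'.lab u) = Based.pt ↔
      Q.aug.app _ (p.lab (φ u)) = Based.pt ∨ Q.aug.app _ (p.lab v) = Based.pt) := by
    intro u hu
    obtain ⟨σ, -, hσ⟩ := h.label_below u hu
    have h1 := Q.aug.app_comp (⟨Sum.inl v, hu⟩ : p.1.In (φ u)) (p.lab (φ u)) (p.lab v)
    rw [← aug_map_eq_pt_iff Q σ, hσ]
    exact (Eq.congr_left h1).trans (unitOperad_comp_eq_pt_iff _ _ _)
  refine ⟨fun h' t => ?_, fun h' u => ?_⟩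
  · by_cases ht : t = v
    · obtain ⟨s, hs⟩ := Option.ne_none_iff_exists'.1 h.internal
      have hsv : s ≠ v := by
        rintro rfl
        exact not_path_of_parent hs (RTree.Path.refl _)
      obtain ⟨u, rfl⟩ := h.exists_eq hsv
      rw [ht]
      exact fun h0 => h' u ((key u hs).2 (Or.inr h0))
    · obtain ⟨u, rfl⟩ := h.exists_eq ht
      by_cases hu : p.1.parent (Sum.inl v) = some (φ u)
      · exact fun h0 => h' u ((key u hu).2 (Or.inl h0))
      · exact mt (h.labels u hu).aug_eq_pt_iff.2 (h' u)
  · by_cases hu : p.1.parent (Sum.inl v) = some (φ u)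
    · exact fun h0 => ((key u hu).1 h0).elim (h' _) (h' _)
    · exact mt (h.labels u hu).aug_eq_pt_iff.1 (h' _)

theorem aug_unit_ne_pt (Q : AugmentedOperad.{u}) : Q.aug.app Unit Q.unit ≠ Based.pt := by
  rw [Q.aug.app_unit]
  exact fun h => Bool.noConfusion (congrArg Subtype.val h)

end

theorem leavesAbove_of_subsingleton {S : Type} [Subsingleton S] (T : RTree S) (e : T.Edge) :
    T.leavesAbove e = Set.univ := by
  refine Set.eq_univ_of_forall fun x => ?_
  obtain ⟨y, hy⟩ := exists_path_leaf e
  rw [T.label.injective (Subsingleton.elim (T.label x) (T.label y))]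
  exact hy

/-- With at most one label there is a single branch, of total weight `1`. Thus the relation for zero
branches is void in arity one, and the counit need not respect it. -/
theorem branchWeight_ne_zero {Q : SymSeq.{u}} {S : Type} [Subsingleton S] (p : WTree Q S)
    (e : p.1.Edge) : p.1.branchWeight p.wt (p.1.leavesAbove e) ≠ 0 := by
  intro h
  have h0 : ∀ e, p.wt e = 0 := fun e' => (branchWeight_eq_zero_iff p.wt_nonneg _).1 h e' (by
    rw [leavesAbove_of_subsingleton, leavesAbove_of_subsingleton])
  obtain ⟨x, -⟩ := exists_path_leaf e
  have h1 := p.depth_inr x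
  have h2 : (0 : ℝ) = p.depth (Sum.inr x) := by
    refine depth_unique (f := fun _ => 0) (fun e => ?_) (Sum.inr x)
    rw [h0, zero_add]
    cases p.1.parent e <;> rfl
  rw [← h2] at h1
  exact zero_ne_one h1

end WTree

section

variable {Q : AugmentedOperad.{u}}

open Classical in
/-- The counit on labelled weighted trees. -/
def preCounit : PreBar Q.toSymSeq Unit → Bool :=
  Sum.elim (fun _ => false) (fun p => decide (WTree.AugNonzero p))

open Classical in
theorem BarRel.preCounit_eq {x y : PreBar Q.toSymSeq Unit} (h : BarRel Q Unit x y) :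
    preCounit x = preCounit y := by
  cases h with
  | iso p p' φ h => exact decide_eq_decide.2 h.augNonzero_iff.symm
  | label_pt p v h =>
    refine decide_eq_false fun h' => h' v ?_
    rw [h]
    exact (Q.aug.app _).map_pt
  | zero_branch p e he h => exact (p.branchWeight_ne_zero e h).elim
  | contract p p' v φ h h₀ => exact decide_eq_decide.2 h.augNonzero_iff.symm
  | unit p p' v φ h σ h₁ =>
    refine decide_eq_decide.2 (h.augNonzero_iff ?_).symm
    rw [h₁]
    exact mt (aug_map_eq_pt_iff Q σ _).1 (WTree.aug_unit_ne_pt Q)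
  | augment p p' v φ h h₀ h₁ => exact decide_eq_decide.2 (h.augNonzero_iff h₁).symm
  | augment_pt p v hv h₀ h₁ => exact decide_eq_false fun h' => h' v h₁

/-- The counit of the bar construction. -/
def BarObj.counit (Q : AugmentedOperad.{u}) : BasedMap (BarObj Q Unit) Bool where
  toFun := Quot.lift preCounit fun _ _ h => h.preCounit_eq
  continuous_toFun := by
    classical
    refine continuous_quot_lift _ (continuous_const.sumElim (continuous_sigma fun T => ?_))
    have h1 : Continuous fun y : ∀ v : T.V, UnitObj (T.In v) => decide (∀ v, y v ≠ Based.pt) :=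
      continuous_of_discreteTopology
    have h2 : Continuous fun c : (∀ v : T.V, Q.obj (T.In v)) × {w : T.Edge → ℝ // T.IsWeighting w} =>
        decide (∀ v, Q.aug.app _ (c.1 v) ≠ Based.pt) :=
      h1.comp (continuous_pi fun v =>
        (Q.aug.app _).continuous_toFun.comp ((continuous_apply v).comp continuous_fst))
    exact continuous_iff_le_induced.2
      (le_trans (seqCoreflection_le _) (continuous_iff_le_induced.1 h2))
  map_pt := rfl

open Classical in
theorem BarObj.counit_mk_eq_true_iff (p : WTree Q.toSymSeq Unit) :
    BarObj.counit Q (BarObj.mk p) = true ↔ WTree.AugNonzero p := decide_eq_true_iff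

/-- In a tree with one leaf every vertex is unstable, so strong augmentation applies to all labels.
-/
theorem BarObj.exists_lab_eq_pt (hQ : Q.StronglyAugmented) {p : WTree Q.toSymSeq Unit}
    (h : BarObj.counit Q (BarObj.mk p) = false) : ∃ v, p.lab v = Based.pt := by
  by_contra! hcon
  rw [← Bool.not_eq_true, BarObj.counit_mk_eq_true_iff] at h
  refine h fun v => hQ.aug_ne_pt ?_ (hcon v)
  obtain ⟨e, he⟩ := p.1.arity_pos v
  exact unstable_of_leavesAbove_eq he (by
    rw [WTree.leavesAbove_of_subsingleton, WTree.leavesAbove_of_subsingleton])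

theorem BarObj.counit_eq_false_iff (hQ : Q.StronglyAugmented) (x : BarObj Q Unit) :
    BarObj.counit Q x = false ↔ x = Based.pt := by
  constructor
  · induction x using Quot.ind with
    | mk x =>
      rcases x with ⟨⟩ | p
      · exact fun _ => rfl
      · intro h
        obtain ⟨v, hv⟩ := BarObj.exists_lab_eq_pt hQ h
        exact WTree.mk_eq_pt_of_lab hv
  · rintro rfl
    rfl

/-! ## The counit laws -/

namespace WTree

/-- The cut branch is the root branch. Hence `base bot = 0`, the normalisation is trivial, and the
upper tree is `p`. The lower tree consists of copies of vertices of `p`, so if its counit vanishes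
then `p` has a label at the base point. If the branch is zero, `p` has a zero root branch. -/
theorem decomp_counit_left {B : Type} [Finite B] (hQ : Q.StronglyAugmented)
    (p : WTree Q.toSymSeq B) :
    Smash.leftUnitor (Smash.map (BarObj.counit Q) (BasedMap.id _)
      (decomp (p.relabel (graftLeft B)))) = BarObj.mk p := by
  have hcs : (p.relabel (graftLeft B)).1.cutSet = Set.univ :=
    Set.eq_univ_of_forall fun x => ⟨p.1.label x, rfl⟩
  by_cases hl : IsLive (p.relabel (graftLeft B))
  · obtain ⟨pA, pB, top, bot, φA, φB, hs⟩ := hl.exists_isSplit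
    rw [hs.decomp_eq]
    change (match BarObj.counit Q (BarObj.mk pA) with
      | true => BarObj.mk pB
      | false => Based.pt) = _
    cases hc : BarObj.counit Q (BarObj.mk pA) with
    | false =>
      obtain ⟨v, hv⟩ := BarObj.exists_lab_eq_pt hQ hc
      exact (mk_eq_pt_of_lab (p := p) ((hs.lower.labels v).lab_eq_pt_iff.1 hv)).symm
    | true =>
      have hbot : bot = p.1.root :=
        eq_root_of_path (hs.cut.branch p.1.root (by rw [hcs]; exact leavesAbove_root)).2
      refine IsPiece.mk_eq (p := p) hs.upper.of_relabel (isPiece_self p) rfl hbot fun e _ => ?_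
      have h0 : p.base bot = 0 := base_of_parent_none (hbot ▸ parent_root _)
      change (p.depth e - p.base bot) / (1 - p.base bot) = p.depth e
      rw [h0, sub_zero, sub_zero, div_one]
  · rw [decomp_of_not_isLive hl]
    refine (Quot.sound (BarRel.zero_branch p p.1.root (Or.inl (parent_root _)) ?_)).symm
    refine (branchWeight_eq_zero_iff p.wt_nonneg _).2 fun e he => ?_
    by_contra hne
    exact hl ⟨e, by rw [hcs]; exact he.trans leavesAbove_root, hne⟩

/-- Dually, the cut branch is that of the leaf `a`. Its top has depth `1`, so the scaling factor of
the lower tree is `1`. -/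
theorem decomp_counit_right {A : Type} [Finite A] (hQ : Q.StronglyAugmented) (a : A)
    (p : WTree Q.toSymSeq A) :
    Smash.rightUnitor (Smash.map (BasedMap.id _) (BarObj.counit Q)
      (decomp (p.relabel (graftRight A a)))) = BarObj.mk p := by
  have hcs : (p.relabel (graftRight A a)).1.cutSet = p.1.leavesAbove (p.1.leaf a) := by
    rw [leaf, leavesAbove_inr]
    ext x
    rw [mem_cutSet, Set.mem_singleton_iff, Equiv.eq_symm_apply]
    change (∃ b, graftRight A a (p.1.label x) = Sum.inr b) ↔ _
    constructor
    · rintro ⟨b, hb⟩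
      exact ((Equiv.symm_apply_eq _).2 hb.symm).symm
    · intro hx
      exact ⟨(), (Equiv.eq_symm_apply _).1 hx⟩
  by_cases hl : IsLive (p.relabel (graftRight A a))
  · obtain ⟨pA, pB, top, bot, φA, φB, hs⟩ := hl.exists_isSplit
    rw [hs.decomp_eq]
    change (match BarObj.counit Q (BarObj.mk pB) with
      | true => BarObj.mk pA
      | false => Based.pt) = _
    cases hc : BarObj.counit Q (BarObj.mk pB) with
    | false =>
      obtain ⟨v, hv⟩ := BarObj.exists_lab_eq_pt hQ hc
      exact (mk_eq_pt_of_lab (p := p) ((hs.upper.labels v).lab_eq_pt_iff.1 hv)).symm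
    | true =>
      have htop : top = p.1.leaf a :=
        path_inr (hs.cut.branch (p.1.leaf a) (by rw [hcs]; rfl)).1
      have h1 : p.depth top = 1 := by rw [htop]; exact p.depth_inr _
      have hlt : p.base bot < 1 := h1 ▸ hs.live
      refine IsPiece.mk_eq (p := p) hs.lower.of_relabel (isPiece_self p) ?_ rfl fun e _ => ?_
      · funext s
        by_cases h : s = a
        · rw [h, lowerLeaf_self, htop]
        · rw [lowerLeaf_of_ne h]
          rfl
      · rw [lowerDepth]
        split_ifs
        · change p.base bot + (1 - p.base bot) / (p.depth top - p.base bot) *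
            (p.depth e - p.base bot) = p.depth e
          rw [h1, div_self (by linarith)]
          ring
        · rfl
  · rw [decomp_of_not_isLive hl]
    refine (Quot.sound (BarRel.zero_branch p (p.1.leaf a) (Or.inr ⟨_, rfl⟩) ?_)).symm
    refine (branchWeight_eq_zero_iff p.wt_nonneg _).2 fun e he => ?_
    by_contra hne
    exact hl ⟨e, by rw [hcs]; exact he, hne⟩

end WTree

end

end OpBar
end

noncomputable section
namespace OpBar
open RTree

namespace RTree

theorem IsCut.relabel {S S' : Type} {T : RTree S} {Y : Set T.L} {top bot : T.Edge}
    (h : T.IsCut Y top bot) (f : S ≃ S') : (T.relabel f).IsCut Y top bot :=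
  ⟨h.leaves_top, h.leaves_bot, h.branch⟩

theorem IsCut.of_relabel {S S' : Type} {T : RTree S} {Y : Set T.L} {top bot : T.Edge}
    {f : S ≃ S'} (h : (T.relabel f).IsCut Y top bot) : T.IsCut Y top bot :=
  ⟨h.leaves_top, h.leaves_bot, h.branch⟩

theorem IsCut.leavesAbove_below_ne {S : Type} {T : RTree S} {Y : Set T.L} {top bot : T.Edge}
    (h : T.IsCut Y top bot) {v : T.V} (hv : T.parent bot = some v) :
    Y ⊆ T.leavesAbove (Sum.inl v) ∧ T.leavesAbove (Sum.inl v) ≠ Y :=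
  ⟨h.leaves_bot ▸ leavesAbove_mono (Path.of_parent hv), fun heq =>
    not_path_of_parent hv (h.branch _ heq).2⟩

end RTree

namespace WTree

/-! ## Iterated decompositions -/

section

variable {Q : SymSeq.{u}} {A B D : Type} {a : A}

section

variable {p : WTree Q (Graft A a D)} {pA : WTree Q A} {pD : WTree Q D} {top bot : p.1.Edge}
  {φA : pA.1.V → p.1.V} {φD : pD.1.V → p.1.V} {Z : Set p.1.L}

/-- The condition `hZD` says that the branch of `Z` is not strictly above the cut branch. Then all
its edges are in the lower tree, and its ends can be computed there. -/
theorem IsSplit.lower_isCut (h : IsSplit pA pD p top bot φA φD) {Z' : Set pA.1.L}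
    (hZ : ∀ e, pA.1.leavesAbove e = Z' ↔
      p.1.leavesAbove (minorEdge pA.1 p.1 (p.1.lowerLeaf top) φA e) = Z)
    (hZD : Z ⊆ p.1.cutSet → Z = p.1.cutSet) {t b : pA.1.Edge} (hc : pA.1.IsCut Z' t b) :
    p.1.IsCut Z (minorEdge pA.1 p.1 (p.1.lowerLeaf top) φA t)
      (minorEdge pA.1 p.1 (p.1.lowerLeaf top) φA b) :=
  h.lower.minor.isCut_of_isCut hZ
    (fun _ he => (h.cut.mem_range_lower_iff h.lower.minor).2 (he ▸ hZD)) hc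

/-- Rescaling affects depths only from the lower end of the cut branch upwards, and the edge below
the branch of `Z` is not on the cut branch. -/
theorem IsSplit.base_lower (h : IsSplit pA pD p top bot φA φD)
    (hZD : Z ⊆ p.1.cutSet → Z = p.1.cutSet) {t : p.1.Edge} {b : pA.1.Edge}
    (hc : p.1.IsCut Z t (minorEdge pA.1 p.1 (p.1.lowerLeaf top) φA b)) :
    pA.base b = p.base (minorEdge pA.1 p.1 (p.1.lowerLeaf top) φA b) := by
  cases hp : pA.1.parent b with
  | none =>
    have hr := h.lower.minor.parent_none_piece.1 hp
    rw [base, base, base_of_parent_none hp, base_of_parent_none (by rw [hr, parent_root])]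
  | some v =>
    have hp' := h.lower.minor.parent_some_piece hp
    rw [base, base, base_of_parent hp, base_of_parent hp']
    refine (h.lower.depth (Sum.inl v)).trans (lowerDepth_of_ne fun heq => ?_)
    obtain ⟨h1, h2⟩ := hc.leavesAbove_below_ne hp'
    change p.1.leavesAbove (Sum.inl (φA v)) = _ at heq
    exact h2 (heq.trans (hZD (heq ▸ h1)).symm)

theorem IsSplit.wt_lower_eq_zero_iff (h : IsSplit pA pD p top bot φA φD) (e : pA.1.Edge) :
    pA.wt e = 0 ↔ p.wt (minorEdge pA.1 p.1 (p.1.lowerLeaf top) φA e) = 0 := by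
  classical
  refine ⟨fun h0 => ?_, fun h0 => by rw [h.wt_lower, h0, mul_zero, ite_self]⟩
  rw [h.wt_lower] at h0
  have h1 := base_lt_one h.live
  split_ifs at h0
  · exact (mul_eq_zero.1 h0).resolve_left
      (div_pos (sub_pos.2 h1) (sub_pos.2 h.live)).ne'
  · exact h0

theorem IsSplit.wt_upper_eq_zero_iff (h : IsSplit pA pD p top bot φA φD) (e : pD.1.Edge) :
    pD.wt e = 0 ↔ p.wt (minorEdge pD.1 p.1 p.1.upperLeaf φD e) = 0 := by
  refine ⟨fun h0 => ?_, fun h0 => by rw [h.wt_upper, h0, mul_zero]⟩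
  rw [h.wt_upper] at h0
  exact (mul_eq_zero.1 h0).resolve_left (one_div_pos.2 (sub_pos.2 (base_lt_one h.live))).ne'

/-- The depth of the edges of the part of the lower tree of a degrafting that lies below a further
degrafting. -/
theorem IsSplit.lowerDepth_lower (h : IsSplit pA pD p top bot φA φD) {Z' : Set pA.1.L}
    (hZ : ∀ e, pA.1.leavesAbove e = Z' ↔
      p.1.leavesAbove (minorEdge pA.1 p.1 (p.1.lowerLeaf top) φA e) = Z)
    (hZD : Z ⊆ p.1.cutSet → Z = p.1.cutSet) {t b : pA.1.Edge} (hc : pA.1.IsCut Z' t b)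
    {e : pA.1.Edge} (he : pA.1.leavesAbove e = Z') :
    pA.1.lowerDepth pA.wt Z' t b e =
      p.1.lowerDepth p.wt Z (minorEdge pA.1 p.1 (p.1.lowerLeaf top) φA t)
        (minorEdge pA.1 p.1 (p.1.lowerLeaf top) φA b)
        (minorEdge pA.1 p.1 (p.1.lowerLeaf top) φA e) := by
  have hc' := h.lower_isCut hZ hZD hc
  have hb : pA.1.base pA.wt b = _ := h.base_lower hZD hc'
  have hte : pA.1.depth pA.wt t = _ := h.lower.depth t
  have hde : pA.1.depth pA.wt e = _ := h.lower.depth e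
  rw [lowerDepth_of_mid he, lowerDepth_of_mid ((hZ e).1 he), hb, hte, hde]
  -- The two cuts may be made at the same branch. After the first one its top already has depth `1`,
  -- so the second scaling is the identity.
  by_cases hZc : Z = p.1.cutSet
  · subst hZc
    obtain ⟨ht', hb'⟩ := hc'.unique h.cut
    have h1 := base_lt_one h.live
    have h2 := h.live
    rw [lowerDepth_of_mid ((hZ e).1 he), lowerDepth_of_mid hc'.leaves_top, ht', hb']
    have h3 : p.1.depth p.wt top - p.1.base p.wt bot ≠ 0 := (sub_pos.2 h2).ne'
    have h4 : 1 - p.1.base p.wt bot ≠ 0 := (sub_pos.2 h1).ne'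
    rw [div_mul_cancel₀ _ h3, add_sub_cancel, add_sub_cancel_left, div_self h4, one_mul]
  · rw [lowerDepth_of_ne (by rw [hc'.leaves_top]; exact hZc),
      lowerDepth_of_ne (by rw [(hZ e).1 he]; exact hZc)]

end

section

variable {a₁ : Graft A a B} {p : WTree Q (Graft (Graft A a B) a₁ D)} {p₁ : WTree Q (Graft A a B)}
  {pD : WTree Q D} {tD bD : p.1.Edge} {φ₁ : p₁.1.V → p.1.V} {φD : pD.1.V → p.1.V}
  {pA : WTree Q A} {pB : WTree Q B} {t₁ b₁ : p₁.1.Edge} {φA : pA.1.V → p₁.1.V}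
  {φB : pB.1.V → p₁.1.V} {Z : Set p.1.L}

theorem IsSplit.lower_cutSet_iff (h : IsSplit p₁ pD p tD bD φ₁ φD)
    (hZZ : ∀ x x', p.1.Path (Sum.inr x) (p.1.lowerLeaf tD (p₁.1.label x')) →
      (x ∈ Z ↔ x' ∈ p₁.1.cutSet)) (e : p₁.1.Edge) :
    p₁.1.leavesAbove e = p₁.1.cutSet ↔
      p.1.leavesAbove (minorEdge p₁.1 p.1 (p.1.lowerLeaf tD) φ₁ e) = Z :=
  h.lower.minor.leavesAbove_iff (fun x _ => h.cut.lowerLeaf_cover x) (fun _ _ => path_root _) hZZ e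

theorem IsSplit.exists_of_lower_isLive (h : IsSplit p₁ pD p tD bD φ₁ φD)
    (hZZ : ∀ x x', p.1.Path (Sum.inr x) (p.1.lowerLeaf tD (p₁.1.label x')) →
      (x ∈ Z ↔ x' ∈ p₁.1.cutSet)) (hl : p₁.IsLive) : ∃ e, p.1.leavesAbove e = Z ∧ p.wt e ≠ 0 := by
  obtain ⟨e, he, hne⟩ := hl
  exact ⟨_, (h.lower_cutSet_iff hZZ e).1 he, mt (h.wt_lower_eq_zero_iff e).2 hne⟩

theorem IsSplit.lower_isLive (h : IsSplit p₁ pD p tD bD φ₁ φD)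
    (hZZ : ∀ x x', p.1.Path (Sum.inr x) (p.1.lowerLeaf tD (p₁.1.label x')) →
      (x ∈ Z ↔ x' ∈ p₁.1.cutSet)) (hZD : Z ⊆ p.1.cutSet → Z = p.1.cutSet)
    (hl : ∃ e, p.1.leavesAbove e = Z ∧ p.wt e ≠ 0) : p₁.IsLive := by
  obtain ⟨e, he, hne⟩ := hl
  obtain ⟨e, rfl⟩ := (h.cut.mem_range_lower_iff h.lower.minor).2 (he ▸ hZD)
  exact ⟨e, (h.lower_cutSet_iff hZZ e).2 he, mt (h.wt_lower_eq_zero_iff e).1 hne⟩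

open Classical in
theorem IsSplit.lower_lower (h : IsSplit p₁ pD p tD bD φ₁ φD)
    (hZZ : ∀ x x', p.1.Path (Sum.inr x) (p.1.lowerLeaf tD (p₁.1.label x')) →
      (x ∈ Z ↔ x' ∈ p₁.1.cutSet)) (hZD : Z ⊆ p.1.cutSet → Z = p.1.cutSet)
    (h₁ : IsSplit pA pB p₁ t₁ b₁ φA φB) :
    IsPiece pA p (minorEdge p₁.1 p.1 (p.1.lowerLeaf tD) φ₁ ∘ p₁.1.lowerLeaf t₁) p.1.root (φ₁ ∘ φA)
      (fun e => if p.1.leavesAbove e = Z then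
        p.1.lowerDepth p.wt Z (minorEdge p₁.1 p.1 (p.1.lowerLeaf tD) φ₁ t₁)
          (minorEdge p₁.1 p.1 (p.1.lowerLeaf tD) φ₁ b₁) e
        else p.1.lowerDepth p.wt p.1.cutSet tD bD e) := by
  have hZ := h.lower_cutSet_iff hZZ
  refine h₁.lower.comp h.lower h.lower.minor.map_root fun e _ => ?_
  by_cases he : p₁.1.leavesAbove e = p₁.1.cutSet
  · rw [if_pos ((hZ e).1 he), h.lowerDepth_lower hZ hZD h₁.cut he]
  · rw [if_neg (mt (hZ e).2 he), lowerDepth_of_ne he]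
    exact h.lower.depth e

theorem IsSplit.lower_upper (h : IsSplit p₁ pD p tD bD φ₁ φD)
    (hZZ : ∀ x x', p.1.Path (Sum.inr x) (p.1.lowerLeaf tD (p₁.1.label x')) →
      (x ∈ Z ↔ x' ∈ p₁.1.cutSet)) (hZD : Z ⊆ p.1.cutSet → Z = p.1.cutSet)
    (h₁ : IsSplit pA pB p₁ t₁ b₁ φA φB) :
    IsPiece pB p (minorEdge p₁.1 p.1 (p.1.lowerLeaf tD) φ₁ ∘ p₁.1.upperLeaf)
      (minorEdge p₁.1 p.1 (p.1.lowerLeaf tD) φ₁ b₁) (φ₁ ∘ φB)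
      (fun e => (p.1.lowerDepth p.wt p.1.cutSet tD bD e -
        p.base (minorEdge p₁.1 p.1 (p.1.lowerLeaf tD) φ₁ b₁)) /
        (1 - p.base (minorEdge p₁.1 p.1 (p.1.lowerLeaf tD) φ₁ b₁))) := by
  have hb : p₁.1.base p₁.wt b₁ = _ :=
    h.base_lower hZD (h.lower_isCut (h.lower_cutSet_iff hZZ) hZD h₁.cut)
  have hd : ∀ e, p₁.1.depth p₁.wt e = _ := h.lower.depth
  refine h₁.upper.comp h.lower rfl fun e _ => ?_
  rw [upperDepth, hb, hd]

end

section

variable {b : B} {p : WTree Q (Graft A a (Graft B b D))} {pA : WTree Q A}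
  {p₂ : WTree Q (Graft B b D)} {t₀ b₀ : p.1.Edge} {φA : pA.1.V → p.1.V} {φ₂ : p₂.1.V → p.1.V}
  {pB : WTree Q B} {pD : WTree Q D} {t₂ b₂ : p₂.1.Edge} {φB : pB.1.V → p₂.1.V}
  {φD : pD.1.V → p₂.1.V}

theorem cutSet_relabel_graftAssoc (T : RTree (Graft A a (Graft B b D))) :
    (T.relabel (graftAssoc A a B b D)).cutSet = {x | ∃ d, T.label x = Sum.inr (Sum.inr d)} := by
  ext x
  rw [mem_cutSet, Set.mem_ofPred_eq]
  change (∃ d, graftAssoc A a B b D (T.label x) = _) ↔ _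
  rcases T.label x with s | s | d
  · exact ⟨fun ⟨_, h⟩ => (Sum.inl_ne_inr h).elim, fun ⟨_, h⟩ => (Sum.inl_ne_inr h).elim⟩
  · exact ⟨fun ⟨_, h⟩ => (Sum.inl_ne_inr h).elim,
      fun ⟨_, h⟩ => (Sum.inl_ne_inr (Sum.inr_injective h)).elim⟩
  · exact ⟨fun _ => ⟨d, rfl⟩, fun _ => ⟨d, rfl⟩⟩

theorem cutSet_relabel_graftAssoc_subset (T : RTree (Graft A a (Graft B b D))) :
    (T.relabel (graftAssoc A a B b D)).cutSet ⊆ T.cutSet := by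
  rw [cutSet_relabel_graftAssoc]
  exact fun x ⟨d, hd⟩ => ⟨_, hd⟩

theorem IsSplit.upper_cutSet_iff (h : IsSplit pA p₂ p t₀ b₀ φA φ₂) (e : p₂.1.Edge) :
    p₂.1.leavesAbove e = p₂.1.cutSet ↔ p.1.leavesAbove (minorEdge p₂.1 p.1 p.1.upperLeaf φ₂ e) =
      (p.1.relabel (graftAssoc A a B b D)).cutSet := by
  refine h.upper.minor.leavesAbove_iff h.cut.upperLeaf_cover (fun x hx => ?_) (fun x x' hx => ?_) e
  · have h1 : x ∈ p.1.leavesAbove b₀ := by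
      rw [h.cut.leaves_bot]
      exact cutSet_relabel_graftAssoc_subset p.1 hx
    exact h1
  · have h1 : x = p.1.label.symm (Sum.inr (p₂.1.label x')) := Sum.inr_injective (path_inr hx)
    rw [cutSet_relabel_graftAssoc, Set.mem_ofPred_eq, h1, Equiv.apply_symm_apply, mem_cutSet]
    exact exists_congr fun d => Sum.inr_injective.eq_iff

theorem IsSplit.mem_range_upper (h : IsSplit pA p₂ p t₀ b₀ φA φ₂) {e : p.1.Edge}
    (he : p.1.leavesAbove e = (p.1.relabel (graftAssoc A a B b D)).cutSet) :
    e ∈ Set.range (minorEdge p₂.1 p.1 p.1.upperLeaf φ₂) :=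
  (h.cut.mem_range_upper_iff h.upper.minor).2
    (he.subset.trans (cutSet_relabel_graftAssoc_subset p.1))

theorem IsSplit.upper_isLive_iff (h : IsSplit pA p₂ p t₀ b₀ φA φ₂) :
    p₂.IsLive ↔ IsLive (p.relabel (graftAssoc A a B b D)) := by
  constructor
  · rintro ⟨e, he, hne⟩
    exact ⟨_, (h.upper_cutSet_iff e).1 he, mt (h.wt_upper_eq_zero_iff e).2 hne⟩
  · rintro ⟨e, he, hne⟩
    obtain ⟨e, rfl⟩ := h.mem_range_upper he
    exact ⟨e, (h.upper_cutSet_iff e).2 he, mt (h.wt_upper_eq_zero_iff e).1 hne⟩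

theorem IsSplit.upper_isCut (h : IsSplit pA p₂ p t₀ b₀ φA φ₂) (hc : p₂.1.IsCut p₂.1.cutSet t₂ b₂) :
    p.1.IsCut (p.1.relabel (graftAssoc A a B b D)).cutSet
      (minorEdge p₂.1 p.1 p.1.upperLeaf φ₂ t₂) (minorEdge p₂.1 p.1 p.1.upperLeaf φ₂ b₂) :=
  h.upper.minor.isCut_of_isCut h.upper_cutSet_iff (fun _ he => h.mem_range_upper he) hc

theorem IsSplit.base_upper (h : IsSplit pA p₂ p t₀ b₀ φA φ₂) (e : p₂.1.Edge) :
    p₂.base e = (p.base (minorEdge p₂.1 p.1 p.1.upperLeaf φ₂ e) - p.base b₀) / (1 - p.base b₀) := by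
  by_cases he : minorEdge p₂.1 p.1 p.1.upperLeaf φ₂ e = b₀
  · rw [h.upper.base_of_eq_bot he, he, sub_self, zero_div]
  · obtain ⟨v, hv, hb⟩ := h.upper.base he
    rw [hb]
    simp only [base, base_of_parent hv]
    rfl

/-- Both steps are affine normalisations fixing the value `1`. Their composite is the one that sends
the base of the higher cut to `0`. -/
theorem IsSplit.upper_upper (h : IsSplit pA p₂ p t₀ b₀ φA φ₂) (h₂ : IsSplit pB pD p₂ t₂ b₂ φB φD) :
    IsPiece pD p (minorEdge p₂.1 p.1 p.1.upperLeaf φ₂ ∘ p₂.1.upperLeaf)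
      (minorEdge p₂.1 p.1 p.1.upperLeaf φ₂ b₂) (φ₂ ∘ φD)
      (p.1.upperDepth p.wt (minorEdge p₂.1 p.1 p.1.upperLeaf φ₂ b₂)) := by
  refine h₂.upper.comp h.upper rfl fun e _ => ?_
  have hb : p₂.1.base p₂.wt b₂ = _ := h.base_upper b₂
  have hd : p₂.1.depth p₂.wt e = _ := h.upper.depth e
  have h1 := base_lt_one h₂.live
  rw [base, hb, div_lt_one (sub_pos.2 (base_lt_one h.live))] at h1
  rw [upperDepth, hb, hd, upperDepth, upperDepth]
  have h2 : 1 - p.base b₀ ≠ 0 := (sub_pos.2 (base_lt_one h.live)).ne'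
  have h3 : 1 - p.base (minorEdge p₂.1 p.1 p.1.upperLeaf φ₂ b₂) ≠ 0 := by
    intro h0
    linarith
  have h4 : p.base (minorEdge p₂.1 p.1 p.1.upperLeaf φ₂ b₂) =
    p.1.base p.wt (minorEdge p₂.1 p.1 p.1.upperLeaf φ₂ b₂) := rfl
  have h5 : p.base b₀ = p.1.base p.wt b₀ := rfl
  rw [h5] at h2 ⊢
  rw [h4] at h3 ⊢
  rw [div_sub_div_same, one_sub_div h2, div_div_div_cancel_right₀ h2]
  congr 1 <;> ring

/-- Rescaling a branch so that its top gets depth `1` commutes with an affine normalisation that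
fixes `1`. -/
theorem IsSplit.upper_lower (h : IsSplit pA p₂ p t₀ b₀ φA φ₂) (h₂ : IsSplit pB pD p₂ t₂ b₂ φB φD) :
    IsPiece pB p (minorEdge p₂.1 p.1 p.1.upperLeaf φ₂ ∘ p₂.1.lowerLeaf t₂) b₀ (φ₂ ∘ φB)
      (fun e => (p.1.lowerDepth p.wt (p.1.relabel (graftAssoc A a B b D)).cutSet
        (minorEdge p₂.1 p.1 p.1.upperLeaf φ₂ t₂) (minorEdge p₂.1 p.1 p.1.upperLeaf φ₂ b₂) e -
        p.base b₀) / (1 - p.base b₀)) := by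
  refine h₂.lower.comp h.upper h.upper.minor.map_root fun e _ => ?_
  have hb : p₂.1.base p₂.wt b₂ = _ := h.base_upper b₂
  have hd : ∀ e, p₂.1.depth p₂.wt e = _ := h.upper.depth
  by_cases he : p₂.1.leavesAbove e = p₂.1.cutSet
  · have hl := h₂.live
    rw [depth, base, hb, hd, upperDepth,
      div_lt_div_iff_of_pos_right (sub_pos.2 (base_lt_one h.live))] at hl
    rw [lowerDepth_of_mid he, lowerDepth_of_mid ((h.upper_cutSet_iff e).1 he), hb, hd, hd,
      upperDepth, upperDepth]
    have h2 : 1 - p.1.base p.wt b₀ ≠ 0 := (sub_pos.2 (base_lt_one h.live)).ne'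
    have h3 : p.1.depth p.wt (minorEdge p₂.1 p.1 p.1.upperLeaf φ₂ t₂) -
      p.1.base p.wt (minorEdge p₂.1 p.1 p.1.upperLeaf φ₂ b₂) ≠ 0 := by
      intro h0
      linarith
    simp only [base]
    rw [div_sub_div_same, div_sub_div_same, one_sub_div h2, div_div_div_cancel_right₀ h2]
    rw [sub_sub_sub_cancel_right, sub_sub_sub_cancel_right, sub_sub_sub_cancel_right]
    field_simp
    ring
  · rw [lowerDepth_of_ne he, lowerDepth_of_ne (mt (h.upper_cutSet_iff e).2 he)]
    exact hd e

end

end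

end WTree
end OpBar
end

noncomputable section
namespace OpBar
open RTree

/-- The decomposition of the bar construction as a based map. -/
def BarObj.decompMap {Q : AugmentedOperad.{u}} (hQ : Q.StronglyAugmented) (A : Type) [Finite A]
    (a : A) (B : Type) [Finite B] :
    BasedMap (BarObj Q (Graft A a B)) (Smash (BarObj Q A) (BarObj Q B)) :=
  ⟨BarObj.decomp hQ, BarObj.continuous_decomp hQ, rfl⟩

namespace WTree

/-! ## Coassociativity -/

section

variable {A B D : Type} {a : A} {b : B}

/-- The leaf `b` of `p₁` stands for all leaves with label in `D`, which belong to the lower cut as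
well. -/
theorem IsSplit.mem_cutSet_graftAssoc_iff {Q : SymSeq.{u}} {p : WTree Q (Graft A a (Graft B b D))}
    {p₁ : WTree Q (Graft A a B)} {pD : WTree Q D} {tD bD : p.1.Edge} {φ₁ : p₁.1.V → p.1.V}
    {φD : pD.1.V → p.1.V} (h : IsSplit p₁ pD (p.relabel (graftAssoc A a B b D)) tD bD φ₁ φD)
    (x : p.1.L) (x' : p₁.1.L)
    (hx : p.1.Path (Sum.inr x)
      ((p.1.relabel (graftAssoc A a B b D)).lowerLeaf tD (p₁.1.label x'))) :
    x ∈ p.1.cutSet ↔ x' ∈ p₁.1.cutSet := by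
  rw [mem_cutSet, mem_cutSet]
  by_cases hb : p₁.1.label x' = Sum.inr b
  · rw [hb, lowerLeaf_self] at hx
    have h1 : x ∈ (p.1.relabel (graftAssoc A a B b D)).cutSet := by
      rw [← h.cut.leaves_top]
      exact hx
    exact ⟨fun _ => ⟨b, hb⟩, fun _ => cutSet_relabel_graftAssoc_subset p.1 h1⟩
  · rw [lowerLeaf_of_ne hb] at hx
    have h1 : x = p.1.label.symm ((graftAssoc A a B b D).symm (Sum.inl ⟨p₁.1.label x', hb⟩)) :=
      Sum.inr_injective (path_inr hx)
    rw [h1, Equiv.apply_symm_apply]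
    clear hx h1
    generalize p₁.1.label x' = s at hb ⊢
    rcases s with s | y
    · exact ⟨fun ⟨_, h⟩ => (Sum.inl_ne_inr h).elim, fun ⟨_, h⟩ => (Sum.inl_ne_inr h).elim⟩
    · exact ⟨fun _ => ⟨y, rfl⟩, fun _ => ⟨_, rfl⟩⟩

variable {Q : AugmentedOperad.{u}} [Finite A] [Finite B] [Finite D]

/-- Two branches are involved, the one carrying the leaves of `D` and the one carrying those of `B`
and `D`. Both sides are the base point unless both branches are non-zero. In that case the trees
over `A`, `B` and `D` on the two sides are pieces of `p` with the same ends and depths. -/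
theorem decomp_coassoc (hQ : Q.StronglyAugmented)
    (p : WTree Q.toSymSeq (Graft A a (Graft B b D))) :
    Smash.assoc (Smash.map (BarObj.decompMap hQ A a B) (BasedMap.id _)
        (decomp (p.relabel (graftAssoc A a B b D)))) =
      Smash.map (BasedMap.id _) (BarObj.decompMap hQ B b D) p.decomp := by
  have hsub := cutSet_relabel_graftAssoc_subset p.1
  have hZD : p.1.cutSet ⊆ (p.1.relabel (graftAssoc A a B b D)).cutSet →
    p.1.cutSet = (p.1.relabel (graftAssoc A a B b D)).cutSet := fun h => h.antisymm hsub
  by_cases hl : IsLive (p.relabel (graftAssoc A a B b D))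
  swap
  · rw [decomp_of_not_isLive hl]
    by_cases hl' : p.IsLive
    · obtain ⟨pA', p₂, t, b₀, φA', φ₂, hs'⟩ := hl'.exists_isSplit
      rw [hs'.decomp_eq]
      exact (Smash.mk_eq_pt (Or.inr (decomp_of_not_isLive (mt hs'.upper_isLive_iff.1 hl)))).symm
    · rw [decomp_of_not_isLive hl']
      rfl
  obtain ⟨p₁, pD, tD, bD, φ₁, φD, hs⟩ := hl.exists_isSplit
  have hZZ := hs.mem_cutSet_graftAssoc_iff
  rw [hs.decomp_eq]
  change Smash.assoc (Smash.mk p₁.decomp (BarObj.mk pD)) = _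
  by_cases hl' : p.IsLive
  swap
  · rw [decomp_of_not_isLive hl', decomp_of_not_isLive (mt (hs.exists_of_lower_isLive hZZ) hl')]
    exact Smash.mk_pt_left _
  obtain ⟨pA', p₂, t, b₀, φA', φ₂, hs'⟩ := hl'.exists_isSplit
  obtain ⟨pA, pB, t₁, b₁, φA, φB, hs₁⟩ := (hs.lower_isLive hZZ hZD hl').exists_isSplit
  obtain ⟨pB', pD', t₂, b₂, φB', φD', hs₂⟩ := (hs'.upper_isLive_iff.2 hl).exists_isSplit
  rw [hs'.decomp_eq, hs₁.decomp_eq]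
  change Smash.mk (BarObj.mk pA) (Smash.mk (BarObj.mk pB) (BarObj.mk pD)) =
    Smash.mk (BarObj.mk pA') p₂.decomp
  rw [hs₂.decomp_eq]
  obtain ⟨ht, hb⟩ := (hs.lower_isCut (hs.lower_cutSet_iff hZZ) hZD hs₁.cut).of_relabel.unique hs'.cut
  obtain ⟨ht₂, hb₂⟩ := (hs'.upper_isCut hs₂.cut).unique hs.cut.of_relabel
  have hA : BarObj.mk pA = BarObj.mk pA' := by
    refine (hs.lower_lower hZZ hZD hs₁).of_relabel.mk_eq hs'.lower ?_ rfl fun e he => ?_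
    · funext s
      by_cases h : s = a
      · subst h
        rw [Function.comp_apply, lowerLeaf_self, lowerLeaf_self]
        exact ht
      · rw [Function.comp_apply, lowerLeaf_of_ne h, lowerLeaf_of_ne h, minorEdge_leaf,
          lowerLeaf_of_ne Sum.inl_ne_inr]
        rfl
    · have he' := (hs'.cut.mem_range_lower_iff hs'.lower.minor).1 he
      by_cases hm : p.1.leavesAbove e = p.1.cutSet
      · rw [← ht, ← hb]
        exact if_pos hm
      -- An edge over `A` that is off the outer branch is also off the inner one: its leaves would
      -- lie in the cut set, which for edges of the lower tree happens only on the outer branch.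
      · rw [lowerDepth_of_ne hm]
        exact (if_neg hm).trans (lowerDepth_of_ne fun hm' => hm (he' (hm'.subset.trans hsub)))
  have hB : BarObj.mk pB = BarObj.mk pB' := by
    refine (hs.lower_upper hZZ hZD hs₁).of_relabel.mk_eq (hs'.upper_lower hs₂) ?_ hb fun e _ => ?_
    · funext y
      rw [Function.comp_apply, Function.comp_apply, upperLeaf, minorEdge_leaf]
      by_cases h : y = b
      · subst h
        rw [lowerLeaf_self, lowerLeaf_self, ht₂]
      · rw [lowerLeaf_of_ne h, minorEdge_leaf,
          lowerLeaf_of_ne fun h' => h (Sum.inr_injective h')]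
        rfl
    · rw [ht₂, hb₂, ← hb]
      rfl
  have hD : BarObj.mk pD = BarObj.mk pD' := by
    refine hs.upper.of_relabel.mk_eq (hs'.upper_upper hs₂) ?_ hb₂.symm fun e _ => ?_
    · funext d
      rw [Function.comp_apply, upperLeaf, upperLeaf, minorEdge_leaf]
      rfl
    · rw [hb₂]
      rfl
  rw [hA, hB, hD]

end

/-! ## Cocommutativity -/

section

variable {A B D : Type} {a a' : A} {h : a ≠ a'}

section

variable {Q : SymSeq.{u}} {p : WTree Q (Graft (Graft A a B) (Sum.inl ⟨a', h.symm⟩) D)}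
  {p₁ : WTree Q (Graft A a B)} {pD : WTree Q D} {tD bD : p.1.Edge} {φ₁ : p₁.1.V → p.1.V}
  {φD : pD.1.V → p.1.V} {Z : Set p.1.L}

theorem IsSplit.mem_cutSet_graftComm_iff (hs : IsSplit p₁ pD p tD bD φ₁ φD)
    (hZ : ∀ x, x ∈ Z ↔ ∃ y h, p.1.label x = Sum.inl ⟨Sum.inr y, h⟩) (x : p.1.L) (x' : p₁.1.L)
    (hx : p.1.Path (Sum.inr x) (p.1.lowerLeaf tD (p₁.1.label x'))) :
    x ∈ Z ↔ x' ∈ p₁.1.cutSet := by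
  rw [hZ, mem_cutSet]
  by_cases hb : p₁.1.label x' = Sum.inl ⟨a', h.symm⟩
  · rw [hb, lowerLeaf_self] at hx
    have h1 : x ∈ p.1.cutSet := by
      rw [← hs.cut.leaves_top]
      exact hx
    obtain ⟨d, hd⟩ := h1
    rw [hb, hd]
    exact ⟨fun ⟨_, _, h⟩ => (Sum.inr_ne_inl h).elim, fun ⟨_, h⟩ => (Sum.inl_ne_inr h).elim⟩
  · rw [lowerLeaf_of_ne hb] at hx
    have h1 : x = p.1.label.symm (Sum.inl ⟨p₁.1.label x', hb⟩) := Sum.inr_injective (path_inr hx)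
    rw [h1, Equiv.apply_symm_apply]
    constructor
    · rintro ⟨y, _, h⟩
      exact ⟨y, congrArg Subtype.val (Sum.inl_injective h)⟩
    · rintro ⟨y, h⟩
      exact ⟨y, Sum.inr_ne_inl, congrArg Sum.inl (Subtype.ext h)⟩

/-- Leaves over `B` and over `D` are disjoint, so the inclusion is impossible. In this form it
supplies the condition `hZD` of the lemmas on iterated cuts. -/
theorem eq_cutSet_of_subset (hZ : ∀ x, x ∈ Z ↔ ∃ y h, p.1.label x = Sum.inl ⟨Sum.inr y, h⟩)
    (hne : Z.Nonempty) (hsub : Z ⊆ p.1.cutSet) : Z = p.1.cutSet := by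
  obtain ⟨x, hx⟩ := hne
  obtain ⟨d, hd⟩ := hsub hx
  obtain ⟨y, _, hy⟩ := (hZ x).1 hx
  rw [hd] at hy
  exact (Sum.inr_ne_inl hy).elim

theorem ne_cutSet_of_subset {X : Set p.1.L}
    (hZ : ∀ x, x ∈ Z ↔ ∃ y h, p.1.label x = Sum.inl ⟨Sum.inr y, h⟩)
    (hne : X.Nonempty) (hsub : X ⊆ Z) : X ≠ p.1.cutSet := by
  rintro rfl
  obtain ⟨x, d, hd⟩ := hne
  obtain ⟨y, _, hy⟩ := (hZ x).1 (hsub ⟨d, hd⟩)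
  rw [hd] at hy
  exact Sum.inr_ne_inl hy

end

variable {Q : AugmentedOperad.{u}}
  {p : WTree Q.toSymSeq (Graft (Graft A a B) (Sum.inl ⟨a', h.symm⟩) D)}

/-- Cutting off `D` first rescales only the branch of `D`, which contains no edge of the tree over
`B`. So the result is the same as cutting `B` out of `p` directly. -/
theorem IsSplit.mk_upper_eq {p₁ : WTree Q.toSymSeq (Graft A a B)} {pD : WTree Q.toSymSeq D}
    {tD bD : p.1.Edge} {φ₁ : p₁.1.V → p.1.V} {φD : pD.1.V → p.1.V} {Z : Set p.1.L}
    (hs : IsSplit p₁ pD p tD bD φ₁ φD)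
    (hZ : ∀ x, x ∈ Z ↔ ∃ y h, p.1.label x = Sum.inl ⟨Sum.inr y, h⟩)
    {pA : WTree Q.toSymSeq A} {pB pB' : WTree Q.toSymSeq B} {t₁ b₁ : p₁.1.Edge}
    {φA : pA.1.V → p₁.1.V} {φB : pB.1.V → p₁.1.V} (hs₁ : IsSplit pA pB p₁ t₁ b₁ φA φB)
    {tB bB : p.1.Edge} {φB' : pB'.1.V → p.1.V} (hc : p.1.IsCut Z tB bB)
    (h' : IsPiece pB' p (fun y => p.1.leaf (Sum.inl ⟨Sum.inr y, Sum.inr_ne_inl⟩)) bB φB'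
      (p.1.upperDepth p.wt bB)) :
    BarObj.mk pB = BarObj.mk pB' := by
  have hZZ := hs.mem_cutSet_graftComm_iff (h := h) hZ
  have hZD := eq_cutSet_of_subset (h := h) hZ hc.nonempty
  obtain ⟨-, hb⟩ := (hs.lower_isCut (hs.lower_cutSet_iff hZZ) hZD hs₁.cut).unique hc
  refine (hs.lower_upper hZZ hZD hs₁).mk_eq h' ?_ hb fun e he => ?_
  · funext y
    rw [Function.comp_apply, upperLeaf, minorEdge_leaf, lowerLeaf_of_ne Sum.inr_ne_inl]
  · have h1 : p.1.leavesAbove e ⊆ Z := by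
      obtain ⟨e, rfl⟩ := he
      rw [← hc.leaves_bot]
      exact leavesAbove_mono (h'.minor.path_bot e)
    rw [lowerDepth_of_ne (ne_cutSet_of_subset (h := h) hZ (exists_path_leaf e) h1), hb]
    rfl

theorem cutSet_relabel_graftComm
    (T : RTree (Graft (Graft A a B) (Sum.inl ⟨a', h.symm⟩) D)) (x : T.L) :
    x ∈ (T.relabel (graftComm A a a' h B D)).cutSet ↔
      ∃ y h, T.label x = Sum.inl ⟨Sum.inr y, h⟩ := by
  rw [mem_cutSet]
  change (∃ y, graftComm A a a' h B D (T.label x) = _) ↔ _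
  rcases T.label x with ⟨s | y, hs⟩ | d
  · exact ⟨fun ⟨_, h⟩ => (Sum.inl_ne_inr h).elim, fun ⟨_, _, h⟩ =>
      (Sum.inl_ne_inr (congrArg Subtype.val (Sum.inl_injective h))).elim⟩
  · exact ⟨fun _ => ⟨y, hs, rfl⟩, fun _ => ⟨y, rfl⟩⟩
  · exact ⟨fun ⟨_, h⟩ => (Sum.inl_ne_inr h).elim, fun ⟨_, _, h⟩ => (Sum.inr_ne_inl h).elim⟩

theorem mem_cutSet_iff_graftComm
    (T : RTree (Graft (Graft A a B) (Sum.inl ⟨a', h.symm⟩) D)) (x : T.L) :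
    x ∈ T.cutSet ↔
      ∃ d h', (T.relabel (graftComm A a a' h B D)).label x = Sum.inl ⟨Sum.inr d, h'⟩ := by
  rw [mem_cutSet]
  change _ ↔ ∃ d h', graftComm A a a' h B D (T.label x) = _
  rcases T.label x with ⟨s | y, hs⟩ | d
  · exact ⟨fun ⟨_, h⟩ => (Sum.inl_ne_inr h).elim, fun ⟨_, _, h⟩ =>
      (Sum.inl_ne_inr (congrArg Subtype.val (Sum.inl_injective h))).elim⟩
  · exact ⟨fun ⟨_, h⟩ => (Sum.inl_ne_inr h).elim, fun ⟨_, _, h⟩ => (Sum.inr_ne_inl h).elim⟩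
  · exact ⟨fun _ => ⟨d, Sum.inr_ne_inl, rfl⟩, fun _ => ⟨d, rfl⟩⟩

theorem decomp_cocomm [Finite A] [Finite B] [Finite D] (hQ : Q.StronglyAugmented)
    (p : WTree Q.toSymSeq (Graft (Graft A a B) (Sum.inl ⟨a', h.symm⟩) D)) :
    Smash.swapRight (Smash.map (BarObj.decompMap hQ A a B) (BasedMap.id _) p.decomp) =
      Smash.map (BarObj.decompMap hQ A a' D) (BasedMap.id _)
        (decomp (p.relabel (graftComm A a a' h B D))) := by
  have hZ := cutSet_relabel_graftComm (h := h) p.1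
  have hZ' := mem_cutSet_iff_graftComm (h := h) p.1
  by_cases hl : p.IsLive
  swap
  · rw [decomp_of_not_isLive hl]
    by_cases hl' : IsLive (p.relabel (graftComm A a a' h B D))
    · obtain ⟨p₂, pB', tB, bB, φ₂, φB', hs'⟩ := hl'.exists_isSplit
      have hZZ' := hs'.mem_cutSet_graftComm_iff (h := h.symm) hZ'
      rw [hs'.decomp_eq]
      exact (Smash.mk_eq_pt (Or.inl (decomp_of_not_isLive
        (mt (hs'.exists_of_lower_isLive hZZ') hl)))).symm
    · rw [decomp_of_not_isLive hl']
      rfl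
  obtain ⟨p₁, pD, tD, bD, φ₁, φD, hs⟩ := hl.exists_isSplit
  have hZZ := hs.mem_cutSet_graftComm_iff (h := h) hZ
  rw [hs.decomp_eq]
  change Smash.swapRight (Smash.mk p₁.decomp (BarObj.mk pD)) = _
  by_cases hl' : IsLive (p.relabel (graftComm A a a' h B D))
  swap
  · rw [decomp_of_not_isLive hl', decomp_of_not_isLive (mt (hs.exists_of_lower_isLive hZZ) hl')]
    exact Smash.mk_pt_right _
  obtain ⟨p₂, pB', tB, bB, φ₂, φB', hs'⟩ := hl'.exists_isSplit
  have hZZ' := hs'.mem_cutSet_graftComm_iff (h := h.symm) hZ'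
  have hZD := eq_cutSet_of_subset (h := h) hZ hs'.cut.nonempty
  have hZD' := eq_cutSet_of_subset (h := h.symm) (p := p.relabel (graftComm A a a' h B D)) hZ'
    hs.cut.nonempty
  obtain ⟨pA, pB, t₁, b₁, φA, φB, hs₁⟩ := (hs.lower_isLive hZZ hZD hl').exists_isSplit
  obtain ⟨pA', pD', t₂, b₂, φA', φD', hs₂⟩ := (hs'.lower_isLive hZZ' hZD' hl).exists_isSplit
  rw [hs'.decomp_eq, hs₁.decomp_eq]
  change Smash.mk (Smash.mk (BarObj.mk pA) (BarObj.mk pD)) (BarObj.mk pB) =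
    Smash.mk p₂.decomp (BarObj.mk pB')
  rw [hs₂.decomp_eq]
  obtain ⟨ht, hb⟩ :=
    (hs.lower_isCut (hs.lower_cutSet_iff hZZ) hZD hs₁.cut).unique hs'.cut.of_relabel
  obtain ⟨ht', hb'⟩ :=
    (hs'.lower_isCut (hs'.lower_cutSet_iff hZZ') hZD' hs₂.cut).of_relabel.unique hs.cut
  have hB : BarObj.mk pB = BarObj.mk pB' :=
    hs.mk_upper_eq (h := h) hZ hs₁ hs'.cut.of_relabel hs'.upper.of_relabel
  have hD : BarObj.mk pD' = BarObj.mk pD :=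
    hs'.mk_upper_eq (h := h.symm) hZ' hs₂ (hs.cut.relabel _) (hs.upper.to_relabel _)
  have hA : BarObj.mk pA = BarObj.mk pA' := by
    refine (hs.lower_lower hZZ hZD hs₁).mk_eq (hs'.lower_lower hZZ' hZD' hs₂).of_relabel ?_ rfl
      fun e _ => ?_
    · funext s
      rw [Function.comp_apply, Function.comp_apply]
      by_cases hs1 : s = a
      · subst hs1
        rw [lowerLeaf_self, ht, lowerLeaf_of_ne h, minorEdge_leaf]
        exact lowerLeaf_self.symm
      · by_cases hs2 : s = a'
        · subst hs2
          rw [lowerLeaf_self, ht', lowerLeaf_of_ne hs1, minorEdge_leaf]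
          exact lowerLeaf_self
        · rw [lowerLeaf_of_ne hs1, lowerLeaf_of_ne hs2, minorEdge_leaf, minorEdge_leaf,
            lowerLeaf_of_ne fun h' => hs2 (congrArg Subtype.val (Sum.inl_injective h')),
            lowerLeaf_of_ne fun h' => hs1 (congrArg Subtype.val (Sum.inl_injective h'))]
          rfl
    · rw [ht, hb, ht', hb']
      -- The two branches share no edge and are rescaled independently, so the order does not
      -- matter.
      by_cases h1 : p.1.leavesAbove e = (p.1.relabel (graftComm A a a' h B D)).cutSet
      · have h2 : p.1.leavesAbove e ≠ p.1.cutSet :=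
          ne_cutSet_of_subset (h := h) hZ (exists_path_leaf e) h1.subset
        exact (if_pos h1).trans (if_neg h2).symm
      · refine (if_neg h1).trans ?_
        by_cases h2 : p.1.leavesAbove e = p.1.cutSet
        · exact (if_pos h2).symm
        · exact (lowerDepth_of_ne h2).trans ((if_neg h2).trans (lowerDepth_of_ne h1)).symm
  rw [hA, hB, hD]

end

end WTree

/-- The cooperad structure of the bar construction. -/
def barCooperad {Q : AugmentedOperad.{u}} (hQ : Q.StronglyAugmented) :
    CooperadStructure (bar Q) where
  counit := BarObj.counit Q
  decomp A _ a B _ := BarObj.decompMap hQ A a B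
  decomp_map f g a x := by
    induction x using Quot.ind with
    | mk x =>
      rcases x with x | p
      · rfl
      · exact WTree.decomp_relabel f g p
  coassoc a b x := by
    induction x using Quot.ind with
    | mk x =>
      rcases x with x | p
      · rfl
      · exact WTree.decomp_coassoc hQ p
  cocomm a a' h x := by
    induction x using Quot.ind with
    | mk x =>
      rcases x with x | p
      · rfl
      · exact WTree.decomp_cocomm hQ p
  counit_left x := by
    induction x using Quot.ind with
    | mk x =>
      rcases x with x | p
      · rfl
      · exact WTree.decomp_counit_left hQ p
  counit_right a x := by
    induction x using Quot.ind with
    | mk x =>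
      rcases x with x | p
      · rfl
      · exact WTree.decomp_counit_right hQ a p

end OpBar
end

/-! ### The cooperad structure and its explicit decompositions -/

open OpBar
theorem mainTheorem2 (Q : AugmentedOperad.{u}) (hQ : Q.StronglyAugmented) :
    ∃ K : CooperadStructure (bar Q),
      (∀ x : (bar Q).obj Unit, K.counit x = false ↔ x = Based.pt) ∧
      ∀ (A : Type) [Finite A] (a : A) (B : Type) [Finite B] (p : WTree Q.toSymSeq (Graft A a B)),
        ((∀ e, p.1.leavesAbove e ≠ p.cutLeaves) →
          K.decomp A a B (BarObj.mk p) = Based.pt) ∧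
        (p.1.branchWeight p.wt p.cutLeaves = 0 →
          K.decomp A a B (BarObj.mk p) = Based.pt) ∧
        ((∃ e, p.1.leavesAbove e = p.cutLeaves) →
          p.1.branchWeight p.wt p.cutLeaves ≠ 0 →
          ∃ (pA : WTree Q.toSymSeq A) (pB : WTree Q.toSymSeq B) (top bot : p.1.Edge)
            (φA : pA.1.V → p.1.V) (φB : pB.1.V → p.1.V),
            WTree.IsDegrafting pA pB p top bot φA φB ∧
            K.decomp A a B (BarObj.mk p) = Smash.mk (BarObj.mk pA) (BarObj.mk pB)) := by
  refine ⟨barCooperad hQ, BarObj.counit_eq_false_iff hQ, fun A _ a B _ p => ⟨fun h => ?_,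
    fun h => ?_, fun _ h => ?_⟩⟩
  · exact WTree.decomp_of_not_isLive fun ⟨e, he, _⟩ => h e he
  · exact WTree.decomp_of_not_isLive fun ⟨e, he, hne⟩ =>
      hne ((RTree.branchWeight_eq_zero_iff p.wt_nonneg _).1 h e he)
  · have hl : p.IsLive := by
      by_contra hl
      refine h ((RTree.branchWeight_eq_zero_iff p.wt_nonneg _).2 fun e he => ?_)
      by_contra hne
      exact hl ⟨e, he, hne⟩
    obtain ⟨pA, pB, top, bot, φA, φB, hs⟩ := hl.exists_isSplit
    exact ⟨pA, pB, top, bot, φA, φB, hs.isDegrafting, hs.decomp_eq⟩
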